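/- Let $d\ge 2$ and fix $1\le k\le d-1$. Let $\nu_j$ be the $j$-dimensional volume (Hausdorff) measure in $\mathbb R^d$, normalized to agree with Lebesgue measure on $j$-flats ($\nu_0$ is counting measure), and $|\cdot|=\nu_d$. Let $\mathcal C'_d$ be the set of non-empty compact convex subsets of $\mathbb R^d$ with the Borel $\sigma$-algebra of the Hausdorff metric. A tessellation is a sequence of sets in $\mathcal C'_d$ (cells) with non-empty, pairwise disjoint interiors that covers $\mathbb R^d$ and of which only finitely many meet any given compact set; the cells are then polytopes. A random tessellation is a sequence of random elements of $\mathcal C'_d$ that is almost surely a tessellation; it is stationary (motion-invariant) if the law of the point process of its cells is invariant under translations (under proper rigid motions). For a polytope $C$ let $C^{(j)}$ be the union of its $j$-faces, and for a tessellation $X$ let $X^{(j)}$ be the union of its $j$-facets, i.e. of the $j$-dimensional intersections of finitely many cells. Let $X=\{\Xi_n\}_{n\ge1}$ be a stationary random tessellation, $X_0$ a motion-invariant random tessellation, and $X_1,X_2,\dots$ independent copies of $X_0$ such that $(X_n)_{n\ge1}$ is independent of the sequence $(\Xi_n)_{n\ge1}$. For $W\subseteq\mathbb R^d$ put $$Z_k(W)=\sum_{n\ge1}\nu_{k-1}\bigl(X_n^{(d-1)}\cap\Xi_n^{(k)}\cap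 W\bigr).$$ Let $\alpha:\mathcal C'_d\to\mathbb R^d$ be measurable with $\alpha(C)\in C$ and $\alpha(C+x)=\alpha(C)+x$, and let $$\gamma=\mathbb E\,\#\{n:\alpha(\Xi_n)\in[0,1)^d\},\qquad P^0(B)=\gamma^{-1}\,\mathbb E\,\#\{n:\alpha(\Xi_n)\in[0,1)^d,\ \Xi_n-\alpha(\Xi_n)\in B\},$$ $$\lambda_0=\mathbb E\,\nu_{k-1}\bigl(X_0^{(d-1)}\cap([0,1)^k\times\{0\}^{d-k})\bigr),\qquad \mu_k=\mathbb E\,\nu_k\bigl(X^{(k)}\cap[0,1)^d\bigr).$$ Assume that: (a) there is an integer $m_k\ge1$ such that for every $W\in\mathcal C'_d$ with $|W|>0$, almost surely $m_k\,\nu_k(X^{(k)}\cap W)=\sum_{n\ge1}\nu_k(\Xi_n^{(k)}\cap W)$; (b) $0<\gamma<\infty$, $\mu_k<\infty$ and $\lambda_0<\infty$; (c) $\mathbb E\,\nu_k^2(X^{(k)}\cap[0,1]^d)<\infty$ and $\int\mathbb E\,\nu_{k-1}^2(X_0^{(d-1)}\cap C^{(k)})\,P^0(dC)<\infty$. Let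 $W_1\in\mathcal C'_d$ contain a ball $\{x:\|x\|\le r\}$ with $r>0$, put $W_\varrho=\varrho W_1$ for $\varrho>0$, and assume that the limit $$\tau_{k,d}^2=\lim_{\varrho\to\infty}\frac{\operatorname{Var}\nu_k(X^{(k)}\cap W_\varrho)}{|W_\varrho|}$$ exists in $\mathbb R$. Then, for every $\varrho>0$, $Z_k(W_\varrho)$ is almost surely finite and has a finite second moment; the function $C\mapsto\operatorname{Var}\nu_{k-1}(X_0^{(d-1)}\cap C^{(k)})$ is $P^0$-integrable; and the limit $\lim_{\varrho\to\infty}\operatorname{Var}(Z_k(W_\varrho))/|W_\varrho|$ exists and equals $$\bigl(\tau_0^{(k,d)}\bigr)^2+(\lambda_0m_k)^2\,\tau_{k,d}^2,\qquad\text{where}\quad \bigl(\tau_0^{(k,d)}\bigr)^2=\gamma\int\operatorname{Var}\bigl(\nu_{k-1}(X_0^{(d-1)}\cap C^{(k)})\bigr)\,P^0(dC).$$ -/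

import Mathlib

open MeasureTheory ProbabilityTheory Filter Topology
open scoped ENNReal Pointwise

namespace Tess

/-- Euclidean space of dimension `d`. -/
abbrev E (d : ℕ) := EuclideanSpace ℝ (Fin d)

/-- The space of non-empty compact convex subsets of `E d`. -/
abbrev Body (d : ℕ) := ConvexBody (E d)

/-- Convex bodies carry the Borel σ-algebra of the Hausdorff metric. On this space it coincides with
the trace of the Borel σ-algebra of the Fell topology on closed sets. -/
noncomputable instance instMeasurableSpaceBody (d : ℕ) : MeasurableSpace (Body d) := borel (Body d)

instance instBorelSpaceBody (d : ℕ) : BorelSpace (Body d) := ⟨rfl⟩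

/-- The image of a convex body under a rigid motion. -/
def moveBody {d : ℕ} (g : E d ≃ᵃⁱ[ℝ] E d) (C : Body d) : Body d where
  carrier := g '' (C : Set (E d))
  convex' := C.convex.affine_image (g.toAffineEquiv : E d →ᵃ[ℝ] E d)
  isCompact' := C.isCompact.image g.continuous
  nonempty' := C.nonempty.image g

/-- The translate `C + x`. -/
noncomputable def translate {d : ℕ} (x : E d) (C : Body d) : Body d :=
  moveBody (AffineIsometryEquiv.constVAdd ℝ (E d) x) C

/-- A motion of `E d` is proper if its linear part is a rotation. -/
def IsProperMotion {d : ℕ} (g : E d ≃ᵃⁱ[ℝ] E d) : Prop :=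
  LinearMap.det (g.linearIsometryEquiv.toLinearEquiv : E d →ₗ[ℝ] E d) = 1

/-- A (deterministic) tessellation, given by an enumeration of its cells. -/
structure IsTessellation {d : ℕ} (c : ℕ → Body d) : Prop where
  interior_nonempty : ∀ n, (interior (c n : Set (E d))).Nonempty
  disjoint_interior : ∀ n m, n ≠ m →
    Disjoint (interior (c n : Set (E d))) (interior (c m : Set (E d)))
  cover : ⋃ n, (c n : Set (E d)) = Set.univ
  locallyFinite : ∀ K : Set (E d), IsCompact K → {n | ((c n : Set (E d)) ∩ K).Nonempty}.Finite

/-- The dimension of (the affine hull of) a set. -/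
noncomputable def dimSet {d : ℕ} (F : Set (E d)) : ℕ := Module.finrank ℝ (vectorSpan ℝ F)

/-- `C^(k)`, the union of the `k`-faces of `C`: the `k`-dimensional intersections of the polytope
`C` with supporting hyperplanes. -/
def faceUnion {d : ℕ} (k : ℕ) (C : Body d) : Set (E d) :=
  ⋃₀ {F | F.Nonempty ∧ IsExposed ℝ (C : Set (E d)) F ∧ dimSet F = k}

/-- `X^(k)`, the union of the `k`-facets of a tessellation: the `k`-dimensional intersections of
finitely many cells. -/
def facetUnion {d : ℕ} (k : ℕ) (c : ℕ → Body d) : Set (E d) :=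
  ⋃₀ {F | F.Nonempty ∧ dimSet F = k ∧
    ∃ I : Finset ℕ, I.Nonempty ∧ F = ⋂ i ∈ I, (c i : Set (E d))}

/-- `[0,1)^d`. -/
def cube (d : ℕ) : Set (E d) := {x | ∀ i, x i ∈ Set.Ico (0 : ℝ) 1}

/-- `[0,1]^d`. -/
def closedCube (d : ℕ) : Set (E d) := {x | ∀ i, x i ∈ Set.Icc (0 : ℝ) 1}

/-- `[0,1)^k` inside the coordinate subspace `ℝ^k × {0}` of `E d`. -/
def flatCube (d k : ℕ) : Set (E d) :=
  {x | ∀ i : Fin d, ((i : ℕ) < k → x i ∈ Set.Ico (0 : ℝ) 1) ∧ (k ≤ (i : ℕ) → x i = 0)}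

/-- The counting measure `∑ₙ δ_{cₙ}` on the space of convex bodies. It does not depend on the
enumeration of the cells. -/
noncomputable def pointProcess {d : ℕ} (c : ℕ → Body d) : Measure (Body d) :=
  Measure.sum fun n => Measure.dirac (c n)

section random

variable {Ω : Type*} [MeasurableSpace Ω]

/-- A random tessellation: a sequence of random convex bodies which is almost surely a
tessellation. -/
structure IsRandomTessellation {d : ℕ} (X : ℕ → Ω → Body d) (P : Measure Ω) : Prop where
  measurable : ∀ n, Measurable (X n)
  isTessellation : ∀ᵐ ω ∂P, IsTessellation fun n => X n ω

/-- The law of the point process of cells is invariant under translations. -/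
def IsStationary {d : ℕ} (X : ℕ → Ω → Body d) (P : Measure Ω) : Prop :=
  ∀ x : E d, IdentDistrib (fun ω => pointProcess fun n => translate x (X n ω))
    (fun ω => pointProcess fun n => X n ω) P P

/-- The law of the point process of cells is invariant under translations and rotations. -/
def IsMotionInvariant {d : ℕ} (X : ℕ → Ω → Body d) (P : Measure Ω) : Prop :=
  ∀ g : E d ≃ᵃⁱ[ℝ] E d, IsProperMotion g →
    IdentDistrib (fun ω => pointProcess fun n => moveBody g (X n ω))
      (fun ω => pointProcess fun n => X n ω) P P

/-- The data of an `X/X₀`-nesting: an initial tessellation `X` with cells `X n`, and component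
tessellations `Y n` with cells `Y n l`, nested in the cells `X n`. The components are
independent copies of `X₀` (as point processes of cells), and independent of the sequence `X`. -/
structure IsNesting {d : ℕ} (X X₀ : ℕ → Ω → Body d) (Y : ℕ → ℕ → Ω → Body d)
    (P : Measure Ω) : Prop where
  initial : IsRandomTessellation X P
  generic : IsRandomTessellation X₀ P
  component : ∀ n, IsRandomTessellation (Y n) P
  copies : ∀ n, IdentDistrib (fun ω => pointProcess fun l => Y n l ω)
    (fun ω => pointProcess fun l => X₀ l ω) P P
  indep_components : iIndepFun (fun n ω => pointProcess fun l => Y n l ω) P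
  indep_initial : IndepFun (fun ω n => X n ω) (fun ω n => pointProcess fun l => Y n l ω) P

/-- An associated point: a measurable, translation-covariant choice of a point in each body. -/
structure IsAssociatedPoint {d : ℕ} (α : Body d → E d) : Prop where
  measurable : Measurable α
  mem : ∀ C, α C ∈ C
  translate : ∀ C x, α (translate x C) = α C + x

/-- The intensity measure of the point process of cells, `A ↦ 𝔼 #{n : Xₙ ∈ A}`. -/
noncomputable def cellIntensityMeasure {d : ℕ} (X : ℕ → Ω → Body d) (P : Measure Ω) :
    Measure (Body d) :=
  Measure.sum fun n => P.map (X n)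

/-- The cell intensity `γ = 𝔼 #{n : α(Xₙ) ∈ [0,1)^d}`. -/
noncomputable def cellIntensity {d : ℕ} (α : Body d → E d) (X : ℕ → Ω → Body d)
    (P : Measure Ω) : ℝ≥0∞ :=
  cellIntensityMeasure X P {C | α C ∈ cube d}

/-- The Palm mark distribution, i.e. the law of the typical cell:
`P⁰(B) = γ⁻¹ 𝔼 #{n : α(Xₙ) ∈ [0,1)^d, Xₙ - α(Xₙ) ∈ B}`. -/
noncomputable def palm {d : ℕ} (α : Body d → E d) (X : ℕ → Ω → Body d) (P : Measure Ω) :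
    Measure (Body d) :=
  (cellIntensity α X P)⁻¹ •
    ((cellIntensityMeasure X P).restrict {C | α C ∈ cube d}).map fun C => translate (-α C) C

/-- `ν_k(X^(k) ∩ B)`. -/
noncomputable def facetVolume {d : ℕ} (k : ℕ) (X : ℕ → Ω → Body d) (B : Set (E d)) (ω : Ω) :
    ℝ≥0∞ :=
  μHE[k] (facetUnion k (fun n => X n ω) ∩ B)

/-- `ν_{k-1}(X₀^(d-1) ∩ B)`. -/
noncomputable def traceVolume {d : ℕ} (k : ℕ) (X₀ : ℕ → Ω → Body d) (B : Set (E d)) (ω : Ω) :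
    ℝ≥0∞ :=
  μHE[k - 1] (facetUnion (d - 1) (fun n => X₀ n ω) ∩ B)

/-- `Z_k(W) = ∑ₙ ν_{k-1}(Yₙ^(d-1) ∩ Xₙ^(k) ∩ W)`. -/
noncomputable def Z {d : ℕ} (k : ℕ) (X : ℕ → Ω → Body d) (Y : ℕ → ℕ → Ω → Body d)
    (W : Set (E d)) (ω : Ω) : ℝ≥0∞ :=
  ∑' n, traceVolume k (Y n) (faceUnion k (X n ω) ∩ W) ω

/-- The intensity `λ₀ = 𝔼 ν_{k-1}(X₀^(d-1) ∩ ℝ^k ∩ [0,1)^k)`. -/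
noncomputable def traceIntensity {d : ℕ} (k : ℕ) (X₀ : ℕ → Ω → Body d) (P : Measure Ω) : ℝ≥0∞ :=
  ∫⁻ ω, traceVolume k X₀ (flatCube d k) ω ∂P

/-- The intensity `μ_k = 𝔼 ν_k(X^(k) ∩ [0,1)^d)`. -/
noncomputable def facetIntensity {d : ℕ} (k : ℕ) (X : ℕ → Ω → Body d) (P : Measure Ω) : ℝ≥0∞ :=
  ∫⁻ ω, facetVolume k X (cube d) ω ∂P

/-- Condition F in dimension `k` with multiplicity `m`: each `k`-facet of `X` lies in `m` of the
`k`-faces of the cells. -/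
def ConditionF {d : ℕ} (k m : ℕ) (X : ℕ → Ω → Body d) (P : Measure Ω) : Prop :=
  1 ≤ m ∧ ∀ W : Body d, 0 < volume (W : Set (E d)) →
    ∀ᵐ ω ∂P, (m : ℝ≥0∞) * facetVolume k X W ω = ∑' n, μHE[k] (faceUnion k (X n ω) ∩ (W : Set (E d)))

/-- The variance of `ν_{k-1}(X₀^(d-1) ∩ C^(k))`, for a fixed polytope `C`. -/
noncomputable def traceVariance {d : ℕ} (k : ℕ) (X₀ : ℕ → Ω → Body d) (P : Measure Ω)
    (C : Body d) : ℝ :=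
  variance (fun ω => (traceVolume k X₀ (faceUnion k C) ω).toReal) P

end random

end Tess

/-!
Given the initial tessellation `X`, the summands `ν_{k-1}(Yₙ^(d-1) ∩ Xₙ^(k) ∩ W)` of `Z_k(W)` are
independent, with first and second moments depending
on `Xₙ` alone (`traceMoment`). Hence `Var Z_k(W)` is the variance of the conditional expectation
plus the mean of the sum of conditional variances (`lintegral_sq_condIndep_tsum`,
`IsNesting.variance_Z`).

*Conditional expectation.* By motion invariance and uniqueness of Haar measure, the mean trace of
`X₀^(d-1)` in a `k`-flat is `λ₀` times `k`-dimensional Lebesgue measure, so its mean trace in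
`C^(k) ∩ W` is `λ₀ ν_k(C^(k) ∩ W)` (`lintegral_facetUnion_faceUnion`). Two given `k`-flats with
coordinates are related by a *proper* motion since `k < d`. By condition F the conditional
expectation is `λ₀ m ν_k(X^(k) ∩ W)`, whose normalized variance tends to `(λ₀ m)² τ²` by assumption.

*Conditional variances.* By the refined Campbell formula (`lintegral_cellIntensityMeasure_eq_palm`)
the mean of `∑ₙ f(Xₙ)` is `γ` times the integral of `f(C + x)` over `x ∈ ℝ^d` and the typical cell
`C`. For `f` a moment of the trace in the window `ρ W₁`, the average over `x` tends to the moment on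
the whole of `C`, because most translates `C + x` which meet the window lie in it
(`tendsto_average`), and it never exceeds that moment. Dominated convergence applies to the second
moment and to the squared first moment separately (`tendsto_lintegral_traceMoment`); the difference
of the limits is `γ ∫ Var dP⁰`.

*Measurability.* All functionals have to be measurable with respect to the point process of cells,
which is only a measure on the space of convex bodies. The Hausdorff measure of a random compact set
is measurable as soon as the events that the set hits a given closed set are
(`exists_measurable_hausdorffMeasure`). For the `k`-faces of a cell these events are described by
outer normals, `C^(k)` being the set of points of `C` with `d - k` linearly independent normals
(`IsPolytopal.faceUnion_eq_skeleton`), and for the `(d-1)`-facets by pairs of cells meeting in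
dimension `d - 1`, which are integrated with respect to an s-finite kernel that recovers the cells
from their point process (`cellKernel`). Cells of a tessellation are polytopes in the sense of
`IsPolytopal` because they are separated from each of the finitely many cells nearby.
-/

namespace Tess

/-! ### Measurability of the Hausdorff measure of a random compact set -/

/-- A family of events which behaves like "a random compact set hits `K`" carries the Hausdorff
measure of that set as a measurable function: the `δ`-content of a compact set is an infimum over
countably many finite covers by finite unions of basic open sets, and a compact set is covered by
an open set iff it misses the complement. -/
theorem exists_measurable_hausdorffMeasure {X : Type*} [MetricSpace X] [SecondCountableTopology X]
    [MeasurableSpace X] [BorelSpace X] {s : ℝ} (hs : 0 ≤ s) {T : Type*} [MeasurableSpace T]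
    (Hit : Set X → Set T) (hHit : ∀ K, IsClosed K → MeasurableSet (Hit K)) :
    ∃ Φ : T → ℝ≥0∞, Measurable Φ ∧ ∀ t S, IsCompact S →
      (∀ K, IsClosed K → (t ∈ Hit K ↔ (S ∩ K).Nonempty)) → Φ t = μH[s] S := by
  classical
  let ι := TopologicalSpace.countableBasis X
  let U : Finset ι → Set X := fun J => ⋃ b ∈ J, (b : Set X)
  have hUo : ∀ J, IsOpen (U J) := fun J => isOpen_biUnion fun b _ =>
    TopologicalSpace.isOpen_of_mem_countableBasis b.2
  let cost : Set X → ℝ≥0∞ := fun V => ⨆ _ : V.Nonempty, Metric.ediam V ^ s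
  have hcost : ∀ {V V' : Set X}, V ⊆ V' → cost V ≤ cost V' := by
    intro V V' h
    refine iSup_le fun hV => le_iSup_of_le (hV.mono h) ?_
    exact ENNReal.rpow_le_rpow (Metric.ediam_mono h) hs
  -- The cost of the empty set has to vanish even for `s = 0`, where `0 ^ 0 = 1`. A finset `t` of
  -- finsets stands for a finite cover by the sets `U J`, and `K t` is the part left uncovered.
  let K : Finset (Finset ι) → Set X := fun t => (⋃ J ∈ t, U J)ᶜ
  have hK : ∀ t, IsClosed (K t) := fun t =>
    (isOpen_biUnion fun J _ => hUo J).isClosed_compl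
  let Φ : T → ℝ≥0∞ := fun x => ⨆ n : ℕ, ⨅ t : Finset (Finset ι),
    ⨅ _ : ∀ J ∈ t, Metric.ediam (U J) ≤ (n : ℝ≥0∞)⁻¹,
      if x ∈ Hit (K t) then ∞ else ∑ J ∈ t, cost (U J)
  refine ⟨Φ, ?_, ?_⟩
  · refine .iSup fun n => .iInf fun t => .iInf fun _ => ?_
    exact Measurable.ite (hHit _ (hK t)) measurable_const measurable_const
  intro x S hS hx
  have hcov : ∀ t, x ∉ Hit (K t) ↔ S ⊆ ⋃ J ∈ t, U J := by
    intro t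
    rw [hx _ (hK t), Set.not_nonempty_iff_eq_empty, ← Set.disjoint_iff_inter_eq_empty,
      Set.disjoint_compl_right_iff_subset]
  apply le_antisymm
  · refine iSup_le fun n => ?_
    rw [Measure.hausdorffMeasure_apply]
    set r : ℝ≥0∞ := (n : ℝ≥0∞)⁻¹ / 2 with hr
    have hr0 : 0 < r := by
      rw [hr]; exact ENNReal.div_pos (by simp) (by simp)
    have hrmin : min r 1 < (n : ℝ≥0∞)⁻¹ := by
      rcases Nat.eq_zero_or_pos n with rfl | hn
      · simp [r]
      · refine lt_of_le_of_lt (min_le_left _ _) ?_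
        exact ENNReal.half_lt_self (by simp) (by simp; omega)
    refine le_iSup₂_of_le (min r 1) (lt_min hr0 one_pos) ?_
    refine le_iInf fun t => le_iInf fun hSt => le_iInf fun ht => ?_
    refine ENNReal.le_of_forall_pos_le_add fun ε hε hfin => ?_
    obtain ⟨ε', hε'0, hε'⟩ := ENNReal.exists_pos_sum_of_countable
      (ε := (ε : ℝ≥0∞)) (by simpa using hε.ne') ℕ
    -- An arbitrary countable cover is fattened to an open one at small extra cost; compactness then
    -- yields finitely many basic sets, which are grouped by the member of the cover they lie in.
    have hV : ∀ i, ∃ V : Set X, IsOpen V ∧ t i ⊆ V ∧ Metric.ediam V ≤ (n : ℝ≥0∞)⁻¹ ∧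
        cost V ≤ cost (t i) + ε' i := by
      intro i
      have hti : Metric.ediam (t i) < ∞ :=
        ((ht i).trans (min_le_right _ _)).trans_lt ENNReal.one_lt_top
      have hcont : Tendsto (fun δ : NNReal => Metric.ediam (t i) + 2 * (δ : ℝ≥0∞)) (𝓝[>] 0)
          (𝓝 (Metric.ediam (t i))) := by
        have : Continuous fun δ : NNReal => Metric.ediam (t i) + 2 * (δ : ℝ≥0∞) := by
          refine continuous_const.add ?_
          exact (ENNReal.continuous_const_mul (by simp)).comp ENNReal.continuous_coe
        simpa using (this.tendsto 0).mono_left nhdsWithin_le_nhds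
      have h1 : ∀ᶠ δ : NNReal in 𝓝[>] 0, Metric.ediam (t i) + 2 * (δ : ℝ≥0∞) < (n : ℝ≥0∞)⁻¹ :=
        hcont.eventually_lt_const ((ht i).trans_lt hrmin)
      have h2 : ∀ᶠ δ : NNReal in 𝓝[>] 0, (Metric.ediam (t i) + 2 * (δ : ℝ≥0∞)) ^ s <
          Metric.ediam (t i) ^ s + ε' i := by
        refine ((ENNReal.continuous_rpow_const.tendsto _).comp hcont).eventually_lt_const ?_
        refine ENNReal.lt_add_right ?_ (by simpa using (hε'0 i).ne')
        exact ENNReal.rpow_ne_top_of_nonneg hs hti.ne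
      obtain ⟨δ, ⟨h1, h2⟩, hδ⟩ := ((h1.and h2).and self_mem_nhdsWithin).exists
      have hδ' : (0 : ℝ) < δ := hδ
      refine ⟨Metric.thickening δ (t i), Metric.isOpen_thickening,
        Metric.self_subset_thickening hδ' _, (Metric.ediam_thickening_le δ).trans h1.le, ?_⟩
      refine iSup_le fun hne => ?_
      have hti' : (t i).Nonempty := by
        by_contra h
        rw [Set.not_nonempty_iff_eq_empty] at h
        simp [h] at hne
      have : cost (t i) = Metric.ediam (t i) ^ s := by simp [cost, hti']
      rw [this]
      exact (ENNReal.rpow_le_rpow (Metric.ediam_thickening_le δ) hs).trans h2.le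
    choose V hVo htV hVd hVc using hV
    let A := {p : ι × ℕ // (p.1 : Set X) ⊆ V p.2}
    obtain ⟨F, hF⟩ := hS.elim_finite_subcover (fun p : A => (p.1.1 : Set X))
      (fun p => TopologicalSpace.isOpen_of_mem_countableBasis p.1.1.2) (by
        intro y hy
        obtain ⟨i, hi⟩ := Set.mem_iUnion.1 (hSt hy)
        obtain ⟨b, hb, hyb, hbV⟩ :=
          (TopologicalSpace.isBasis_countableBasis X).exists_subset_of_mem_open
            (htV i hi) (hVo i)
        exact Set.mem_iUnion.2 ⟨⟨(⟨b, hb⟩, i), hbV⟩, hyb⟩)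
    let J : ℕ → Finset ι := fun i => (F.filter fun p => p.1.2 = i).image fun p => p.1.1
    have hJ : ∀ i, U (J i) ⊆ V i := by
      intro i
      refine Set.iUnion₂_subset fun b hb => ?_
      obtain ⟨p, hp, rfl⟩ := Finset.mem_image.1 hb
      obtain ⟨_, rfl⟩ := Finset.mem_filter.1 hp
      exact p.2
    let I : Finset ℕ := F.image fun p => p.1.2
    refine iInf₂_le_of_le (I.image J) ?_ ?_
    · intro j hj
      obtain ⟨i, _, rfl⟩ := Finset.mem_image.1 hj
      exact (Metric.ediam_mono (hJ i)).trans (hVd i)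
    have hcover : S ⊆ ⋃ j ∈ I.image J, U j := by
      intro y hy
      obtain ⟨p, hp, hyp⟩ := Set.mem_iUnion₂.1 (hF hy)
      refine Set.mem_iUnion₂.2 ⟨J p.1.2, Finset.mem_image_of_mem _
        (Finset.mem_image.2 ⟨p, hp, rfl⟩), Set.mem_iUnion₂.2 ⟨p.1.1, ?_, hyp⟩⟩
      exact Finset.mem_image.2 ⟨p, Finset.mem_filter.2 ⟨hp, rfl⟩, rfl⟩
    rw [if_neg ((hcov _).2 hcover)]
    calc ∑ j ∈ I.image J, cost (U j) ≤ ∑ i ∈ I, cost (U (J i)) :=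
          Finset.sum_image_le_of_nonneg (fun _ _ => zero_le)
      _ ≤ ∑ i ∈ I, (cost (t i) + ε' i) :=
          Finset.sum_le_sum fun i _ => (hcost (hJ i)).trans (hVc i)
      _ ≤ ∑' i, (cost (t i) + ε' i) := ENNReal.sum_le_tsum _
      _ = ∑' i, cost (t i) + ∑' i, (ε' i : ℝ≥0∞) := ENNReal.tsum_add
      _ ≤ _ := by gcongr
  · have heq : μH[s] S = ⨆ n : ℕ, OuterMeasure.mkMetric'.pre
        (fun V : Set X => Metric.ediam V ^ s) (n : ℝ≥0∞)⁻¹ S := by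
      rw [Measure.hausdorffMeasure, ← Measure.coe_toOuterMeasure, Measure.mkMetric_toOuterMeasure,
        OuterMeasure.mkMetric, OuterMeasure.mkMetric'.eq_iSup_nat]
      simp
    rw [heq]
    refine iSup_mono fun n => le_iInf fun t => le_iInf fun ht => ?_
    split_ifs with h
    · exact le_top
    refine (measure_mono ((hcov t).1 h)).trans ((measure_biUnion_finset_le _ _).trans ?_)
    refine Finset.sum_le_sum fun j hj => ?_
    rcases (U j).eq_empty_or_nonempty with h0 | h0
    · simp [h0]
    · simp only [cost, h0, iSup_pos]
      exact OuterMeasure.mkMetric'.pre_le (ht j hj)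

/-- The version of `exists_measurable_hausdorffMeasure` for the normalized Hausdorff measure. -/
theorem exists_measurable_euclideanHausdorffMeasure {X : Type*} [MetricSpace X]
    [SecondCountableTopology X] [MeasurableSpace X] [BorelSpace X] (j : ℕ) {T : Type*}
    [MeasurableSpace T] (Hit : Set X → Set T) (hHit : ∀ K, IsClosed K → MeasurableSet (Hit K)) :
    ∃ Φ : T → ℝ≥0∞, Measurable Φ ∧ ∀ t S, IsCompact S →
      (∀ K, IsClosed K → (t ∈ Hit K ↔ (S ∩ K).Nonempty)) → Φ t = μHE[j] S := by
  obtain ⟨Φ, hΦ, h⟩ := exists_measurable_hausdorffMeasure (s := j) (by positivity) Hit hHit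
  refine ⟨fun t => (Measure.addHaarScalarFactor (volume : Measure (EuclideanSpace ℝ (Fin j)))
    μH[j] : ℝ≥0∞) * Φ t, hΦ.const_mul _, fun t S hS ht => ?_⟩
  simp only [h t S hS ht, Measure.euclideanHausdorffMeasure_def]
  rfl

/-! ### The space of convex bodies -/

section bodySpace

variable {d : ℕ}

lemma isInducing_toNonemptyCompacts : Topology.IsInducing
    (fun C : Body d => (⟨⟨(C : Set (E d)), C.isCompact⟩, C.nonempty⟩ :
      TopologicalSpace.NonemptyCompacts (E d))) := by
  have : Isometry (fun C : Body d => (⟨⟨(C : Set (E d)), C.isCompact⟩, C.nonempty⟩ :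
      TopologicalSpace.NonemptyCompacts (E d))) := by
    intro C C'
    rw [← ConvexBody.hausdorffEDist_coe]
    rfl
  exact this.isUniformInducing.isInducing

instance instSecondCountableTopologyBody : SecondCountableTopology (Body d) :=
  isInducing_toNonemptyCompacts.secondCountableTopology

lemma eventually_body_subset (C : Body d) {U : Set (E d)} (hU : IsOpen U)
    (h : (C : Set (E d)) ⊆ U) : ∀ᶠ C' in 𝓝 C, ((C' : Body d) : Set (E d)) ⊆ U := by
  obtain ⟨δ, hδ, hsub⟩ := C.isCompact.exists_thickening_subset_open hU h
  filter_upwards [Metric.ball_mem_nhds C hδ] with C' hC' x hx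
  obtain ⟨y, hy, hxy⟩ := Metric.exists_dist_lt_of_hausdorffDist_lt hx
    (by simpa using hC' : Metric.hausdorffDist (C' : Set (E d)) C < δ)
    ConvexBody.hausdorffEDist_ne_top
  exact hsub (Metric.mem_thickening_iff.2 ⟨y, hy, hxy⟩)

lemma eventually_body_inter_nonempty (C : Body d) {U : Set (E d)} (hU : IsOpen U)
    (h : ((C : Set (E d)) ∩ U).Nonempty) :
    ∀ᶠ C' in 𝓝 C, (((C' : Body d) : Set (E d)) ∩ U).Nonempty := by
  obtain ⟨x, hx, hxU⟩ := h
  obtain ⟨δ, hδ, hsub⟩ := Metric.isOpen_iff.1 hU x hxU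
  filter_upwards [Metric.ball_mem_nhds C hδ] with C' hC'
  obtain ⟨y, hy, hxy⟩ := Metric.exists_dist_lt_of_hausdorffDist_lt hx
    (by simpa [dist_comm] using hC' : Metric.hausdorffDist (C : Set (E d)) C' < δ)
    ConvexBody.hausdorffEDist_ne_top
  exact ⟨y, hy, hsub (by simpa [dist_comm] using hxy)⟩

variable {Q : Type*} [TopologicalSpace Q]

lemma isClosed_exists_mem_body {b : Q → Body d} (hb : Continuous b) {R : Set (Q × E d)}
    (hR : IsClosed R) : IsClosed {p | ∃ x ∈ b p, (p, x) ∈ R} := by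
  rw [← isOpen_compl_iff, isOpen_iff_mem_nhds]
  intro p hp
  have hp' : ∀ x ∈ b p, (p, x) ∈ Rᶜ := by
    intro x hx hR
    exact hp ⟨x, hx, hR⟩
  obtain ⟨U, V, hU, hV, hpU, hCV, hUV⟩ := generalized_tube_lemma (isCompact_singleton (x := p))
    (b p).isCompact hR.isOpen_compl (by
      rintro ⟨q, x⟩ ⟨rfl, hx⟩
      exact hp' x hx)
  filter_upwards [hU.mem_nhds (hpU rfl), hb.continuousAt.eventually
    (eventually_body_subset (b p) hV hCV)] with q hq hq'
  rintro ⟨x, hx, hxR⟩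
  exact hUV (Set.mk_mem_prod hq (hq' hx)) hxR

lemma isClosed_forall_mem_body {b : Q → Body d} (hb : Continuous b) {R : Set (Q × E d)}
    (hR : IsClosed R) : IsClosed {p | ∀ x ∈ b p, (p, x) ∈ R} := by
  rw [← isOpen_compl_iff, isOpen_iff_mem_nhds]
  intro p hp
  simp only [Set.mem_compl_iff, Set.mem_ofPred_eq, not_forall] at hp
  obtain ⟨x, hx, hxR⟩ := hp
  obtain ⟨U, V, hU, hV, hpU, hxV, hUV⟩ := isOpen_prod_iff.1 hR.isOpen_compl p x hxR
  filter_upwards [hU.mem_nhds hpU, hb.continuousAt.eventually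
    (eventually_body_inter_nonempty (b p) hV ⟨x, hx, hxV⟩)] with q hq hq'
  obtain ⟨y, hy, hyV⟩ := hq'
  intro h
  exact hUV (Set.mk_mem_prod hq hyV) (h y hy)

lemma isClosed_mem_body {b : Q → Body d} (hb : Continuous b) {f : Q → E d} (hf : Continuous f) :
    IsClosed {p | f p ∈ b p} := by
  have := isClosed_exists_mem_body hb (R := {z : Q × E d | f z.1 = z.2})
    (isClosed_eq (hf.comp continuous_fst) continuous_snd)
  convert this using 3 with p
  simp

lemma continuous_infDist_body (z : E d) :
    Continuous fun C : Body d => Metric.infDist z (C : Set (E d)) := by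
  refine (LipschitzWith.of_le_add_mul 1 fun C C' => ?_).continuous
  have := Metric.infDist_le_infDist_add_hausdorffDist (x := z)
    (ConvexBody.hausdorffEDist_ne_top (K := C') (L := C))
  simpa [dist_comm] using this

/-- The projection of a closed relation along a `σ`-compact space is a countable union of closed
sets. Restricting the eliminated variable to an open set does no harm, since open sets are
countable unions of closed sets. -/
lemma measurableSet_exists_mem_isOpen [MeasurableSpace Q] [OpensMeasurableSpace Q]
    {T : Type*} [PseudoEMetricSpace T] [SigmaCompactSpace T] {R : Set (Q × T)} (hR : IsClosed R)
    {O : Set T} (hO : IsOpen O) : MeasurableSet {p | ∃ y ∈ O, (p, y) ∈ R} := by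
  obtain ⟨F, hF, hFO, hFU, _⟩ := hO.exists_iUnion_isClosed
  have : {p | ∃ y ∈ O, (p, y) ∈ R} =
      ⋃ n, ⋃ m, Prod.fst '' (R ∩ Set.univ ×ˢ (F n ∩ compactCovering T m)) := by
    ext p
    simp only [Set.mem_ofPred_eq, Set.mem_iUnion, Set.mem_image, Prod.exists, exists_and_right,
      exists_eq_right, Set.mem_inter_iff, Set.mem_prod, Set.mem_univ, true_and]
    constructor
    · rintro ⟨y, hy, hyR⟩
      obtain ⟨n, hn⟩ := Set.mem_iUnion.1 (hFU.symm ▸ hy)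
      obtain ⟨m, hm⟩ := exists_mem_compactCovering y
      exact ⟨n, m, y, hyR, hn, hm⟩
    · rintro ⟨n, m, y, hyR, hn, hm⟩
      exact ⟨y, hFO n hn, hyR⟩
  rw [this]
  refine .iUnion fun n => .iUnion fun m => IsClosed.measurableSet ?_
  have hK : IsCompact (F n ∩ compactCovering T m) := (isCompact_compactCovering T m).inter_left (hF n)
  rw [← isOpen_compl_iff, isOpen_iff_mem_nhds]
  intro p hp
  obtain ⟨U, V, hU, hV, hpU, hCV, hUV⟩ := generalized_tube_lemma (isCompact_singleton (x := p))
    hK hR.isOpen_compl (by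
      rintro ⟨q, x⟩ ⟨rfl, hx⟩ hqR
      exact hp ⟨(q, x), ⟨hqR, trivial, hx⟩, rfl⟩)
  filter_upwards [hU.mem_nhds (hpU rfl)] with q hq
  rintro ⟨⟨q', x⟩, ⟨hqR, _, hx⟩, rfl⟩
  exact hUV (Set.mk_mem_prod hq (hCV hx)) hqR

lemma measurableSet_mem_interior_body :
    MeasurableSet {p : Body d × E d | p.2 ∈ interior (p.1 : Set (E d))} := by
  have : {p : Body d × E d | p.2 ∈ interior (p.1 : Set (E d))} =
      ⋃ n : ℕ, ⋂ v ∈ Metric.closedBall (0 : E d) (1 / (n + 1 : ℝ)), {p | p.2 + v ∈ p.1} := by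
    ext ⟨C, x⟩
    simp only [Set.mem_ofPred_eq, Set.mem_iUnion, Set.mem_iInter, mem_closedBall_zero_iff]
    rw [mem_interior_iff_mem_nhds, Metric.nhds_basis_closedBall.mem_iff]
    constructor
    · rintro ⟨ε, hε, h⟩
      obtain ⟨n, hn⟩ := exists_nat_one_div_lt hε
      exact ⟨n, fun v hv => h (by simpa using hv.trans hn.le)⟩
    · rintro ⟨n, h⟩
      refine ⟨1 / (n + 1 : ℝ), by positivity, fun y hy => ?_⟩
      have := h (y - x) (by simpa [dist_eq_norm] using hy)
      simpa using this
  rw [this]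
  refine .iUnion fun n => IsClosed.measurableSet ?_
  exact isClosed_biInter fun v _ => isClosed_mem_body continuous_fst (continuous_snd.add continuous_const)

lemma measurableSet_mem_interior (x : E d) :
    MeasurableSet {C : Body d | x ∈ interior (C : Set (E d))} :=
  measurableSet_mem_interior_body.preimage (measurable_id.prodMk measurable_const)

lemma exists_denseSeq_mem_interior {s : Set (E d)} (h : (interior s).Nonempty) :
    ∃ n, TopologicalSpace.denseSeq (E d) n ∈ interior s := by
  exact (TopologicalSpace.denseRange_denseSeq (E d)).exists_mem_open isOpen_interior h

lemma measurableSet_interior_nonempty :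
    MeasurableSet {C : Body d | (interior (C : Set (E d))).Nonempty} := by
  have : {C : Body d | (interior (C : Set (E d))).Nonempty} =
      ⋃ n, {C : Body d | TopologicalSpace.denseSeq (E d) n ∈ interior (C : Set (E d))} := by
    ext C
    simp only [Set.mem_ofPred_eq, Set.mem_iUnion]
    exact ⟨exists_denseSeq_mem_interior, fun ⟨n, hn⟩ => ⟨_, hn⟩⟩
  rw [this]
  exact .iUnion fun n => measurableSet_mem_interior _

/-! ### Translations of convex bodies -/

@[simp]
lemma mem_translate {x y : E d} {C : Body d} : y ∈ translate x C ↔ y - x ∈ C := by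
  change y ∈ (fun z => x +ᵥ z) '' (C : Set (E d)) ↔ _
  constructor
  · rintro ⟨z, hz, rfl⟩
    simpa using hz
  · intro h
    exact ⟨y - x, h, by simp⟩

lemma coe_translate (x : E d) (C : Body d) :
    (translate x C : Set (E d)) = (fun y => x + y) '' (C : Set (E d)) := rfl

lemma translate_translate (x y : E d) (C : Body d) :
    translate x (translate y C) = translate (x + y) C := by
  ext z
  simp only [SetLike.mem_coe, mem_translate]
  rw [sub_sub]

@[simp]
lemma translate_zero (C : Body d) : translate 0 C = C := by
  ext z
  simp

lemma continuous_translate : Continuous fun p : E d × Body d => translate p.1 p.2 := by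
  have key : ∀ p q : E d × Body d, dist (translate p.1 p.2) (translate q.1 q.2) ≤
      dist p.1 q.1 + dist p.2 q.2 := by
    have h1 : ∀ (x : E d) (C C' : Body d), dist (translate x C) (translate x C') ≤ dist C C' := by
      intro x C C'
      rw [← ConvexBody.hausdorffDist_coe, ← ConvexBody.hausdorffDist_coe, coe_translate,
        coe_translate, Metric.hausdorffDist_image (isometry_add_left x)]
    have h2 : ∀ (x y : E d) (C : Body d), dist (translate x C) (translate y C) ≤ dist x y := by
      intro x y C
      rw [← ConvexBody.hausdorffDist_coe]
      refine Metric.hausdorffDist_le_of_mem_dist dist_nonneg ?_ ?_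
      · rintro _ ⟨z, hz, rfl⟩
        exact ⟨y + z, ⟨z, hz, rfl⟩, (dist_add_right x y z).le⟩
      · rintro _ ⟨z, hz, rfl⟩
        exact ⟨x + z, ⟨z, hz, rfl⟩, ((dist_add_right y x z).trans (dist_comm y x)).le⟩
    intro p q
    exact (dist_triangle _ (translate q.1 p.2) _).trans (add_le_add (h2 _ _ _) (h1 _ _ _))
  refine (LipschitzWith.of_dist_le_mul (K := 2) fun p q => (key p q).trans ?_).continuous
  have h1 : dist p.1 q.1 ≤ dist p q := le_max_left _ _
  have h2 : dist p.2 q.2 ≤ dist p q := le_max_right _ _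
  push_cast
  linarith

lemma measurable_translate : Measurable fun p : E d × Body d => translate p.1 p.2 :=
  continuous_translate.measurable

/-! ### Dimension -/

lemma le_dimSet_iff {F : Set (E d)} (hF : F.Nonempty) {j : ℕ} :
    j ≤ dimSet F ↔ ∃ x : E d, ∃ u : Fin j → E d, LinearIndependent ℝ u ∧ x ∈ F ∧
      ∀ i, x + u i ∈ F := by
  constructor
  · intro h
    obtain ⟨x, hx⟩ := hF
    have hspan : vectorSpan ℝ F = Submodule.span ℝ ((fun y => y - x) '' F) := by
      rw [vectorSpan_eq_span_vsub_set_right ℝ hx]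
      rfl
    rw [dimSet, hspan] at h
    obtain ⟨f, hf, -, hli⟩ := Submodule.exists_fun_fin_finrank_span_eq ℝ ((fun y => y - x) '' F)
    refine ⟨x, fun i => f (Fin.castLE h i), hli.comp _ (Fin.castLE_injective h), hx, fun i => ?_⟩
    obtain ⟨y, hy, hyf⟩ := hf (Fin.castLE h i)
    simpa [← hyf] using hy
  · rintro ⟨x, u, hu, hx, hxu⟩
    have hle : Submodule.span ℝ (Set.range u) ≤ vectorSpan ℝ F := by
      rw [Submodule.span_le]
      rintro _ ⟨i, rfl⟩
      simpa using vsub_mem_vectorSpan ℝ (hxu i) hx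
    have := Submodule.finrank_mono hle
    rwa [finrank_span_eq_card hu, Fintype.card_fin] at this

lemma dimSet_mono {F G : Set (E d)} (h : F ⊆ G) : dimSet F ≤ dimSet G :=
  Submodule.finrank_mono (vectorSpan_mono ℝ h)

lemma measurableSet_dimSet_inter (j : ℕ) : MeasurableSet {p : Body d × Body d |
    ((p.1 : Set (E d)) ∩ p.2).Nonempty ∧ dimSet ((p.1 : Set (E d)) ∩ p.2) = j} := by
  have key : ∀ j, MeasurableSet {p : Body d × Body d |
      ((p.1 : Set (E d)) ∩ p.2).Nonempty ∧ j ≤ dimSet ((p.1 : Set (E d)) ∩ p.2)} := by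
    intro j
    have hR : IsClosed {z : (Body d × Body d) × (E d × (Fin j → E d)) |
        (z.2.1 ∈ z.1.1 ∧ z.2.1 ∈ z.1.2) ∧ ∀ i, z.2.1 + z.2.2 i ∈ z.1.1 ∧ z.2.1 + z.2.2 i ∈ z.1.2} := by
      simp only [Set.ofPred_and, Set.ofPred_forall]
      refine .inter (.inter ?_ ?_) (isClosed_iInter fun i => .inter ?_ ?_) <;>
        exact isClosed_mem_body (by fun_prop) (by fun_prop)
    have hO : IsOpen {y : E d × (Fin j → E d) | LinearIndependent ℝ y.2} :=
      isOpen_setOfPred_linearIndependent.preimage continuous_snd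
    convert measurableSet_exists_mem_isOpen hR hO using 1
    ext ⟨C, C'⟩
    simp only [Set.mem_ofPred_eq, Prod.exists]
    constructor
    · rintro ⟨hne, hj⟩
      obtain ⟨x, u, hu, hx, hxu⟩ := (le_dimSet_iff hne).1 hj
      exact ⟨x, u, hu, hx, hxu⟩
    · rintro ⟨x, u, hu, hx, hxu⟩
      exact ⟨⟨x, hx⟩, (le_dimSet_iff ⟨x, hx⟩).2 ⟨x, u, hu, hx, hxu⟩⟩
  convert (key j).diff (key (j + 1)) using 1
  ext p
  simp only [Set.mem_ofPred_eq, Set.mem_sdiff]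
  constructor
  · rintro ⟨h, rfl⟩
    exact ⟨⟨h, le_rfl⟩, fun h' => absurd h'.2 (by omega)⟩
  · rintro ⟨⟨h, h1⟩, h2⟩
    refine ⟨h, le_antisymm ?_ h1⟩
    by_contra hlt
    exact h2 ⟨h, by omega⟩

end bodySpace

/-! ### Faces of polytopes -/

section polytope

open scoped RealInnerProductSpace

variable {d : ℕ} {ι : Type*}

/-- The constraints active at `x`: the indices `i` for which `a i` is an outer normal of `C`
at `x`. -/
def active (C : Body d) (a : ι → E d) (x : E d) : Set ι :=
  {i | ∀ y ∈ C, ⟪a i, y⟫ ≤ ⟪a i, x⟫}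

/-- The vectors `a i` describe the body `C` as a polytope with interior points: a direction which
does not violate an active constraint points into `C`, and at some point no constraint is active. -/
structure IsFacetSystem (C : Body d) (a : ι → E d) : Prop where
  exists_smul_mem : ∀ x ∈ C, ∀ v, (∀ i ∈ active C a x, ⟪a i, v⟫ ≤ 0) → ∃ ε : ℝ, 0 < ε ∧ x + ε • v ∈ C
  exists_active_eq_empty : ∃ z ∈ C, active C a z = ∅

/-- The direction of the smallest face containing `x`. -/
noncomputable def faceDirection (C : Body d) (a : ι → E d) (x : E d) : Submodule ℝ (E d) :=
  (Submodule.span ℝ (a '' active C a x))ᗮ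

/-- The smallest face containing `x`. -/
def minFace (C : Body d) (a : ι → E d) (x : E d) : Set (E d) :=
  {z | z ∈ C ∧ active C a x ⊆ active C a z}

variable {C : Body d} {a : ι → E d} {x y z : E d}

lemma mem_faceDirection {v : E d} :
    v ∈ faceDirection C a x ↔ ∀ i ∈ active C a x, ⟪a i, v⟫ = 0 := by
  rw [faceDirection, Submodule.mem_orthogonal]
  constructor
  · intro h i hi
    exact h _ (Submodule.subset_span (Set.mem_image_of_mem _ hi))
  · intro h u hu
    induction hu using Submodule.span_induction with
    | mem u hu => obtain ⟨i, hi, rfl⟩ := hu; exact h i hi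
    | zero => simp
    | add u u' _ _ h1 h2 => rw [inner_add_left, h1, h2, add_zero]
    | smul c u _ h1 => rw [real_inner_smul_left, h1, mul_zero]

lemma faceDirection_anti (h : active C a x ⊆ active C a y) :
    faceDirection C a y ≤ faceDirection C a x := by
  intro v hv
  rw [mem_faceDirection] at hv ⊢
  exact fun i hi => hv i (h hi)

lemma mem_active_iff_of_mem_active {i : ι} (hi : i ∈ active C a x) (hx : x ∈ C) (hz : z ∈ C) :
    i ∈ active C a z ↔ ⟪a i, z⟫ = ⟪a i, x⟫ := by
  constructor
  · intro h
    exact le_antisymm (hi z hz) (h x hx)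
  · intro h y hy
    rw [h]
    exact hi y hy

lemma midpoint_mem_body (hx : x ∈ C) (hy : y ∈ C) : midpoint ℝ x y ∈ C :=
  C.convex.midpoint_mem hx hy

lemma inner_midpoint (u : E d) : ⟪u, midpoint ℝ x y⟫ = (⟪u, x⟫ + ⟪u, y⟫) / 2 := by
  rw [midpoint_eq_smul_add, real_inner_smul_right, inner_add_right]
  simp
  ring

lemma active_midpoint_subset (hx : x ∈ C) (hy : y ∈ C) :
    active C a (midpoint ℝ x y) ⊆ active C a x ∩ active C a y := by
  intro i hi
  have h1 := hi x hx
  have h2 := hi y hy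
  rw [inner_midpoint] at h1 h2
  have hxy : ⟪a i, x⟫ = ⟪a i, y⟫ := by linarith
  constructor <;> intro z hz <;> have := hi z hz <;> rw [inner_midpoint] at this <;> linarith

lemma dimSet_minFace (ha : IsFacetSystem C a) (hx : x ∈ C) :
    vectorSpan ℝ (minFace C a x) = faceDirection C a x := by
  apply le_antisymm
  · rw [vectorSpan_def, Submodule.span_le]
    rintro _ ⟨y, hy, z, hz, rfl⟩
    rw [SetLike.mem_coe, mem_faceDirection]
    intro i hi
    change ⟪a i, y - z⟫ = 0
    rw [inner_sub_right, (mem_active_iff_of_mem_active hi hx hy.1).1 (hy.2 hi),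
      (mem_active_iff_of_mem_active hi hx hz.1).1 (hz.2 hi), sub_self]
  · intro v hv
    rw [mem_faceDirection] at hv
    obtain ⟨ε, hε, hmem⟩ := ha.exists_smul_mem x hx v fun i hi => (hv i hi).le
    have hF : x + ε • v ∈ minFace C a x := by
      refine ⟨hmem, fun i hi => (mem_active_iff_of_mem_active hi hx hmem).2 ?_⟩
      rw [inner_add_right, real_inner_smul_right, hv i hi, mul_zero, add_zero]
    have := vsub_mem_vectorSpan ℝ hF (⟨hx, le_rfl⟩ : x ∈ minFace C a x)
    rw [vsub_eq_sub, add_sub_cancel_left] at this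
    simpa [hε.ne'] using Submodule.smul_mem _ ε⁻¹ this

lemma isExposed_minFace [Finite ι] (hx : x ∈ C) : IsExposed ℝ (C : Set (E d)) (minFace C a x) := by
  classical
  have := Fintype.ofFinite ι
  intro _
  let I : Finset ι := {i | i ∈ active C a x}
  have hI : ∀ i, i ∈ I ↔ i ∈ active C a x := by simp [I]
  have hval : ∀ z, innerSL ℝ (∑ i ∈ I, a i) z = ∑ i ∈ I, ⟪a i, z⟫ := by
    intro z
    rw [innerSL_apply_apply, sum_inner]
  refine ⟨innerSL ℝ (∑ i ∈ I, a i), ?_⟩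
  ext z
  simp only [minFace, Set.mem_ofPred_eq, SetLike.mem_coe, hval]
  refine and_congr_right fun hz => ⟨fun h y hy => ?_, fun h i hi => ?_⟩
  · exact Finset.sum_le_sum fun i hi => h ((hI i).1 hi) y hy
  · rw [mem_active_iff_of_mem_active hi hx hz]
    have hle : ∀ i ∈ I, ⟪a i, z⟫ ≤ ⟪a i, x⟫ := fun i hi => (hI i).1 hi z hz
    exact (Finset.sum_eq_sum_iff_of_le hle).1
      (le_antisymm (Finset.sum_le_sum hle) (h x hx)) i ((hI i).2 hi)

/-- Every exposed face is the smallest face containing one of its points, namely a point with as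
few active constraints as possible. -/
lemma exists_eq_minFace [Finite ι] (ha : IsFacetSystem C a) {F : Set (E d)} (hF : F.Nonempty)
    (hexp : IsExposed ℝ (C : Set (E d)) F) : ∃ y ∈ F, y ∈ C ∧ F = minFace C a y := by
  obtain ⟨l, hl⟩ := hexp hF
  have hFC : ∀ z ∈ F, z ∈ C := fun z hz => by rw [hl] at hz; exact hz.1
  obtain ⟨_, ⟨y, hy, rfl⟩, hmin⟩ := WellFounded.has_min
    (wellFounded_lt : WellFounded ((· < ·) : Set ι → Set ι → Prop)) (active C a '' F) (hF.image _)
  refine ⟨y, hy, hFC y hy, Set.Subset.antisymm (fun z hz => ⟨hFC z hz, ?_⟩) ?_⟩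
  · have hmid : midpoint ℝ y z ∈ F := hexp.convex C.convex |>.midpoint_mem hy hz
    have hsub := active_midpoint_subset (a := a) (hFC y hy) (hFC z hz)
    have heq : active C a (midpoint ℝ y z) = active C a y := by
      by_contra hne
      exact hmin _ ⟨_, hmid, rfl⟩ (lt_of_le_of_ne (hsub.trans Set.inter_subset_left) hne)
    rw [heq] at hsub
    exact hsub.trans Set.inter_subset_right
  · rintro z ⟨hz, hact⟩
    have hyC := hFC y hy
    obtain ⟨ε, hε, hmem⟩ := ha.exists_smul_mem y hyC (y - z) fun i hi => by
      rw [inner_sub_right, (mem_active_iff_of_mem_active hi hyC hz).1 (hact hi), sub_self]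
    rw [hl] at hy ⊢
    refine ⟨hz, fun w hw => (hy.2 w hw).trans ?_⟩
    have := hy.2 _ hmem
    simp only [map_add, map_smul, map_sub, smul_eq_mul] at this
    nlinarith

/-- A face of dimension less than `d` lies in a face whose dimension is larger by one. -/
lemma exists_finrank_faceDirection_succ [Finite ι] (ha : IsFacetSystem C a) (hx : x ∈ C)
    (hlt : Module.finrank ℝ (faceDirection C a x) < d) :
    ∃ y ∈ C, active C a y ⊆ active C a x ∧
      Module.finrank ℝ (faceDirection C a y) = Module.finrank ℝ (faceDirection C a x) + 1 := by
  classical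
  have := Fintype.ofFinite ι
  -- Among the larger faces take one of smallest dimension. If its dimension exceeds that of the
  -- given face by more than one, then a face strictly between the two is found.
  set f : E d → ℕ := fun y => Module.finrank ℝ (faceDirection C a y) with hf
  have hex : ∃ n, ∃ y ∈ C, active C a y ⊆ active C a x ∧ f x < f y ∧ f y = n := by
    obtain ⟨z, hz, hz0⟩ := ha.exists_active_eq_empty
    refine ⟨f z, z, hz, by simp [hz0], ?_, rfl⟩
    have : faceDirection C a z = ⊤ := by
      rw [eq_top_iff]
      intro v _
      rw [mem_faceDirection, hz0]
      simp
    change Module.finrank ℝ (faceDirection C a x) < Module.finrank ℝ (faceDirection C a z)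
    rwa [this, finrank_top, finrank_euclideanSpace_fin]
  obtain ⟨y, hy, hyx, hfy, hfn⟩ := Nat.find_spec hex
  have hmin : ∀ y' ∈ C, active C a y' ⊆ active C a x → f x < f y' → f y ≤ f y' := by
    intro y' h1 h2 h3
    rw [hfn]
    exact Nat.find_min' hex ⟨y', h1, h2, h3, rfl⟩
  refine ⟨y, hy, hyx, ?_⟩
  by_contra hne
  have hgt : f x + 1 < f y := lt_of_le_of_ne hfy (Ne.symm hne)
  obtain ⟨w, hw, hw'⟩ : ∃ w ∈ faceDirection C a y,
      w ∉ faceDirection C a x ⊔ Submodule.span ℝ {y - x} := by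
    rw [← SetLike.not_le_iff_exists]
    intro hle
    have h1 := Submodule.finrank_mono hle
    have h2 := Submodule.finrank_add_le_finrank_add_finrank (faceDirection C a x)
      (Submodule.span ℝ {y - x})
    have h3 : Module.finrank ℝ (Submodule.span ℝ {y - x}) ≤ 1 := by
      simpa using finrank_span_le_card (R := ℝ) ({y - x} : Set (E d))
    simp only [hf] at hgt
    omega
  have hwx : w ∉ faceDirection C a x := fun h => hw' (Submodule.mem_sup_left h)
  obtain ⟨w, hw, hw', i₁, hi₁, hpos⟩ : ∃ w ∈ faceDirection C a y,
      w ∉ faceDirection C a x ⊔ Submodule.span ℝ {y - x} ∧ ∃ i ∈ active C a x, 0 < ⟪a i, w⟫ := by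
    rw [mem_faceDirection] at hwx
    push Not at hwx
    obtain ⟨i, hi, hne⟩ := hwx
    rcases lt_or_gt_of_ne hne with h | h
    · exact ⟨-w, Submodule.neg_mem _ hw, by rwa [Submodule.neg_mem_iff], i, hi, by
        rw [inner_neg_right]; linarith⟩
    · exact ⟨w, hw, hw', i, hi, h⟩
  let J : Finset ι := {i | i ∈ active C a x ∧ 0 < ⟪a i, w⟫}
  have hJ : ∀ i, i ∈ J ↔ i ∈ active C a x ∧ 0 < ⟪a i, w⟫ := by simp [J]
  obtain ⟨i₀, hi₀, hmin₀⟩ := J.exists_min_image (fun i => (⟪a i, x⟫ - ⟪a i, y⟫) / ⟪a i, w⟫)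
    ⟨i₁, (hJ _).2 ⟨hi₁, hpos⟩⟩
  obtain ⟨hi₀x, hi₀w⟩ := (hJ _).1 hi₀
  -- Walk from `y` in the direction `w` until the next constraint among those active at `x`
  set t := (⟪a i₀, x⟫ - ⟪a i₀, y⟫) / ⟪a i₀, w⟫ with ht
  have ht0 : 0 ≤ t := div_nonneg (sub_nonneg.2 (hi₀x y hy)) hi₀w.le
  set v := y + t • w - x with hv
  have hinner : ∀ i, ⟪a i, v⟫ = ⟪a i, y⟫ + t * ⟪a i, w⟫ - ⟪a i, x⟫ := by
    intro i
    rw [hv, inner_sub_right, inner_add_right, real_inner_smul_right]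
  have hv_le : ∀ i ∈ active C a x, ⟪a i, v⟫ ≤ 0 := by
    intro i hi
    rw [hinner]
    have h1 := hi y hy
    rcases lt_or_ge 0 ⟪a i, w⟫ with h | h
    · have := hmin₀ i ((hJ _).2 ⟨hi, h⟩)
      rw [le_div_iff₀ h] at this
      linarith
    · nlinarith
  have hv_i₀ : ⟪a i₀, v⟫ = 0 := by
    rw [hinner, ht, div_mul_cancel₀ _ hi₀w.ne']
    ring
  obtain ⟨ε, hε, hmem⟩ := ha.exists_smul_mem x hx v hv_le
  set y' := midpoint ℝ x (x + ε • v) with hy'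
  have hy'C : y' ∈ C := midpoint_mem_body hx hmem
  have hsub : active C a y' ⊆ active C a x :=
    (active_midpoint_subset hx hmem).trans Set.inter_subset_left
  have hact : ∀ i ∈ active C a x, (i ∈ active C a y' ↔ ⟪a i, v⟫ = 0) := by
    intro i hi
    rw [mem_active_iff_of_mem_active hi hx hy'C, hy', inner_midpoint, inner_add_right,
      real_inner_smul_right]
    constructor
    · intro h
      have : ε * ⟪a i, v⟫ = 0 := by linarith
      simpa [hε.ne'] using this
    · intro h
      rw [h]
      ring
  have hlt' : faceDirection C a x < faceDirection C a y' := by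
    refine lt_of_le_of_ne (faceDirection_anti hsub) fun heq => hw' ?_
    have hvx : v ∈ faceDirection C a x := by
      rw [heq, mem_faceDirection]
      exact fun i hi => (hact i (hsub hi)).1 hi
    have ht0' : t ≠ 0 := by
      intro h0
      have : i₀ ∈ active C a y := by
        rw [mem_active_iff_of_mem_active hi₀x hx hy]
        have := hv_i₀
        rw [hinner, h0] at this
        linarith
      rw [mem_faceDirection] at hw
      exact hi₀w.ne' (hw i₀ this)
    have : w = t⁻¹ • v + t⁻¹ • (-(y - x)) := by
      rw [← smul_add, hv, show y + t • w - x + -(y - x) = t • w by abel, smul_smul,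
        inv_mul_cancel₀ ht0', one_smul]
    rw [this]
    exact Submodule.add_mem_sup (Submodule.smul_mem _ _ hvx)
      (Submodule.smul_mem _ _ (Submodule.neg_mem _ (Submodule.mem_span_singleton_self _)))
  have hlt'' : faceDirection C a y' < faceDirection C a y := by
    refine lt_of_le_of_ne (faceDirection_anti fun i hi => ?_) fun heq => ?_
    · rw [hact i (hyx hi), hinner, (mem_active_iff_of_mem_active (hyx hi) hx hy).1 hi,
        (mem_faceDirection.1 hw) i hi]
      ring
    · rw [← heq, mem_faceDirection] at hw
      exact hi₀w.ne' (hw i₀ ((hact i₀ hi₀x).2 hv_i₀))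
  have h1 := Submodule.finrank_lt_finrank_of_lt hlt''
  have h2 := hmin y' hy'C hsub (Submodule.finrank_lt_finrank_of_lt hlt')
  exact absurd h1 (not_lt.2 h2)

lemma exists_finrank_faceDirection_eq [Finite ι] (ha : IsFacetSystem C a) {k : ℕ} (hk : k ≤ d)
    (hx : x ∈ C) (hxk : Module.finrank ℝ (faceDirection C a x) ≤ k) :
    ∃ y ∈ C, active C a y ⊆ active C a x ∧ Module.finrank ℝ (faceDirection C a y) = k := by
  induction k with
  | zero => exact ⟨x, hx, le_rfl, by omega⟩
  | succ k ih =>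
    rcases hxk.eq_or_lt with h | h
    · exact ⟨x, hx, le_rfl, h⟩
    · obtain ⟨y, hy, hyx, hyk⟩ := ih (by omega) (by omega)
      obtain ⟨z, hz, hzy, hzk⟩ := exists_finrank_faceDirection_succ ha hy (by omega)
      exact ⟨z, hz, hzy.trans hyx, by rw [hzk, hyk]⟩

/-- The points of `C` at which `C` has `d - k` linearly independent outer normals. For a polytope
these are the points of its `k`-faces. -/
def skeleton (k : ℕ) (C : Body d) : Set (E d) :=
  {x | x ∈ C ∧ ∃ u : Fin (d - k) → E d, LinearIndependent ℝ u ∧ ∀ i, ∀ y ∈ C, ⟪u i, y⟫ ≤ ⟪u i, x⟫}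

lemma IsFacetSystem.faceUnion_eq_skeleton [Finite ι] (ha : IsFacetSystem C a) {k : ℕ}
    (hk : k ≤ d) : faceUnion k C = skeleton k C := by
  have hdim : ∀ x, Module.finrank ℝ (Submodule.span ℝ (a '' active C a x)) +
      Module.finrank ℝ (faceDirection C a x) = d := fun x => by
    rw [faceDirection, Submodule.finrank_add_finrank_orthogonal, finrank_euclideanSpace_fin]
  ext x
  constructor
  · rintro ⟨F, ⟨hne, hexp, hFk⟩, hxF⟩
    obtain ⟨y, hyF, hyC, rfl⟩ := exists_eq_minFace ha hne hexp
    rw [dimSet, dimSet_minFace ha hyC] at hFk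
    refine ⟨hxF.1, ?_⟩
    obtain ⟨f, hf, -, hli⟩ := Submodule.exists_fun_fin_finrank_span_eq ℝ (a '' active C a y)
    have hcard : d - k ≤ Module.finrank ℝ (Submodule.span ℝ (a '' active C a y)) := by
      have := hdim y
      omega
    refine ⟨fun i => f (Fin.castLE hcard i), hli.comp _ (Fin.castLE_injective _), fun i => ?_⟩
    obtain ⟨j, hj, hjf⟩ := hf (Fin.castLE hcard i)
    intro w hw
    have := hxF.2 hj w hw
    rwa [hjf] at this
  · rintro ⟨hxC, u, hu, hux⟩
    have hle : Module.finrank ℝ (faceDirection C a x) ≤ k := by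
      have hsub : faceDirection C a x ≤ (Submodule.span ℝ (Set.range u))ᗮ := by
        intro v hv
        have key : ∀ v ∈ faceDirection C a x, ∀ i, ⟪u i, v⟫ ≤ 0 := by
          intro v hv i
          obtain ⟨ε, hε, hmem⟩ := ha.exists_smul_mem x hxC v fun i hi =>
            (mem_faceDirection.1 hv i hi).le
          have := hux i _ hmem
          rw [inner_add_right, real_inner_smul_right] at this
          nlinarith
        rw [Submodule.mem_orthogonal]
        intro w hw
        induction hw using Submodule.span_induction with
        | mem w hw =>
          obtain ⟨i, rfl⟩ := hw
          refine le_antisymm (key v hv i) ?_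
          have := key (-v) (Submodule.neg_mem _ hv) i
          rw [inner_neg_right] at this
          linarith
        | zero => simp
        | add u u' _ _ h1 h2 => rw [inner_add_left, h1, h2, add_zero]
        | smul c u _ h1 => rw [real_inner_smul_left, h1, mul_zero]
      have h1 := Submodule.finrank_mono hsub
      have h2 := Submodule.finrank_add_finrank_orthogonal (Submodule.span ℝ (Set.range u))
      rw [finrank_span_eq_card hu, Fintype.card_fin, finrank_euclideanSpace_fin] at h2
      omega
    obtain ⟨y, hy, hyx, hyk⟩ := exists_finrank_faceDirection_eq ha hk hxC hle
    exact ⟨minFace C a y, ⟨⟨y, hy, le_rfl⟩, isExposed_minFace hy, by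
      rw [dimSet, dimSet_minFace ha hy, hyk]⟩, hxC, hyx⟩

lemma IsFacetSystem.finite_faces [Finite ι] (ha : IsFacetSystem C a) (k : ℕ) :
    {F : Set (E d) | F.Nonempty ∧ IsExposed ℝ (C : Set (E d)) F ∧ dimSet F = k}.Finite := by
  refine (Set.finite_range fun J : Set ι => {z | z ∈ C ∧ J ⊆ active C a z}).subset ?_
  rintro F ⟨hne, hexp, -⟩
  obtain ⟨y, -, -, rfl⟩ := exists_eq_minFace ha hne hexp
  exact ⟨active C a y, rfl⟩

/-- Polytopes with interior points, described by finitely many outer unit normals: near `C`, a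
point outside of `C` violates, or attains, one of the corresponding constraints. In this form the
condition is a countable union of closed ones. -/
def IsPolytopal (C : Body d) : Prop :=
  (interior (C : Set (E d))).Nonempty ∧ ∃ p n : ℕ, ∃ a : Fin p → E d, (∀ i, ‖a i‖ = 1) ∧
    ∀ z, 1 / (n + 1 : ℝ) ≤ Metric.infDist z C ∨ z ∈ C ∨ ∃ i, ∀ y ∈ C, ⟪a i, y⟫ ≤ ⟪a i, z⟫

lemma measurableSet_isPolytopal : MeasurableSet {C : Body d | IsPolytopal C} := by
  have : {C : Body d | IsPolytopal C} = {C : Body d | (interior (C : Set (E d))).Nonempty} ∩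
      ⋃ p : ℕ, ⋃ n : ℕ, {C : Body d | ∃ a ∈ (Set.univ : Set (Fin p → E d)), (C, a) ∈
        {q : Body d × (Fin p → E d) | (∀ i, ‖q.2 i‖ = 1) ∧ ∀ z,
          1 / (n + 1 : ℝ) ≤ Metric.infDist z (q.1 : Set (E d)) ∨ z ∈ q.1 ∨
            ∃ i, ∀ y ∈ q.1, ⟪q.2 i, y⟫ ≤ ⟪q.2 i, z⟫}} := by
    ext C
    simp only [IsPolytopal, Set.mem_inter_iff, Set.mem_iUnion, Set.mem_ofPred_eq, Set.mem_univ,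
      true_and]
  rw [this]
  refine measurableSet_interior_nonempty.inter (.iUnion fun p => .iUnion fun n =>
    measurableSet_exists_mem_isOpen ?_ isOpen_univ)
  simp only [Set.ofPred_and, Set.ofPred_forall, Set.ofPred_or, Set.ofPred_exists]
  refine .inter (isClosed_iInter fun i => ?_) (isClosed_iInter fun z => .union ?_ (.union ?_ ?_))
  · exact isClosed_eq (by fun_prop) continuous_const
  · exact isClosed_le continuous_const ((continuous_infDist_body z).comp continuous_fst)
  · exact isClosed_mem_body continuous_fst continuous_const
  · refine isClosed_iUnion_of_finite fun i => ?_
    simp only [← Set.ofPred_forall]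
    exact isClosed_forall_mem_body (Q := Body d × (Fin p → E d)) continuous_fst
      (R := {z' : (Body d × (Fin p → E d)) × E d | ⟪z'.1.2 i, z'.2⟫ ≤ ⟪z'.1.2 i, z⟫})
      (isClosed_le (by fun_prop) (by fun_prop))

lemma inner_lt_of_mem_interior {s : Set (E d)} {x : E d} (hx : x ∈ interior s) {u : E d}
    (hu : u ≠ 0) : ∃ y ∈ s, ⟪u, x⟫ < ⟪u, y⟫ := by
  have hcont : Tendsto (fun t : ℝ => x + t • u) (𝓝[>] 0) (𝓝 x) := by
    have : Continuous fun t : ℝ => x + t • u := by fun_prop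
    simpa using (this.tendsto 0).mono_left nhdsWithin_le_nhds
  obtain ⟨t, hts, ht⟩ := ((hcont.eventually_mem (mem_interior_iff_mem_nhds.1 hx)).and
    self_mem_nhdsWithin).exists
  refine ⟨_, hts, ?_⟩
  rw [inner_add_right, real_inner_smul_right]
  have : 0 < ⟪u, u⟫ := real_inner_self_pos.2 hu
  have := mul_pos (Set.mem_Ioi.1 ht) this
  linarith

lemma IsPolytopal.exists_isFacetSystem (hC : IsPolytopal C) :
    ∃ (p : ℕ) (a : Fin p → E d), IsFacetSystem C a := by
  obtain ⟨⟨z₀, hz₀⟩, p, n, a, ha, h⟩ := hC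
  have ha0 : ∀ i, a i ≠ 0 := fun i h0 => by simpa [h0] using ha i
  have hz₀i : ∀ i, ∃ y ∈ C, ⟪a i, z₀⟫ < ⟪a i, y⟫ := fun i => inner_lt_of_mem_interior hz₀ (ha0 i)
  refine ⟨p, a, ⟨fun x hx v hv => ?_, z₀, interior_subset hz₀, ?_⟩⟩
  swap
  · ext i
    simp only [Set.mem_empty_iff_false, iff_false]
    intro hi
    obtain ⟨y, hy, hlt⟩ := hz₀i i
    exact absurd (hi y hy) (not_le.2 hlt)
  have hcont : Continuous fun t : ℝ => x + t • v := by fun_prop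
  have h0 : Tendsto (fun t : ℝ => x + t • v) (𝓝[>] 0) (𝓝 x) := by
    simpa using (hcont.tendsto 0).mono_left nhdsWithin_le_nhds
  -- For small `ε > 0` the point `x + ε • v` satisfies all constraints, possibly with equality, and
  -- it is so close to `C` that the first alternative in `IsPolytopal` is excluded.
  have e1 : ∀ᶠ t : ℝ in 𝓝[>] 0, ∀ i, ∃ y ∈ C, ⟪a i, x + t • v⟫ ≤ ⟪a i, y⟫ := by
    rw [eventually_all]
    intro i
    by_cases hi : i ∈ active C a x
    · filter_upwards [self_mem_nhdsWithin] with t ht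
      refine ⟨x, hx, ?_⟩
      rw [inner_add_right, real_inner_smul_right]
      have := mul_nonpos_of_nonneg_of_nonpos (Set.mem_Ioi.1 ht).le (hv i hi)
      linarith
    · simp only [active, Set.mem_ofPred_eq, not_forall, not_le] at hi
      obtain ⟨y, hy, hlt⟩ := hi
      have : Tendsto (fun t : ℝ => ⟪a i, x + t • v⟫) (𝓝[>] 0) (𝓝 ⟪a i, x⟫) :=
        tendsto_const_nhds.inner h0
      filter_upwards [this.eventually_lt_const hlt] with t ht
      exact ⟨y, hy, ht.le⟩
  have hinf : Metric.infDist x (C : Set (E d)) < 1 / (n + 1 : ℝ) := by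
    rw [Metric.infDist_zero_of_mem hx]
    positivity
  have e2 : ∀ᶠ t : ℝ in 𝓝[>] 0, Metric.infDist (x + t • v) C < 1 / (n + 1 : ℝ) :=
    (((Metric.continuous_infDist_pt _).tendsto _).comp h0).eventually_lt_const hinf
  obtain ⟨ε, ⟨hε1, hε2⟩, hε⟩ := ((e1.and e2).and self_mem_nhdsWithin).exists
  refine ⟨ε, hε, ?_⟩
  -- Points close to `x + ε • v` on the segment to the interior point satisfy all constraints
  -- strictly, hence belong to `C`
  have hlim : Tendsto (fun t : ℝ => (1 - t) • (x + ε • v) + t • z₀) (𝓝[>] 0) (𝓝 (x + ε • v)) := by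
    have : Continuous fun t : ℝ => (1 - t) • (x + ε • v) + t • z₀ := by fun_prop
    simpa using (this.tendsto 0).mono_left nhdsWithin_le_nhds
  refine C.isClosed.mem_of_tendsto hlim ?_
  filter_upwards [(((Metric.continuous_infDist_pt _).tendsto _).comp hlim).eventually_lt_const hε2,
    Ioo_mem_nhdsGT (zero_lt_one' ℝ)] with t ht1 ht2
  rcases h ((1 - t) • (x + ε • v) + t • z₀) with h1 | h1 | ⟨i, hi⟩
  · exact absurd ht1 (not_lt.2 h1)
  · exact h1
  · exfalso
    obtain ⟨y, hy, hyz⟩ := hz₀i i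
    obtain ⟨y', hy', hyx⟩ := hε1 i
    have h1 := hi y hy
    have h2 := hi y' hy'
    rw [inner_add_right, real_inner_smul_right, real_inner_smul_right] at h1 h2
    have ht := ht2.1
    have ht' := ht2.2
    nlinarith

lemma IsPolytopal.faceUnion_eq_skeleton (hC : IsPolytopal C) {k : ℕ} (hk : k ≤ d) :
    faceUnion k C = skeleton k C := by
  obtain ⟨p, a, ha⟩ := hC.exists_isFacetSystem
  exact ha.faceUnion_eq_skeleton hk

lemma IsPolytopal.finite_faces (hC : IsPolytopal C) (k : ℕ) :
    {F : Set (E d) | F.Nonempty ∧ IsExposed ℝ (C : Set (E d)) F ∧ dimSet F = k}.Finite := by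
  obtain ⟨p, a, ha⟩ := hC.exists_isFacetSystem
  exact ha.finite_faces k

lemma IsPolytopal.isCompact_faceUnion (hC : IsPolytopal C) (k : ℕ) :
    IsCompact (faceUnion k C) :=
  (hC.finite_faces k).isCompact_sUnion fun _ hF => hF.2.1.isCompact C.isCompact

lemma faceUnion_subset (k : ℕ) (C : Body d) : faceUnion k C ⊆ C :=
  Set.sUnion_subset fun _ hF => hF.2.1.subset

lemma skeleton_translate (k : ℕ) (x : E d) (C : Body d) :
    skeleton k (translate x C) = (fun y => x + y) '' skeleton k C := by
  ext z
  rw [show (fun y => x + y) '' skeleton k C = {z | z - x ∈ skeleton k C} by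
    ext z
    constructor
    · rintro ⟨y, hy, rfl⟩
      simpa using hy
    · intro h
      exact ⟨z - x, h, by simp⟩]
  simp only [skeleton, Set.mem_ofPred_eq, mem_translate]
  refine and_congr_right fun hz => exists_congr fun u => and_congr_right fun hu =>
    forall_congr' fun i => ⟨fun h y hy => ?_, fun h y hy => ?_⟩
  · have := h (y + x) (by simpa using hy)
    rw [inner_add_right] at this
    rw [inner_sub_right]
    linarith
  · have := h _ hy
    rw [inner_sub_right, inner_sub_right] at this
    linarith

lemma IsPolytopal.translate (hC : IsPolytopal C) (x : E d) : IsPolytopal (translate x C) := by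
  obtain ⟨⟨z₀, hz₀⟩, p, n, a, ha, h⟩ := hC
  refine ⟨?_, p, n, a, ha, fun z => ?_⟩
  · rw [coe_translate, ← Homeomorph.coe_addLeft, ← Homeomorph.image_interior]
    exact ⟨_, z₀, hz₀, rfl⟩
  · have hinf : Metric.infDist z (Tess.translate x C) = Metric.infDist (z - x) C := by
      have := Metric.infDist_image (t := (C : Set (E d))) (x := z - x) (isometry_add_left x)
      rwa [add_sub_cancel] at this
    rw [hinf, mem_translate]
    refine (h (z - x)).imp_right (Or.imp_right fun ⟨i, hi⟩ => ⟨i, fun y hy => ?_⟩)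
    have := hi _ (mem_translate.1 hy)
    rw [inner_sub_right, inner_sub_right] at this
    linarith

end polytope

/-! ### Cells and facets of a tessellation -/

section tessellation

open scoped RealInnerProductSpace

variable {d : ℕ} {c : ℕ → Body d}

/-- Cells are polytopes: finitely many other cells meet a neighbourhood of a given cell, and each of
them is separated from it by a hyperplane. -/
lemma IsTessellation.isPolytopal (hc : IsTessellation c) (n : ℕ) : IsPolytopal (c n) := by
  classical
  set K := Metric.cthickening 1 (c n : Set (E d)) with hK
  have hfin := hc.locallyFinite K (c n).isCompact.cthickening
  let J : Finset ℕ := hfin.toFinset.erase n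
  have hcl : ∀ m, closure (interior (c m : Set (E d))) = c m := fun m => by
    rw [(c m).convex.closure_interior_eq_closure_of_nonempty_interior (hc.interior_nonempty m),
      (c m).isClosed.closure_eq]
  have hsep : ∀ m, m ≠ n → ∃ u : E d, ‖u‖ = 1 ∧ ∀ y ∈ c n, ∀ z ∈ c m, ⟪u, y⟫ ≤ ⟪u, z⟫ := by
    intro m hm
    obtain ⟨f, b, hf1, hf2⟩ := geometric_hahn_banach_open_open (c n).convex.interior
      isOpen_interior (c m).convex.interior isOpen_interior (hc.disjoint_interior n m hm.symm)
    have h1 : ∀ y ∈ c n, f y ≤ b := by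
      intro y hy
      have : y ∈ closure (interior (c n : Set (E d))) := by rw [hcl]; exact hy
      exact closure_minimal (fun z hz => (hf1 z hz).le) (isClosed_le f.continuous continuous_const) this
    have h2 : ∀ y ∈ c m, b ≤ f y := by
      intro y hy
      have : y ∈ closure (interior (c m : Set (E d))) := by rw [hcl]; exact hy
      exact closure_minimal (fun z hz => (hf2 z hz).le) (isClosed_le continuous_const f.continuous) this
    set v := (InnerProductSpace.toDual ℝ (E d)).symm f with hv
    have hvf : ∀ y, ⟪v, y⟫ = f y := fun y => by
      rw [hv, InnerProductSpace.toDual_symm_apply]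
    have hv0 : v ≠ 0 := by
      intro h0
      obtain ⟨y, hy⟩ := hc.interior_nonempty n
      obtain ⟨z, hz⟩ := hc.interior_nonempty m
      have := (hf1 y hy).trans (hf2 z hz)
      rw [← hvf, ← hvf, h0] at this
      simp at this
    refine ⟨‖v‖⁻¹ • v, norm_smul_inv_norm hv0, fun y hy z hz => ?_⟩
    rw [real_inner_smul_left, real_inner_smul_left, hvf, hvf]
    exact mul_le_mul_of_nonneg_left ((h1 y hy).trans (h2 z hz)) (by positivity)
  choose! u hu1 hu2 using hsep
  have hJ : ∀ m ∈ J, m ≠ n := fun m hm => Finset.ne_of_mem_erase hm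
  refine ⟨hc.interior_nonempty n, J.card, 0, fun i => u (J.equivFin.symm i), fun i =>
    hu1 _ (hJ _ (J.equivFin.symm i).2), fun z => ?_⟩
  rw [or_iff_not_imp_left]
  intro hz
  have hzK : z ∈ K := by
    rw [hK, Metric.cthickening_eq_preimage_infEDist]
    rw [Nat.cast_zero, zero_add, div_one, not_le] at hz
    rw [Set.mem_preimage, Set.mem_Iic, ENNReal.ofReal_one,
      ← ENNReal.ofReal_toReal (Metric.infEDist_ne_top (c n).nonempty)]
    exact ENNReal.ofReal_le_one.2 hz.le
  obtain ⟨m, hm⟩ := Set.mem_iUnion.1 (hc.cover.symm ▸ Set.mem_univ z)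
  by_cases hmn : m = n
  · exact Or.inl (hmn ▸ hm)
  · have hmJ : m ∈ J := Finset.mem_erase.2 ⟨hmn, hfin.mem_toFinset.2 ⟨z, hm, hzK⟩⟩
    refine Or.inr ⟨J.equivFin ⟨m, hmJ⟩, fun y hy => ?_⟩
    simpa using hu2 m hmn y hy z hm

lemma dimSet_eq_of_interior_nonempty {s : Set (E d)} (h : (interior s).Nonempty) : dimSet s = d := by
  have h1 : vectorSpan ℝ s = ⊤ := by
    rw [← direction_affineSpan, top_unique (le_trans (le_of_eq
      (isOpen_interior.affineSpan_eq_top h).symm) (affineSpan_mono ℝ interior_subset)),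
      AffineSubspace.direction_top]
  rw [dimSet, h1, finrank_top, finrank_euclideanSpace_fin]

lemma IsTessellation.dimSet_inter_lt (hc : IsTessellation c) {i j : ℕ} (hij : c i ≠ c j)
    (hne : ((c i : Set (E d)) ∩ c j).Nonempty) : dimSet ((c i : Set (E d)) ∩ c j) < d := by
  refine lt_of_le_of_ne ?_ fun h => ?_
  · have := Submodule.finrank_le (vectorSpan ℝ ((c i : Set (E d)) ∩ c j))
    rwa [finrank_euclideanSpace_fin] at this
  · have h1 : vectorSpan ℝ ((c i : Set (E d)) ∩ c j) = ⊤ := by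
      apply Submodule.eq_top_of_finrank_eq
      rw [finrank_euclideanSpace_fin]
      exact h
    have h2 : (interior ((c i : Set (E d)) ∩ c j)).Nonempty := by
      rw [((c i).convex.inter (c j).convex).interior_nonempty_iff_affineSpan_eq_top]
      rwa [← AffineSubspace.affineSpan_eq_top_iff_vectorSpan_eq_top_of_nonempty ℝ _ _ hne] at h1
    rw [interior_inter] at h2
    exact (Set.not_disjoint_iff_nonempty_inter.2 h2)
      (hc.disjoint_interior i j fun h => hij (by rw [h]))

lemma IsTessellation.mem_facetUnion_iff (hc : IsTessellation c) (hd : 1 ≤ d) {x : E d} :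
    x ∈ facetUnion (d - 1) c ↔ ∃ i j, dimSet ((c i : Set (E d)) ∩ c j) = d - 1 ∧
      x ∈ c i ∧ x ∈ c j := by
  constructor
  · rintro ⟨F, ⟨hne, hdim, I, ⟨i, hi⟩, rfl⟩, hx⟩
    have hxI : ∀ j ∈ I, x ∈ c j := by simpa using hx
    have hsub : ∀ j ∈ I, ⋂ i ∈ I, (c i : Set (E d)) ⊆ (c i : Set (E d)) ∩ c j := fun j hj =>
      Set.subset_inter (Set.biInter_subset_of_mem hi) (Set.biInter_subset_of_mem hj)
    obtain ⟨j, hj, hij⟩ : ∃ j ∈ I, c i ≠ c j := by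
      by_contra! h
      have : ⋂ j ∈ I, (c j : Set (E d)) = c i := by
        refine Set.Subset.antisymm (Set.biInter_subset_of_mem hi) (Set.subset_iInter₂ fun j hj => ?_)
        rw [h j hj]
      rw [this, dimSet_eq_of_interior_nonempty (hc.interior_nonempty i)] at hdim
      omega
    refine ⟨i, j, ?_, hxI i hi, hxI j hj⟩
    have h1 := dimSet_mono (hsub j hj)
    have h2 := hc.dimSet_inter_lt hij ⟨x, hxI i hi, hxI j hj⟩
    omega
  · rintro ⟨i, j, hdim, hxi, hxj⟩
    exact Set.mem_sUnion.2 ⟨(c i : Set (E d)) ∩ c j,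
      ⟨⟨x, hxi, hxj⟩, hdim, {i, j}, by simp, by simp⟩, hxi, hxj⟩

lemma IsTessellation.isCompact_facetUnion_inter (hc : IsTessellation c) (hd : 1 ≤ d)
    {A : Set (E d)} (hA : IsCompact A) : IsCompact (facetUnion (d - 1) c ∩ A) := by
  have hfin := hc.locallyFinite A hA
  have : facetUnion (d - 1) c ∩ A = A ∩ ⋃ i ∈ {n | ((c n : Set (E d)) ∩ A).Nonempty},
      ⋃ j ∈ {n | ((c n : Set (E d)) ∩ A).Nonempty}, ⋃ _ : dimSet ((c i : Set (E d)) ∩ c j) = d - 1,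
        ((c i : Set (E d)) ∩ c j) := by
    ext x
    simp only [Set.mem_inter_iff, hc.mem_facetUnion_iff hd, Set.mem_iUnion, Set.mem_ofPred_eq,
      SetLike.mem_coe, exists_prop]
    constructor
    · rintro ⟨⟨i, j, hdim, hi, hj⟩, hx⟩
      exact ⟨hx, i, ⟨x, hi, hx⟩, j, ⟨x, hj, hx⟩, hdim, hi, hj⟩
    · rintro ⟨hx, i, -, j, -, hdim, hi, hj⟩
      exact ⟨⟨i, j, hdim, hi, hj⟩, hx⟩
  rw [this]
  refine hA.inter_right ?_
  refine hfin.isClosed_biUnion fun i _ => hfin.isClosed_biUnion fun j _ =>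
    isClosed_iUnion_of_finite fun _ => (c i).isClosed.inter (c j).isClosed

/-! ### Motions of tessellations -/

lemma dimSet_image (g : E d ≃ᵃⁱ[ℝ] E d) (F : Set (E d)) : dimSet (g '' F) = dimSet F := by
  have : vectorSpan ℝ (g '' F) =
      (vectorSpan ℝ F).map (g.linearIsometryEquiv.toLinearEquiv : E d →ₗ[ℝ] E d) :=
    ((g.toAffineEquiv : E d →ᵃ[ℝ] E d).map_vectorSpan).symm
  rw [dimSet, this, dimSet]
  exact LinearEquiv.finrank_map_eq _ _

lemma facetUnion_moveBody (g : E d ≃ᵃⁱ[ℝ] E d) (j : ℕ) (c : ℕ → Body d) :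
    facetUnion j (fun n => moveBody g (c n)) = g '' facetUnion j c := by
  have himg : ∀ I : Finset ℕ, ⋂ i ∈ I, (moveBody g (c i) : Set (E d)) =
      g '' ⋂ i ∈ I, (c i : Set (E d)) := by
    intro I
    rw [Set.image_iInter g.bijective]
    refine Set.iInter_congr fun i => ?_
    rw [Set.image_iInter g.bijective]
    rfl
  rw [facetUnion, facetUnion, Set.image_sUnion]
  congr 1
  ext F
  constructor
  · rintro ⟨hne, hdim, I, hI, rfl⟩
    rw [himg] at hne hdim ⊢
    rw [dimSet_image] at hdim
    exact ⟨_, ⟨hne.of_image, hdim, I, hI, rfl⟩, rfl⟩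
  · rintro ⟨_, ⟨hne, hdim, I, hI, rfl⟩, rfl⟩
    exact ⟨hne.image g, by rw [dimSet_image, hdim], I, hI, (himg I).symm⟩

lemma IsTessellation.moveBody (hc : IsTessellation c) (g : E d ≃ᵃⁱ[ℝ] E d) :
    IsTessellation fun n => moveBody g (c n) := by
  have hint : ∀ n, interior (Tess.moveBody g (c n) : Set (E d)) = g '' interior (c n : Set (E d)) :=
    fun n => (g.toHomeomorph.image_interior _).symm
  refine ⟨fun n => ?_, fun n m hnm => ?_, ?_, fun K hK => ?_⟩
  · rw [hint]
    exact (hc.interior_nonempty n).image g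
  · rw [hint, hint, Set.disjoint_image_iff g.injective]
    exact hc.disjoint_interior n m hnm
  · change ⋃ n, g '' (c n : Set (E d)) = Set.univ
    rw [← Set.image_iUnion, hc.cover, Set.image_univ, g.surjective.range_eq]
  · refine (hc.locallyFinite (g ⁻¹' K) ?_).subset ?_
    · exact g.toHomeomorph.isCompact_preimage.2 hK
    · rintro n ⟨_, ⟨x, hx, rfl⟩, hxK⟩
      exact ⟨x, hx, hxK⟩

/-! ### Measurability of facet functionals of a point process of cells -/

lemma pointProcess_apply (c : ℕ → Body d) {A : Set (Body d)} (hA : MeasurableSet A) :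
    pointProcess c A = ∑' n, A.indicator 1 (c n) := by
  rw [pointProcess, Measure.sum_apply _ hA]
  simp [Measure.dirac_apply' _ hA]

lemma lintegral_pointProcess (c : ℕ → Body d) {f : Body d → ℝ≥0∞} (hf : Measurable f) :
    ∫⁻ C, f C ∂(pointProcess c) = ∑' n, f (c n) := by
  rw [pointProcess, lintegral_sum_measure]
  simp [lintegral_dirac' _ hf]

lemma measurable_pointProcess {Ω : Type*} [MeasurableSpace Ω] {X : ℕ → Ω → Body d}
    (hX : ∀ n, Measurable (X n)) : Measurable fun ω => pointProcess fun n => X n ω := by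
  refine Measure.measurable_of_measurable_coe _ fun A hA => ?_
  simp only [pointProcess_apply _ hA]
  exact Measurable.tsum fun n => (measurable_one.indicator hA).comp (hX n)

/-- The bodies having the `n`-th point of a fixed dense sequence in their interior. -/
def bodiesAt (d n : ℕ) : Set (Body d) :=
  {C | TopologicalSpace.denseSeq (E d) n ∈ interior (C : Set (E d))}

lemma measurableSet_bodiesAt (d n : ℕ) : MeasurableSet (bodiesAt d n) :=
  measurableSet_mem_interior _

/-- The cell having the `n`-th point of a fixed dense sequence in its interior, as a kernel from
counting measures to bodies. It is cut off so as to be a finite kernel. -/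
noncomputable def cellAt (d n : ℕ) : Kernel (Measure (Body d)) (Body d) where
  toFun := {N : Measure (Body d) | N (bodiesAt d n) ≤ 1}.indicator
    fun N => N.restrict (bodiesAt d n)
  measurable' := by
    refine Measurable.indicator (Measure.measurable_of_measurable_coe _ fun A hA => ?_) ?_
    · simp only [Measure.restrict_apply hA]
      exact Measure.measurable_coe (hA.inter (measurableSet_bodiesAt d n))
    · exact measurableSet_le (Measure.measurable_coe (measurableSet_bodiesAt d n)) measurable_const

lemma cellAt_of_le {n : ℕ} {N : Measure (Body d)} (h : N (bodiesAt d n) ≤ 1) :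
    cellAt d n N = N.restrict (bodiesAt d n) :=
  Set.indicator_of_mem (s := {N : Measure (Body d) | N (bodiesAt d n) ≤ 1}) h _

instance isFiniteKernel_cellAt (d n : ℕ) : IsFiniteKernel (cellAt d n) := by
  refine ⟨⟨1, ENNReal.one_lt_top, fun N => ?_⟩⟩
  by_cases h : N (bodiesAt d n) ≤ 1
  · rw [cellAt_of_le h]
    simpa using h
  · have : cellAt d n N = 0 :=
      Set.indicator_of_notMem (s := {N : Measure (Body d) | N (bodiesAt d n) ≤ 1}) h _
    simp [this]

/-- The cells of a tessellation, each charged at least once, as an s-finite kernel. -/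
noncomputable def cellKernel (d : ℕ) : Kernel (Measure (Body d)) (Body d) :=
  Kernel.sum (cellAt d)

instance isSFiniteKernel_cellKernel (d : ℕ) : IsSFiniteKernel (cellKernel d) := by
  unfold cellKernel
  infer_instance

lemma IsTessellation.lintegral_cellKernel_ne_zero_iff (hc : IsTessellation c) {f : Body d → ℝ≥0∞}
    (hf : Measurable f) :
    ∫⁻ C, f C ∂(cellKernel d (pointProcess c)) ≠ 0 ↔ ∃ n, f (c n) ≠ 0 := by
  have hat : ∀ q, cellAt d q (pointProcess c) = (pointProcess c).restrict (bodiesAt d q) := by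
    intro q
    refine cellAt_of_le ?_
    rw [pointProcess_apply _ (measurableSet_bodiesAt d q)]
    by_cases h : ∃ n, c n ∈ bodiesAt d q
    · obtain ⟨n, hn⟩ := h
      rw [tsum_eq_single n]
      · exact Set.indicator_le_self' (fun _ _ => zero_le) _
      · intro m hm
        refine Set.indicator_of_notMem (fun hq => ?_) _
        exact Set.disjoint_left.1 (hc.disjoint_interior m n hm) hq hn
    · push Not at h
      rw [ENNReal.tsum_eq_zero.2 fun m => Set.indicator_of_notMem (h m) _]
      exact zero_le
  rw [cellKernel, Kernel.sum_apply, lintegral_sum_measure, Ne, ENNReal.tsum_eq_zero]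
  have hint : ∀ q, ∫⁻ C, f C ∂(cellAt d q (pointProcess c)) =
      ∑' n, (bodiesAt d q).indicator f (c n) := by
    intro q
    rw [hat, ← lintegral_indicator (measurableSet_bodiesAt d q),
      lintegral_pointProcess _ (hf.indicator (measurableSet_bodiesAt d q))]
  simp only [hint, ENNReal.tsum_eq_zero, not_forall]
  constructor
  · rintro ⟨q, n, h⟩
    exact ⟨n, fun h0 => h (Set.indicator_apply_eq_zero.2 fun _ => h0)⟩
  · rintro ⟨n, hn⟩
    obtain ⟨q, hq⟩ := exists_denseSeq_mem_interior (hc.interior_nonempty n)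
    exact ⟨q, n, by rwa [Set.indicator_of_mem (s := bodiesAt d q) hq]⟩

lemma measurable_lintegral_cellKernel {T : Type*} [MeasurableSpace T] {g : T → Measure (Body d)}
    (hg : Measurable g) {f : T → Body d → ℝ≥0∞} (hf : Measurable (Function.uncurry f)) :
    Measurable fun t => ∫⁻ C, f t C ∂(cellKernel d (g t)) := by
  have := Measurable.lintegral_kernel_prod_right (κ := (cellKernel d).comap g hg) hf
  simpa only [Kernel.comap_apply] using this

/-- An event of the form "some pair of cells satisfies `R`" is measurable in the point process of
cells. -/
lemma exists_measurableSet_pair_of_cells {T : Type*} [MeasurableSpace T]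
    {R : Set (Body d × Body d × T)} (hR : MeasurableSet R) :
    ∃ A : Set (Measure (Body d) × T), MeasurableSet A ∧ ∀ c t, IsTessellation c →
      ((pointProcess c, t) ∈ A ↔ ∃ i j, (c i, c j, t) ∈ R) := by
  obtain ⟨φ, hφ, hφR⟩ : ∃ φ : Body d × Body d × T → ℝ≥0∞, Measurable φ ∧ ∀ z, φ z ≠ 0 ↔ z ∈ R :=
    ⟨R.indicator 1, measurable_one.indicator hR, fun z => by simp⟩
  have h1 : Measurable fun z : (Measure (Body d) × T) × Body d =>
      ∫⁻ C', φ (z.2, C', z.1.2) ∂(cellKernel d z.1.1) :=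
    measurable_lintegral_cellKernel (g := fun z : (Measure (Body d) × T) × Body d => z.1.1)
      (f := fun z C' => φ (z.2, C', z.1.2)) (by fun_prop)
      (hφ.comp (f := fun w : ((Measure (Body d) × T) × Body d) × Body d => (w.1.2, w.2, w.1.1.2))
        (by fun_prop))
  have h2 : Measurable fun p : Measure (Body d) × T =>
      ∫⁻ C, ∫⁻ C', φ (C, C', p.2) ∂(cellKernel d p.1) ∂(cellKernel d p.1) :=
    measurable_lintegral_cellKernel (g := Prod.fst)
      (f := fun p C => ∫⁻ C', φ (C, C', p.2) ∂(cellKernel d p.1)) measurable_fst h1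
  refine ⟨_, h2 (measurableSet_singleton 0).compl, fun c t hc => ?_⟩
  have h3 : ∀ C, Measurable fun C' => φ (C, C', t) := fun C => hφ.comp (by fun_prop)
  have h4 : Measurable fun C => ∫⁻ C', φ (C, C', t) ∂(cellKernel d (pointProcess c)) :=
    h1.comp (f := fun C => ((pointProcess c, t), C)) (by fun_prop)
  rw [Set.mem_preimage, Set.mem_compl_iff, Set.mem_singleton_iff]
  rw [← ne_eq, hc.lintegral_cellKernel_ne_zero_iff h4]
  refine exists_congr fun i => ?_
  rw [hc.lintegral_cellKernel_ne_zero_iff (h3 _)]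
  exact exists_congr fun j => hφR _

/-- The Hausdorff measure of the facets of a tessellation within a compact set depending on a
parameter is a measurable function of the point process of cells and of the parameter. -/
theorem exists_measurable_facetUnion_inter (hd : 1 ≤ d) (j : ℕ) {T : Type*} [MeasurableSpace T]
    (A : T → Set (E d)) (hA : ∀ K, IsClosed K → MeasurableSet {p : Body d × Body d × T |
      ∃ x ∈ A p.2.2 ∩ K, x ∈ p.1 ∧ x ∈ p.2.1}) :
    ∃ Φ : Measure (Body d) × T → ℝ≥0∞, Measurable Φ ∧ ∀ c t, IsTessellation c → IsCompact (A t) →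
      Φ (pointProcess c, t) = μHE[j] (facetUnion (d - 1) c ∩ A t) := by
  classical
  have hR : ∀ K, IsClosed K → MeasurableSet {p : Body d × Body d × T |
      (((p.1 : Set (E d)) ∩ p.2.1).Nonempty ∧ dimSet ((p.1 : Set (E d)) ∩ p.2.1) = d - 1) ∧
        ∃ x ∈ A p.2.2 ∩ K, x ∈ p.1 ∧ x ∈ p.2.1} := fun K hK =>
    ((measurableSet_dimSet_inter (d := d) (d - 1)).preimage
      (f := fun p : Body d × Body d × T => (p.1, p.2.1)) (by fun_prop)).inter (hA K hK)
  choose! Hit hHit hHit' using fun K hK => exists_measurableSet_pair_of_cells (hR K hK)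
  obtain ⟨Φ, hΦ, h⟩ := exists_measurable_euclideanHausdorffMeasure j Hit hHit
  refine ⟨Φ, hΦ, fun c t hc ht => h _ _ (hc.isCompact_facetUnion_inter hd ht) fun K hK => ?_⟩
  rw [hHit' K hK c t hc]
  constructor
  · rintro ⟨i, j, ⟨-, hdim⟩, x, ⟨hxA, hxK⟩, hxi, hxj⟩
    exact ⟨x, ⟨(hc.mem_facetUnion_iff hd).2 ⟨i, j, hdim, hxi, hxj⟩, hxA⟩, hxK⟩
  · rintro ⟨x, ⟨hx, hxA⟩, hxK⟩
    obtain ⟨i, j, hdim, hxi, hxj⟩ := (hc.mem_facetUnion_iff hd).1 hx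
    exact ⟨i, j, ⟨⟨x, hxi, hxj⟩, hdim⟩, x, ⟨hxA, hxK⟩, hxi, hxj⟩

/-- `exists_measurable_facetUnion_inter` for a fixed compact set. -/
theorem exists_measurable_facetUnion_inter_const (hd : 1 ≤ d) (j : ℕ) {A : Set (E d)}
    (hA : IsCompact A) :
    ∃ Φ : Measure (Body d) → ℝ≥0∞, Measurable Φ ∧ ∀ c, IsTessellation c →
      Φ (pointProcess c) = μHE[j] (facetUnion (d - 1) c ∩ A) := by
  obtain ⟨Φ, hΦ, h⟩ := exists_measurable_facetUnion_inter (T := Unit) hd j (fun _ => A) (by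
    intro K hK
    have hR : IsClosed {z : (Body d × Body d) × E d | z.2 ∈ A ∩ K ∧ z.2 ∈ z.1.1 ∧ z.2 ∈ z.1.2} := by
      simp only [Set.ofPred_and]
      exact .inter ((hA.isClosed.inter hK).preimage continuous_snd) (.inter
        (isClosed_mem_body (by fun_prop) (by fun_prop))
        (isClosed_mem_body (by fun_prop) (by fun_prop)))
    have := (measurableSet_exists_mem_isOpen hR isOpen_univ).preimage
      (f := fun p : Body d × Body d × Unit => (p.1, p.2.1)) (by fun_prop)
    convert this using 1
    ext p
    simp)
  exact ⟨fun N => Φ (N, ()), hΦ.comp (by fun_prop), fun c hc => h c () hc hA⟩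

/-- The Hausdorff measure of the facets of a tessellation within the `k`-faces of a polytope and a
window is measurable, jointly in all three. -/
theorem exists_measurable_facetUnion_faceUnion (hd : 1 ≤ d) (j : ℕ) {k : ℕ} (hk : k ≤ d) :
    ∃ Φ : Measure (Body d) × Body d × Body d → ℝ≥0∞, Measurable Φ ∧ ∀ c C W, IsTessellation c →
      IsPolytopal C → Φ (pointProcess c, C, W) =
        μHE[j] (facetUnion (d - 1) c ∩ (faceUnion k C ∩ W)) := by
  obtain ⟨Φ, hΦ, h⟩ := exists_measurable_facetUnion_inter (T := Body d × Body d) hd j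
    (fun p => skeleton k p.1 ∩ p.2) (by
    intro K hK
    have hR : IsClosed {z : (Body d × Body d × Body d × Body d) × (E d × (Fin (d - k) → E d)) |
        z.2.1 ∈ K ∧ z.2.1 ∈ z.1.1 ∧ z.2.1 ∈ z.1.2.1 ∧ z.2.1 ∈ z.1.2.2.1 ∧ z.2.1 ∈ z.1.2.2.2 ∧
        ∀ i, ∀ y ∈ z.1.2.2.1, ⟪z.2.2 i, y⟫ ≤ ⟪z.2.2 i, z.2.1⟫} := by
      simp only [Set.ofPred_and]
      refine .inter (hK.preimage (by fun_prop)) (.inter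
        (isClosed_mem_body (by fun_prop) (by fun_prop)) (.inter
        (isClosed_mem_body (by fun_prop) (by fun_prop)) (.inter
        (isClosed_mem_body (by fun_prop) (by fun_prop)) (.inter
        (isClosed_mem_body (by fun_prop) (by fun_prop)) ?_))))
      rw [Set.ofPred_forall]
      refine isClosed_iInter fun i => ?_
      exact isClosed_forall_mem_body
        (Q := (Body d × Body d × Body d × Body d) × (E d × (Fin (d - k) → E d))) (by fun_prop)
        (R := {w | ⟪w.1.2.2 i, w.2⟫ ≤ ⟪w.1.2.2 i, w.1.2.1⟫})
        (isClosed_le (by fun_prop) (by fun_prop))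
    have hO : IsOpen {y : E d × (Fin (d - k) → E d) | LinearIndependent ℝ y.2} :=
      isOpen_setOfPred_linearIndependent.preimage continuous_snd
    convert measurableSet_exists_mem_isOpen hR hO using 1
    ext ⟨c, c', C, W⟩
    simp only [skeleton, Set.mem_ofPred_eq, Set.mem_inter_iff, Prod.exists, SetLike.mem_coe]
    constructor
    · rintro ⟨x, ⟨⟨⟨hxC, u, hu, hux⟩, hxW⟩, hxK⟩, hxc, hxc'⟩
      exact ⟨x, u, hu, hxK, hxc, hxc', hxC, hxW, hux⟩
    · rintro ⟨x, u, hu, hxK, hxc, hxc', hxC, hxW, hux⟩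
      exact ⟨x, ⟨⟨⟨hxC, u, hu, hux⟩, hxW⟩, hxK⟩, hxc, hxc'⟩)
  refine ⟨Φ, hΦ, fun c C W hc hC => ?_⟩
  rw [h c (C, W) hc, hC.faceUnion_eq_skeleton hk]
  rw [← hC.faceUnion_eq_skeleton hk]
  exact (hC.isCompact_faceUnion k).inter W.isCompact

/-- The Hausdorff measure of the `k`-faces of a polytope within a window is jointly measurable. -/
theorem exists_measurable_faceUnion (j : ℕ) {k : ℕ} (hk : k ≤ d) :
    ∃ Φ : Body d × Body d → ℝ≥0∞, Measurable Φ ∧ ∀ C W, IsPolytopal C →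
      Φ (C, W) = μHE[j] (faceUnion k C ∩ W) := by
  obtain ⟨Φ, hΦ, h⟩ := exists_measurable_euclideanHausdorffMeasure (T := Body d × Body d) j
    (fun K : Set (E d) => {p | ((skeleton k p.1 ∩ p.2) ∩ K).Nonempty}) (by
    intro K hK
    have hR : IsClosed {z : (Body d × Body d) × (E d × (Fin (d - k) → E d)) |
        z.2.1 ∈ K ∧ z.2.1 ∈ z.1.1 ∧ z.2.1 ∈ z.1.2 ∧
        ∀ i, ∀ y ∈ z.1.1, ⟪z.2.2 i, y⟫ ≤ ⟪z.2.2 i, z.2.1⟫} := by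
      simp only [Set.ofPred_and]
      refine .inter (hK.preimage (by fun_prop)) (.inter
        (isClosed_mem_body (by fun_prop) (by fun_prop)) (.inter
        (isClosed_mem_body (by fun_prop) (by fun_prop)) ?_))
      rw [Set.ofPred_forall]
      refine isClosed_iInter fun i => ?_
      exact isClosed_forall_mem_body
        (Q := (Body d × Body d) × (E d × (Fin (d - k) → E d))) (by fun_prop)
        (R := {w | ⟪w.1.2.2 i, w.2⟫ ≤ ⟪w.1.2.2 i, w.1.2.1⟫})
        (isClosed_le (by fun_prop) (by fun_prop))
    have hO : IsOpen {y : E d × (Fin (d - k) → E d) | LinearIndependent ℝ y.2} :=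
      isOpen_setOfPred_linearIndependent.preimage continuous_snd
    convert measurableSet_exists_mem_isOpen hR hO using 1
    ext ⟨C, W⟩
    simp only [skeleton, Set.mem_ofPred_eq, Set.Nonempty, Set.mem_inter_iff, Prod.exists,
      SetLike.mem_coe]
    constructor
    · rintro ⟨x, ⟨⟨hxC, u, hu, hux⟩, hxW⟩, hxK⟩
      exact ⟨x, u, hu, hxK, hxC, hxW, hux⟩
    · rintro ⟨x, u, hu, hxK, hxC, hxW, hux⟩
      exact ⟨x, ⟨⟨hxC, u, hu, hux⟩, hxW⟩, hxK⟩)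
  refine ⟨Φ, hΦ, fun C W hC => ?_⟩
  rw [hC.faceUnion_eq_skeleton hk]
  refine h (C, W) _ ?_ fun K hK => Iff.rfl
  rw [← hC.faceUnion_eq_skeleton hk]
  exact (hC.isCompact_faceUnion k).inter W.isCompact

end tessellation

/-! ### Motions between flats -/

section flats

open scoped RealInnerProductSpace

variable {d k : ℕ}

lemma abs_det_linearIsometryEquiv (T : E d ≃ₗᵢ[ℝ] E d) :
    |LinearMap.det (T.toLinearEquiv : E d →ₗ[ℝ] E d)| = 1 := by
  have h := Measure.addHaar_image_linearMap (volume : Measure (E d))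
    (T.toLinearEquiv : E d →ₗ[ℝ] E d) (Metric.closedBall 0 1)
  have h1 : (T.toLinearEquiv : E d →ₗ[ℝ] E d) '' Metric.closedBall 0 1 = Metric.closedBall 0 1 := by
    have := T.image_closedBall 0 1
    rw [map_zero] at this
    exact this
  rw [h1] at h
  have h0 : volume (Metric.closedBall (0 : E d) 1) ≠ 0 :=
    (Metric.measure_closedBall_pos volume 0 one_pos).ne'
  have h2 : ENNReal.ofReal |LinearMap.det (T.toLinearEquiv : E d →ₗ[ℝ] E d)| = 1 :=
    (ENNReal.mul_right_inj h0 measure_closedBall_lt_top.ne).1 (by rw [mul_comm, ← h, mul_one])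
  exact ENNReal.ofReal_eq_one.1 h2

/-- Any two `k`-flats, `k < d`, together with their Cartesian coordinates, are related by a proper
motion: an improper one is corrected by the reflection in a hyperplane containing the second. -/
lemma exists_isProperMotion_comp (hk : k < d) (i i' : E k →ᵃⁱ[ℝ] E d) :
    ∃ g : E d ≃ᵃⁱ[ℝ] E d, IsProperMotion g ∧ ∀ x, g (i x) = i' x := by
  let L := i.linearIsometry
  let L' := i'.linearIsometry
  let T₀ : E d →ₗᵢ[ℝ] E d := (L'.comp L.equivRange.symm.toLinearIsometry).extend
  have hT₀ : ∀ x, T₀ (L x) = L' x := by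
    intro x
    have := (L'.comp L.equivRange.symm.toLinearIsometry).extend_apply (L.equivRange x)
    simpa using this
  let T₁ : E d ≃ₗᵢ[ℝ] E d := T₀.toLinearIsometryEquiv rfl
  have hT₁ : ∀ x, T₁ (L x) = L' x := hT₀
  obtain ⟨T, hT, hdet⟩ : ∃ T : E d ≃ₗᵢ[ℝ] E d, (∀ x, T (L x) = L' x) ∧
      LinearMap.det (T.toLinearEquiv : E d →ₗ[ℝ] E d) = 1 := by
    rcases (abs_eq zero_le_one).1 (abs_det_linearIsometryEquiv T₁) with h | h
    · exact ⟨T₁, hT₁, h⟩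
    have hrank : Module.finrank ℝ (LinearMap.range L'.toLinearMap) = k := by
      rw [LinearMap.finrank_range_of_inj L'.injective, finrank_euclideanSpace_fin]
    obtain ⟨n, hn, hn0⟩ : ∃ n ∈ (LinearMap.range L'.toLinearMap)ᗮ, n ≠ 0 := by
      apply Submodule.exists_mem_ne_zero_of_ne_bot
      intro hbot
      have := Submodule.finrank_add_finrank_orthogonal (LinearMap.range L'.toLinearMap)
      rw [hbot, hrank, finrank_bot, finrank_euclideanSpace_fin] at this
      omega
    set H := (Submodule.span ℝ {n})ᗮ with hH
    refine ⟨T₁.trans H.reflection, fun x => ?_, ?_⟩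
    · rw [LinearIsometryEquiv.trans_apply, hT₁]
      apply Submodule.reflection_mem_subspace_eq_self
      rw [hH, Submodule.mem_orthogonal_singleton_iff_inner_left]
      exact hn _ ⟨x, rfl⟩
    · have : ((T₁.trans H.reflection).toLinearEquiv : E d →ₗ[ℝ] E d) =
          (H.reflection.toLinearEquiv : E d →ₗ[ℝ] E d) ∘ₗ (T₁.toLinearEquiv : E d →ₗ[ℝ] E d) := rfl
      rw [this, LinearMap.det_comp, h, Submodule.det_reflection, hH,
        Submodule.orthogonal_orthogonal, finrank_span_singleton hn0]
      norm_num
  let g : E d ≃ᵃⁱ[ℝ] E d := ((AffineIsometryEquiv.constVAdd ℝ (E d) (-(i 0))).trans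
    T.toAffineIsometryEquiv).trans (AffineIsometryEquiv.constVAdd ℝ (E d) (i' 0))
  have hg : ∀ y, g y = i' 0 + T (-(i 0) + y) := fun y => rfl
  refine ⟨g, ?_, fun x => ?_⟩
  · have : g.linearIsometryEquiv = T := by
      ext1 v
      have := g.map_vsub v 0
      rw [vsub_eq_sub, sub_zero, hg, hg, vsub_eq_sub] at this
      rw [this, add_sub_add_left_eq_sub, ← map_sub]
      simp
    rw [IsProperMotion, this, hdet]
  · rw [hg]
    have h1 : L x = i x - i 0 := by
      have := i.map_vsub x 0
      simpa using this
    have h2 : L' x = i' x - i' 0 := by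
      have := i'.map_vsub x 0
      simpa using this
    rw [show -(i 0) + i x = L x by rw [h1]; abel, hT, h2]
    abel

/-- The inclusion of the coordinate flat `ℝ^k × {0}`. -/
noncomputable def coordInclusion (hk : k ≤ d) : E k →ₗᵢ[ℝ] E d where
  toFun x := WithLp.toLp 2 fun i => if h : (i : ℕ) < k then x ⟨i, h⟩ else 0
  map_add' x y := by
    ext i
    by_cases h : (i : ℕ) < k <;> simp [h]
  map_smul' c x := by
    ext i
    by_cases h : (i : ℕ) < k <;> simp [h]
  norm_map' x := by
    rw [EuclideanSpace.norm_eq, EuclideanSpace.norm_eq]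
    congr 1
    symm
    refine Fintype.sum_of_injective (Fin.castLE hk) (Fin.castLE_injective hk) _ _ ?_ ?_
    · intro i hi
      have : ¬ (i : ℕ) < k := fun h => hi ⟨⟨i, h⟩, rfl⟩
      simp [this]
    · intro i
      simp

lemma coordInclusion_image_cube (hk : k ≤ d) : coordInclusion hk '' cube k = flatCube d k := by
  ext y
  constructor
  · rintro ⟨x, hx, rfl⟩ i
    constructor
    · intro h
      simpa [coordInclusion, h] using hx ⟨i, h⟩
    · intro h
      simp [coordInclusion, not_lt.2 h]
  · intro hy
    refine ⟨WithLp.toLp 2 fun i => y (Fin.castLE hk i), fun i => (hy (Fin.castLE hk i)).1 i.2, ?_⟩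
    ext i
    by_cases h : (i : ℕ) < k
    · simp [coordInclusion, h]
    · simp [coordInclusion, h, (hy i).2 (not_lt.1 h)]

lemma measurableSet_cube : MeasurableSet (cube d) := by
  rw [cube, Set.ofPred_forall]
  exact .iInter fun i => measurableSet_Ico.preimage (by fun_prop)

lemma volume_cube : volume (cube d) = 1 := by
  have : cube d = (MeasurableEquiv.toLp 2 (Fin d → ℝ)).symm ⁻¹'
      (Set.univ.pi fun _ => Set.Ico (0 : ℝ) 1) := by
    ext x
    simp [cube, Set.mem_pi]
  rw [this, (EuclideanSpace.volume_preserving_symm_measurableEquiv_toLp (Fin d)).measure_preimage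
    (MeasurableSet.univ_pi fun _ => measurableSet_Ico).nullMeasurableSet, Real.volume_pi_Ico]
  simp

lemma borel_eq_generateFrom_isCompact :
    (inferInstance : MeasurableSpace (E k)) = .generateFrom {s : Set (E k) | IsCompact s} := by
  refine le_antisymm ?_ (MeasurableSpace.generateFrom_le fun s hs => hs.measurableSet)
  rw [BorelSpace.measurable_eq (α := E k), borel_eq_generateFrom_isClosed]
  refine MeasurableSpace.generateFrom_le fun s hs => ?_
  have : s = ⋃ n : ℕ, s ∩ Metric.closedBall 0 n := by
    rw [← Set.inter_iUnion, Metric.iUnion_closedBall_nat, Set.inter_univ]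
  rw [this]
  exact .iUnion fun n => MeasurableSpace.measurableSet_generateFrom
    ((isCompact_closedBall (0 : E k) n).inter_left hs)

lemma isPiSystem_isCompact : IsPiSystem {s : Set (E k) | IsCompact s} :=
  fun _ hs _ ht _ => hs.inter ht

lemma ext_of_isCompact {μ ν : Measure (E k)} (hμ : ∀ B, IsCompact B → μ B ≠ ∞)
    (h : ∀ B, IsCompact B → μ B = ν B) : μ = ν :=
  Measure.ext_of_generateFrom_of_iUnion _ (fun n : ℕ => Metric.closedBall 0 n)
    borel_eq_generateFrom_isCompact isPiSystem_isCompact (Metric.iUnion_closedBall_nat 0)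
    (fun _ => isCompact_closedBall _ _) (fun _ => hμ _ (isCompact_closedBall _ _)) h

end flats

/-! ### The trace of a motion-invariant tessellation in a flat -/

section trace

variable {Ω : Type*} [MeasurableSpace Ω] {P : Measure Ω} {d k j : ℕ} {X₀ : ℕ → Ω → Body d}

lemma isProperMotion_constVAdd (x : E d) :
    IsProperMotion (AffineIsometryEquiv.constVAdd ℝ (E d) x) := by
  have : (AffineIsometryEquiv.constVAdd ℝ (E d) x).linearIsometryEquiv =
      LinearIsometryEquiv.refl ℝ (E d) := rfl
  rw [IsProperMotion, this]
  exact LinearMap.det_id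

lemma IsRandomTessellation.aemeasurable_facetUnion_inter (hT : IsRandomTessellation X₀ P)
    (hd : 1 ≤ d) {A : Set (E d)} (hA : IsCompact A) :
    AEMeasurable (fun ω => μHE[j] (facetUnion (d - 1) (fun n => X₀ n ω) ∩ A)) P := by
  obtain ⟨Φ, hΦ, h⟩ := exists_measurable_facetUnion_inter_const hd j hA
  refine ⟨_, hΦ.comp (measurable_pointProcess hT.measurable), ?_⟩
  filter_upwards [hT.isTessellation] with ω hω
  exact (h _ hω).symm

/-- Moments of the facet content of a motion-invariant tessellation do not change if the compact
set is moved. -/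
lemma lintegral_facetUnion_motion (hT : IsRandomTessellation X₀ P) (hX₀ : IsMotionInvariant X₀ P)
    (hd : 1 ≤ d) {f : ℝ≥0∞ → ℝ≥0∞} (hf : Measurable f) {g : E d ≃ᵃⁱ[ℝ] E d} (hg : IsProperMotion g)
    {A : Set (E d)} (hA : IsCompact A) :
    ∫⁻ ω, f (μHE[j] (facetUnion (d - 1) (fun n => X₀ n ω) ∩ g '' A)) ∂P =
      ∫⁻ ω, f (μHE[j] (facetUnion (d - 1) (fun n => X₀ n ω) ∩ A)) ∂P := by
  obtain ⟨Φ, hΦ, h⟩ := exists_measurable_facetUnion_inter_const hd j (hA.image g.continuous)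
  have hid := (hX₀ g hg).comp (hf.comp hΦ)
  calc _ = ∫⁻ ω, f (Φ (pointProcess fun n => X₀ n ω)) ∂P := by
        refine lintegral_congr_ae ?_
        filter_upwards [hT.isTessellation] with ω hω
        rw [h _ hω]
    _ = ∫⁻ ω, f (Φ (pointProcess fun n => moveBody g (X₀ n ω))) ∂P := hid.lintegral_eq.symm
    _ = _ := by
        refine lintegral_congr_ae ?_
        filter_upwards [hT.isTessellation] with ω hω
        rw [h _ (hω.moveBody g), facetUnion_moveBody, ← Set.image_inter g.injective,
          g.isometry.euclideanHausdorffMeasure_image]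

lemma lintegral_facetUnion_image_eq (hT : IsRandomTessellation X₀ P)
    (hX₀ : IsMotionInvariant X₀ P) (hk : k < d) (i i' : E k →ᵃⁱ[ℝ] E d) {B : Set (E k)}
    (hB : IsCompact B) :
    ∫⁻ ω, μHE[j] (facetUnion (d - 1) (fun n => X₀ n ω) ∩ i' '' B) ∂P =
      ∫⁻ ω, μHE[j] (facetUnion (d - 1) (fun n => X₀ n ω) ∩ i '' B) ∂P := by
  obtain ⟨g, hg, hgi⟩ := exists_isProperMotion_comp hk i i'
  have : i' '' B = g '' (i '' B) := by
    rw [Set.image_image]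
    simp only [hgi]
  rw [this]
  exact lintegral_facetUnion_motion hT hX₀ (by omega) measurable_id hg (hB.image i.continuous)

lemma lintegral_facetUnion_image_lt_top (hT : IsRandomTessellation X₀ P)
    (hX₀ : IsMotionInvariant X₀ P) (hk : k < d)
    (hfin : ∫⁻ ω, μHE[j] (facetUnion (d - 1) (fun n => X₀ n ω) ∩ flatCube d k) ∂P < ∞)
    (i : E k →ᵃⁱ[ℝ] E d) {B : Set (E k)} (hB : IsCompact B) :
    ∫⁻ ω, μHE[j] (facetUnion (d - 1) (fun n => X₀ n ω) ∩ i '' B) ∂P < ∞ := by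
  have hd : 1 ≤ d := by omega
  let y : E k := WithLp.toLp 2 fun _ => 1 / 2
  have hy : Metric.closedBall y (1 / 4) ⊆ cube k := by
    intro x hx l
    have h1 : ‖(x - y) l‖ ≤ 1 / 4 := (PiLp.norm_apply_le (x - y) l).trans (by
      simpa [dist_eq_norm] using hx)
    have h2 : (x - y) l = x l - 1 / 2 := rfl
    rw [h2, Real.norm_eq_abs, abs_le] at h1
    constructor <;> linarith
  have hball : ∀ x : E k, ∫⁻ ω, μHE[j] (facetUnion (d - 1) (fun n => X₀ n ω) ∩
      i '' Metric.closedBall x (1 / 4)) ∂P < ∞ := by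
    intro x
    let i' : E k →ᵃⁱ[ℝ] E d := (coordInclusion hk.le).toAffineIsometry.comp
      (AffineIsometryEquiv.constVAdd ℝ (E k) (y - x)).toAffineIsometry
    rw [lintegral_facetUnion_image_eq hT hX₀ hk i' i (isCompact_closedBall _ _)]
    refine (lintegral_mono fun ω => measure_mono (Set.inter_subset_inter_right _ ?_)).trans_lt hfin
    rw [← coordInclusion_image_cube hk.le]
    rintro _ ⟨z, hz, rfl⟩
    refine ⟨(y - x) + z, hy ?_, rfl⟩
    rw [mem_closedBall_iff_norm] at hz ⊢
    rwa [show y - x + z - y = z - x by abel]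
  obtain ⟨t, -, ht⟩ := hB.elim_nhds_subcover (fun x => Metric.closedBall x (1 / 4))
    fun x _ => Metric.closedBall_mem_nhds x (by norm_num)
  calc _ ≤ ∫⁻ ω, ∑ x ∈ t, μHE[j] (facetUnion (d - 1) (fun n => X₀ n ω) ∩
          i '' Metric.closedBall x (1 / 4)) ∂P := by
        refine lintegral_mono fun ω => ?_
        refine (measure_mono ?_).trans (measure_biUnion_finset_le t _)
        rw [← Set.inter_iUnion₂, ← Set.image_iUnion₂]
        exact Set.inter_subset_inter_right _ (Set.image_mono ht)
    _ = ∑ x ∈ t, ∫⁻ ω, μHE[j] (facetUnion (d - 1) (fun n => X₀ n ω) ∩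
          i '' Metric.closedBall x (1 / 4)) ∂P :=
        lintegral_finsetSum' _ fun x _ => hT.aemeasurable_facetUnion_inter hd
          ((isCompact_closedBall _ _).image i.continuous)
    _ < ∞ := ENNReal.sum_lt_top.2 fun x _ => hball x

/-- The intensity measure, in the coordinates `i` of a `k`-flat, of the random measure given by the
`j`-dimensional content of the facets of `X₀`. -/
lemma exists_traceMeasure (hT : IsRandomTessellation X₀ P) (hX₀ : IsMotionInvariant X₀ P)
    (hk : k < d)
    (hfin : ∫⁻ ω, μHE[j] (facetUnion (d - 1) (fun n => X₀ n ω) ∩ flatCube d k) ∂P < ∞)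
    (i : E k →ᵃⁱ[ℝ] E d) :
    ∃ η : Measure (E k), ∀ B, MeasurableSet B →
      AEMeasurable (fun ω => μHE[j] (facetUnion (d - 1) (fun n => X₀ n ω) ∩ i '' B)) P ∧
      η B = ∫⁻ ω, μHE[j] (facetUnion (d - 1) (fun n => X₀ n ω) ∩ i '' B) ∂P := by
  classical
  have hd : 1 ≤ d := by omega
  have hemb : MeasurableEmbedding i := i.isometry.isClosedEmbedding.measurableEmbedding
  let D : Ω → Set (E d) := fun ω => facetUnion (d - 1) fun n => X₀ n ω
  have hae : ∀ᵐ ω ∂P, IsTessellation (fun n => X₀ n ω) ∧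
      ∀ n : ℕ, μHE[j] (D ω ∩ i '' Metric.closedBall 0 n) < ∞ := by
    refine hT.isTessellation.and (ae_all_iff.2 fun n => ?_)
    exact ae_lt_top' (hT.aemeasurable_facetUnion_inter hd
      ((isCompact_closedBall _ _).image i.continuous))
      (lintegral_facetUnion_image_lt_top hT hX₀ hk hfin i (isCompact_closedBall _ _)).ne
  let G : Set Ω := (toMeasurable P {ω | ¬ (IsTessellation (fun n => X₀ n ω) ∧
      ∀ n : ℕ, μHE[j] (D ω ∩ i '' Metric.closedBall 0 n) < ∞)})ᶜ
  have hGm : MeasurableSet G := (measurableSet_toMeasurable _ _).compl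
  have hGP : ∀ᵐ ω ∂P, ω ∈ G := by
    rw [ae_iff]
    simp only [G, Set.mem_compl_iff, not_not]
    exact (measure_toMeasurable _).trans hae
  have hG : ∀ ω ∈ G, IsTessellation (fun n => X₀ n ω) ∧
      ∀ n : ℕ, μHE[j] (D ω ∩ i '' Metric.closedBall 0 n) < ∞ := by
    intro ω hω
    by_contra h
    exact hω (subset_toMeasurable _ _ h)
  -- The random measure is set to zero off a measurable event of full probability on which it is
  -- locally finite; this makes it measurable, by a π-system argument with the compact sets.
  let θ : Ω → Measure (E k) := G.indicator fun ω => (μHE[j].restrict (D ω)).comap i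
  have hθG : ∀ ω ∈ G, ∀ B, MeasurableSet B → θ ω B = μHE[j] (D ω ∩ i '' B) := by
    intro ω hω B hB
    simp only [θ, Set.indicator_of_mem hω]
    rw [hemb.comap_apply, Measure.restrict_apply (hemb.measurableSet_image.2 hB), Set.inter_comm]
  have hθG' : ∀ ω, ω ∉ G → θ ω = 0 := fun ω hω => Set.indicator_of_notMem hω _
  have hcompact : ∀ B, IsCompact B → Measurable fun ω => θ ω B := by
    intro B hB
    obtain ⟨Φ, hΦ, h⟩ := exists_measurable_facetUnion_inter_const hd j (hB.image i.continuous)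
    have : (fun ω => θ ω B) = G.indicator fun ω => Φ (pointProcess fun n => X₀ n ω) := by
      ext ω
      by_cases hω : ω ∈ G
      · rw [Set.indicator_of_mem hω, hθG ω hω B hB.measurableSet, h _ (hG ω hω).1]
      · rw [Set.indicator_of_notMem hω, hθG' ω hω]
        rfl
    rw [this]
    exact (hΦ.comp (measurable_pointProcess hT.measurable)).indicator hGm
  have hθ : Measurable θ := by
    refine Measure.measurable_of_measurable_coe _ fun B hB => ?_
    have hn : ∀ n : ℕ, Measurable fun ω => (θ ω).restrict (Metric.closedBall 0 n) := by
      intro n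
      have hfinite : ∀ ω, IsFiniteMeasure ((θ ω).restrict (Metric.closedBall 0 n)) := by
        intro ω
        refine ⟨?_⟩
        rw [Measure.restrict_apply_univ]
        by_cases hω : ω ∈ G
        · rw [hθG ω hω _ measurableSet_closedBall]
          exact (hG ω hω).2 n
        · rw [hθG' ω hω]
          exact ENNReal.zero_lt_top
      refine Measurable.measure_of_isPiSystem borel_eq_generateFrom_isCompact
        isPiSystem_isCompact (fun B hB => ?_) ?_
      · simp only [Measure.restrict_apply hB.measurableSet]
        exact hcompact _ (hB.inter_right Metric.isClosed_closedBall)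
      · simp only [Measure.restrict_apply_univ]
        exact hcompact _ (isCompact_closedBall _ _)
    have hsup : (fun ω => θ ω B) = fun ω => ⨆ n : ℕ, (θ ω).restrict (Metric.closedBall 0 n) B := by
      ext ω
      simp only [Measure.restrict_apply hB]
      rw [← Monotone.measure_iUnion, ← Set.inter_iUnion, Metric.iUnion_closedBall_nat,
        Set.inter_univ]
      intro n m hnm
      exact Set.inter_subset_inter_right _ (Metric.closedBall_subset_closedBall (by exact_mod_cast hnm))
    rw [hsup]
    exact .iSup fun n => (Measure.measurable_coe hB).comp (hn n)
  refine ⟨P.bind θ, fun B hB => ?_⟩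
  have hcongr : ∀ᵐ ω ∂P, θ ω B = μHE[j] (D ω ∩ i '' B) := by
    filter_upwards [hGP] with ω hω using hθG ω hω B hB
  refine ⟨⟨_, (Measure.measurable_coe hB).comp hθ, hcongr.mono fun ω hω => hω.symm⟩, ?_⟩
  rw [Measure.bind_apply hB hθ.aemeasurable]
  exact lintegral_congr_ae hcongr

/-- The intensity of the trace of a motion-invariant tessellation in a `k`-flat is a multiple of
Lebesgue measure there, by uniqueness of Haar measure; the factor does not depend on the flat. -/
theorem lintegral_facetUnion_flat (hT : IsRandomTessellation X₀ P) (hX₀ : IsMotionInvariant X₀ P)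
    (hk : k < d)
    (hfin : ∫⁻ ω, μHE[j] (facetUnion (d - 1) (fun n => X₀ n ω) ∩ flatCube d k) ∂P < ∞)
    (i : E k →ᵃⁱ[ℝ] E d) {B : Set (E k)} (hB : MeasurableSet B) :
    AEMeasurable (fun ω => μHE[j] (facetUnion (d - 1) (fun n => X₀ n ω) ∩ i '' B)) P ∧
    ∫⁻ ω, μHE[j] (facetUnion (d - 1) (fun n => X₀ n ω) ∩ i '' B) ∂P =
      (∫⁻ ω, μHE[j] (facetUnion (d - 1) (fun n => X₀ n ω) ∩ flatCube d k) ∂P) * volume B := by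
  choose η hη using exists_traceMeasure (j := j) hT hX₀ hk hfin
  refine ⟨(hη i B hB).1, ?_⟩
  have hcpt : ∀ i B, IsCompact B → η i B ≠ ∞ := by
    intro i B hB
    rw [(hη i B hB.measurableSet).2]
    exact (lintegral_facetUnion_image_lt_top hT hX₀ hk hfin i hB).ne
  -- Independence of the flat includes a translation of the coordinates within one flat, and this is
  -- the translation invariance of `η`.
  have heq : ∀ i i', η i = η i' := fun i i' => ext_of_isCompact (hcpt i) fun B hB => by
    rw [(hη i B hB.measurableSet).2, (hη i' B hB.measurableSet).2]
    exact lintegral_facetUnion_image_eq hT hX₀ hk i' i hB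
  let i₀ : E k →ᵃⁱ[ℝ] E d := (coordInclusion hk.le).toAffineIsometry
  have : IsFiniteMeasureOnCompacts (η i₀) := ⟨fun B hB => (hcpt i₀ B hB).lt_top⟩
  have : (η i₀).IsAddLeftInvariant := by
    refine ⟨fun z => ?_⟩
    let i' : E k →ᵃⁱ[ℝ] E d := i₀.comp (AffineIsometryEquiv.constVAdd ℝ (E k) z).toAffineIsometry
    rw [heq i₀ i']
    ext B hB
    rw [Measure.map_apply (measurable_const_add z) hB,
      (hη i' _ ((measurable_const_add z) hB)).2, ← heq i₀ i', (hη i₀ B hB).2]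
    refine lintegral_congr fun ω => ?_
    congr 2
    ext y
    constructor
    · rintro ⟨x, hx, rfl⟩
      exact ⟨z + x, hx, rfl⟩
    · rintro ⟨x, hx, rfl⟩
      refine ⟨-z + x, by simpa using hx, ?_⟩
      change i₀ (z + (-z + x)) = i₀ x
      rw [add_neg_cancel_left]
  have hc := Measure.isAddLeftInvariant_eq_smul (η i₀) volume
  set c := (η i₀).addHaarScalarFactor volume
  have hc1 : (c : ℝ≥0∞) =
      ∫⁻ ω, μHE[j] (facetUnion (d - 1) (fun n => X₀ n ω) ∩ flatCube d k) ∂P := by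
    have h1 := (hη i₀ (cube k) measurableSet_cube).2
    have h2 : i₀ '' cube k = flatCube d k := coordInclusion_image_cube hk.le
    rw [h2] at h1
    rw [← h1, hc, Measure.smul_apply, volume_cube]
    simp [ENNReal.smul_def]
  rw [← (hη i B hB).2, heq i i₀, ← hc1, hc]
  rfl

/-! ### The trace of a motion-invariant tessellation in the faces of a polytope -/

lemma exists_affineIsometry_of_dimSet {F : Set (E d)} (hF : F.Nonempty) (hk : dimSet F = k) :
    ∃ i : E k →ᵃⁱ[ℝ] E d, F ⊆ Set.range i := by
  obtain ⟨x, hx⟩ := hF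
  have hr : Module.finrank ℝ (vectorSpan ℝ F) = k := hk
  let b := (stdOrthonormalBasis ℝ (vectorSpan ℝ F)).reindex (finCongr hr)
  let L : E k →ₗᵢ[ℝ] E d := (vectorSpan ℝ F).subtypeₗᵢ.comp b.repr.symm.toLinearIsometry
  let i : E k →ᵃⁱ[ℝ] E d := (AffineIsometryEquiv.constVAdd ℝ (E d) x).toAffineIsometry.comp
    L.toAffineIsometry
  refine ⟨i, fun y hy => ⟨b.repr ⟨y - x, vsub_mem_vectorSpan ℝ hy hx⟩, ?_⟩⟩
  have : i (b.repr ⟨y - x, vsub_mem_vectorSpan ℝ hy hx⟩) =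
      x + (b.repr.symm (b.repr ⟨y - x, vsub_mem_vectorSpan ℝ hy hx⟩) : E d) := rfl
  rw [this, LinearIsometryEquiv.symm_apply_apply]
  simp

lemma lintegral_facetUnion_sUnion (hT : IsRandomTessellation X₀ P) (hX₀ : IsMotionInvariant X₀ P)
    (hk : k < d)
    (hfin : ∫⁻ ω, μHE[j] (facetUnion (d - 1) (fun n => X₀ n ω) ∩ flatCube d k) ∂P < ∞)
    {𝓕 : Set (Set (E d))} (h𝓕 : 𝓕.Finite)
    (hm : ∀ F ∈ 𝓕, MeasurableSet F ∧ F.Nonempty ∧ dimSet F = k) :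
    ∀ {M : Set (E d)}, MeasurableSet M →
    AEMeasurable (fun ω => μHE[j] (facetUnion (d - 1) (fun n => X₀ n ω) ∩ (⋃₀ 𝓕 ∩ M))) P ∧
    ∫⁻ ω, μHE[j] (facetUnion (d - 1) (fun n => X₀ n ω) ∩ (⋃₀ 𝓕 ∩ M)) ∂P =
      (∫⁻ ω, μHE[j] (facetUnion (d - 1) (fun n => X₀ n ω) ∩ flatCube d k) ∂P) *
        μHE[k] (⋃₀ 𝓕 ∩ M) := by
  induction 𝓕, h𝓕 using Set.Finite.induction_on with
  | empty => simp
  | @insert F 𝓕 hF h𝓕 ih =>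
    intro M hM
    obtain ⟨hFm, hFne, hFk⟩ := hm F (Set.mem_insert _ _)
    obtain ⟨i, hi⟩ := exists_affineIsometry_of_dimSet hFne hFk
    obtain ⟨h1, h2⟩ := ih (fun G hG => hm G (Set.mem_insert_of_mem _ hG)) (hM.diff hFm)
    have himg : i '' (i ⁻¹' (F ∩ M)) = F ∩ M :=
      Set.image_preimage_eq_of_subset (Set.inter_subset_left.trans hi)
    have hvol : volume (i ⁻¹' (F ∩ M)) = μHE[k] (F ∩ M) := by
      rw [← EuclideanSpace.euclideanHausdorffMeasure_eq_volume,
        ← i.isometry.euclideanHausdorffMeasure_image, himg]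
    obtain ⟨h3, h4⟩ := lintegral_facetUnion_flat (j := j) hT hX₀ hk hfin i
      (i.continuous.measurable (hFm.inter hM))
    rw [himg] at h3 h4
    rw [hvol] at h4
    have e1 : (⋃₀ insert F 𝓕 ∩ M) ∩ F = F ∩ M := by
      rw [Set.sUnion_insert]
      ext x
      simp only [Set.mem_inter_iff, Set.mem_union]
      tauto
    have e2 : (⋃₀ insert F 𝓕 ∩ M) \ F = ⋃₀ 𝓕 ∩ (M \ F) := by
      rw [Set.sUnion_insert]
      ext x
      simp only [Set.mem_inter_iff, Set.mem_union, Set.mem_sdiff]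
      tauto
    have hsplit : ∀ D : Set (E d), μHE[j] (D ∩ (⋃₀ insert F 𝓕 ∩ M)) =
        μHE[j] (D ∩ (F ∩ M)) + μHE[j] (D ∩ (⋃₀ 𝓕 ∩ (M \ F))) := by
      intro D
      rw [← measure_inter_add_sdiff _ hFm, Set.inter_assoc, e1, Set.inter_sdiff_assoc, e2]
    have hsplit' : μHE[k] (⋃₀ insert F 𝓕 ∩ M) = μHE[k] (F ∩ M) + μHE[k] (⋃₀ 𝓕 ∩ (M \ F)) := by
      rw [← measure_inter_add_sdiff _ hFm, e1, e2]
    simp only [hsplit, hsplit']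
    exact ⟨h3.add h1, by rw [lintegral_add_left' h3, h4, h2, mul_add]⟩

theorem lintegral_facetUnion_faceUnion (hT : IsRandomTessellation X₀ P)
    (hX₀ : IsMotionInvariant X₀ P) (hk : k < d)
    (hfin : ∫⁻ ω, μHE[j] (facetUnion (d - 1) (fun n => X₀ n ω) ∩ flatCube d k) ∂P < ∞)
    {C : Body d} (hC : IsPolytopal C) (W : Body d) :
    ∫⁻ ω, μHE[j] (facetUnion (d - 1) (fun n => X₀ n ω) ∩ (faceUnion k C ∩ W)) ∂P =
      (∫⁻ ω, μHE[j] (facetUnion (d - 1) (fun n => X₀ n ω) ∩ flatCube d k) ∂P) *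
        μHE[k] (faceUnion k C ∩ W) :=
  (lintegral_facetUnion_sUnion hT hX₀ hk hfin (hC.finite_faces k)
    (fun _ hF => ⟨(hF.2.1.isCompact C.isCompact).measurableSet, hF.1, hF.2.2⟩)
    W.isClosed.measurableSet).2

end trace

/-! ### The typical cell and Campbell's formula -/

section palm

variable {Ω : Type*} [MeasurableSpace Ω] {P : Measure Ω} {d : ℕ} {X : ℕ → Ω → Body d}
  {α : Body d → E d}

lemma lintegral_cellIntensityMeasure (hX : ∀ n, Measurable (X n)) {f : Body d → ℝ≥0∞}
    (hf : Measurable f) :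
    ∫⁻ C, f C ∂(cellIntensityMeasure X P) = ∫⁻ ω, ∑' n, f (X n ω) ∂P := by
  rw [cellIntensityMeasure, lintegral_sum_measure, lintegral_tsum]
  · exact tsum_congr fun n => lintegral_map hf (hX n)
  · exact fun n => (hf.comp (hX n)).aemeasurable

instance instSFiniteCellIntensityMeasure [IsFiniteMeasure P] :
    SFinite (cellIntensityMeasure X P) := by
  unfold cellIntensityMeasure
  infer_instance

lemma lintegral_cellIntensityMeasure_translate (hX : ∀ n, Measurable (X n))
    (hstat : IsStationary X P) {f : Body d → ℝ≥0∞} (hf : Measurable f) (x : E d) :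
    ∫⁻ C, f (translate x C) ∂(cellIntensityMeasure X P) =
      ∫⁻ C, f C ∂(cellIntensityMeasure X P) := by
  have hfx : Measurable fun C => f (translate x C) :=
    hf.comp (measurable_translate.comp (measurable_const.prodMk measurable_id))
  rw [lintegral_cellIntensityMeasure hX hfx, lintegral_cellIntensityMeasure hX hf]
  have h := ((hstat x).comp (Measure.measurable_lintegral hf)).lintegral_eq
  simpa only [Function.comp_def, lintegral_pointProcess _ hf] using h

lemma measurable_translate_neg (hα : IsAssociatedPoint α) :
    Measurable fun C => translate (-α C) C :=
  measurable_translate.comp (hα.measurable.neg.prodMk measurable_id)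

lemma measurableSet_mem_cube (hα : IsAssociatedPoint α) : MeasurableSet {C | α C ∈ cube d} :=
  hα.measurable measurableSet_cube

lemma cellIntensity_mul_lintegral_palm (hα : IsAssociatedPoint α)
    (hγ0 : cellIntensity α X P ≠ 0) (hγ : cellIntensity α X P ≠ ∞) {g : Body d → ℝ≥0∞}
    (hg : Measurable g) :
    cellIntensity α X P * ∫⁻ C, g C ∂(palm α X P) =
      ∫⁻ C in {C | α C ∈ cube d}, g (translate (-α C) C) ∂(cellIntensityMeasure X P) := by
  rw [palm, lintegral_smul_measure, smul_eq_mul, ← mul_assoc, ENNReal.mul_inv_cancel hγ0 hγ,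
    one_mul, lintegral_map hg (measurable_translate_neg hα)]

/-- Refined Campbell formula: the intensity measure of the cells of a stationary tessellation is
`γ` times the image of Lebesgue measure and the law of the typical cell under translation. -/
theorem lintegral_cellIntensityMeasure_eq_palm [IsFiniteMeasure P] (hX : ∀ n, Measurable (X n))
    (hstat : IsStationary X P) (hα : IsAssociatedPoint α)
    (hγ0 : cellIntensity α X P ≠ 0) (hγ : cellIntensity α X P ≠ ∞) {f : Body d → ℝ≥0∞}
    (hf : Measurable f) :
    ∫⁻ C, f C ∂(cellIntensityMeasure X P) =
      cellIntensity α X P * ∫⁻ C, (∫⁻ x : E d, f (translate x C)) ∂(palm α X P) := by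
  set Λ := cellIntensityMeasure X P
  have hfT : Measurable fun p : E d × Body d => f (translate p.1 p.2) := hf.comp measurable_translate
  have hg : Measurable fun C => ∫⁻ x, f (translate x C) :=
    Measurable.lintegral_prod_left hfT
  have hA := measurableSet_mem_cube hα
  rw [cellIntensity_mul_lintegral_palm hα hγ0 hγ hg]
  have h1 : ∀ C, ∫⁻ x, f (translate x (translate (-α C) C)) = ∫⁻ x, f (translate x C) := by
    intro C
    simp only [translate_translate]
    exact lintegral_add_right_eq_self (fun x => f (translate x C)) (-α C)
  have hind : Measurable fun p : E d × Body d =>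
      (cube d).indicator (1 : E d → ℝ≥0∞) (α p.2 - p.1) :=
    (measurable_one.indicator measurableSet_cube).comp
      ((hα.measurable.comp measurable_snd).sub measurable_fst)
  have hind' : Measurable fun C => (cube d).indicator (1 : E d → ℝ≥0∞) (α C) :=
    (measurable_one.indicator measurableSet_cube).comp hα.measurable
  simp only [h1]
  -- Move the indicator of `α C ∈ cube d` from the cell to the translation vector by invariance of
  -- the intensity measure; the cube has unit volume.
  symm
  calc ∫⁻ C in {C | α C ∈ cube d}, (∫⁻ x : E d, f (translate x C)) ∂Λ
      = ∫⁻ C, (∫⁻ x : E d, (cube d).indicator 1 (α C) * f (translate x C)) ∂Λ := by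
        rw [← lintegral_indicator hA]
        refine lintegral_congr fun C => ?_
        rw [lintegral_const_mul]
        · by_cases hC : α C ∈ cube d
          · rw [Set.indicator_of_mem (s := {C | α C ∈ cube d}) hC, Set.indicator_of_mem hC]
            simp
          · rw [Set.indicator_of_notMem (s := {C | α C ∈ cube d}) hC, Set.indicator_of_notMem hC]
            simp
        · exact hfT.comp (measurable_id.prodMk measurable_const)
    _ = ∫⁻ x : E d, ∫⁻ C, (cube d).indicator 1 (α C) * f (translate x C) ∂Λ := by
        refine lintegral_lintegral_swap (f := fun C x => _) (Measurable.aemeasurable ?_)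
        exact (hind'.comp measurable_fst).mul (hfT.comp measurable_swap)
    _ = ∫⁻ x : E d, ∫⁻ C, (cube d).indicator 1 (α C - x) * f C ∂Λ := by
        refine lintegral_congr fun x => ?_
        have hm : Measurable fun C => (cube d).indicator 1 (α C - x) * f C :=
          (hind.comp (measurable_const.prodMk measurable_id)).mul hf
        rw [← lintegral_cellIntensityMeasure_translate hX hstat hm x]
        simp only [hα.translate, add_sub_cancel_right]
        rfl
    _ = ∫⁻ C, (∫⁻ x : E d, (cube d).indicator 1 (α C - x) * f C) ∂Λ := by
        refine lintegral_lintegral_swap (f := fun x C => _) (Measurable.aemeasurable ?_)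
        exact hind.mul (hf.comp measurable_snd)
    _ = ∫⁻ C, f C ∂Λ := by
        refine lintegral_congr fun C => ?_
        rw [lintegral_mul_const]
        · rw [lintegral_sub_left_eq_self (fun x => (cube d).indicator (1 : E d → ℝ≥0∞) x) (α C),
            lintegral_indicator_one measurableSet_cube, volume_cube, one_mul]
        · exact hind.comp (measurable_id.prodMk measurable_const)

lemma ae_cellIntensityMeasure (hX : ∀ n, Measurable (X n)) {p : Body d → Prop}
    (hp : MeasurableSet {C | p C}) (h : ∀ n, ∀ᵐ ω ∂P, p (X n ω)) :
    ∀ᵐ C ∂(cellIntensityMeasure X P), p C := by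
  rw [cellIntensityMeasure, Measure.ae_sum_iff' hp]
  exact fun n => (ae_map_iff (hX n).aemeasurable hp).2 (h n)

lemma ae_palm (hX : ∀ n, Measurable (X n)) (hα : IsAssociatedPoint α) {p : Body d → Prop}
    (hp : MeasurableSet {C | p C}) (h : ∀ n, ∀ᵐ ω ∂P, p (X n ω))
    (htrans : ∀ C x, p C → p (translate x C)) : ∀ᵐ C ∂(palm α X P), p C := by
  refine Measure.ae_smul_measure ?_ _
  rw [ae_map_iff (measurable_translate_neg hα).aemeasurable hp]
  exact ae_restrict_of_ae ((ae_cellIntensityMeasure hX hp h).mono fun C hC => htrans C _ hC)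

lemma IsRandomTessellation.ae_palm_isPolytopal (hX : IsRandomTessellation X P)
    (hα : IsAssociatedPoint α) : ∀ᵐ C ∂(palm α X P), IsPolytopal C :=
  ae_palm hX.measurable hα measurableSet_isPolytopal
    (fun n => hX.isTessellation.mono fun _ hω => hω.isPolytopal n) fun _ x hC => hC.translate x

end palm

/-! ### Second moments of conditionally independent sums -/

section secondMoment

variable {Ω : Type*} [MeasurableSpace Ω] {P : Measure Ω} [IsProbabilityMeasure P]
  {S T : Type*} [MeasurableSpace S] [MeasurableSpace T]

lemma lintegral_of_indepFun {U : Ω → S} {V : Ω → T} (hU : Measurable U) (hV : Measurable V)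
    (h : IndepFun U V P) {F : S → T → ℝ≥0∞} (hF : Measurable (Function.uncurry F)) :
    ∫⁻ ω, F (U ω) (V ω) ∂P = ∫⁻ ω, ∫⁻ v, F (U ω) v ∂(P.map V) ∂P := by
  have hprod := (indepFun_iff_map_prod_eq_prod_map_map hU.aemeasurable hV.aemeasurable).1 h
  have : IsProbabilityMeasure (P.map V) := Measure.isProbabilityMeasure_map hV.aemeasurable
  have : IsProbabilityMeasure (P.map U) := Measure.isProbabilityMeasure_map hU.aemeasurable
  calc ∫⁻ ω, F (U ω) (V ω) ∂P = ∫⁻ z, Function.uncurry F z ∂(P.map fun ω => (U ω, V ω)) := by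
        rw [lintegral_map hF (hU.prodMk hV)]
        rfl
    _ = ∫⁻ u, ∫⁻ v, F u v ∂(P.map V) ∂(P.map U) := by
        rw [hprod, lintegral_prod _ hF.aemeasurable]
        rfl
    _ = _ := lintegral_map hF.lintegral_prod_right hU

omit [IsProbabilityMeasure P] in
lemma ennreal_tsum_sq_lintegral {f : ℕ → Ω → ℝ≥0∞} (hf : ∀ n, Measurable (f n)) :
    ∫⁻ ω, (∑' n, f n ω) ^ 2 ∂P = ∑' i, ∑' j, ∫⁻ ω, f i ω * f j ω ∂P := by
  have : ∀ ω, (∑' n, f n ω) ^ 2 = ∑' i, ∑' j, f i ω * f j ω := by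
    intro ω
    rw [sq, ← ENNReal.tsum_mul_right]
    exact tsum_congr fun i => ENNReal.tsum_mul_left.symm
  simp only [this]
  have h1 : ∀ i j, AEMeasurable (fun ω => f i ω * f j ω) P := fun i j =>
    ((hf i).mul (hf j)).aemeasurable
  rw [lintegral_tsum (f := fun i ω => ∑' j, f i ω * f j ω) fun i => AEMeasurable.tsum (h1 i)]
  exact tsum_congr fun i => lintegral_tsum (h1 i)

variable {X : ℕ → Ω → S} {N : ℕ → Ω → T} {Q : Measure T} {Φ : T → S → ℝ≥0∞}

lemma lintegral_condIndep_tsum (hX : ∀ n, Measurable (X n)) (hN : ∀ n, Measurable (N n))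
    (hQ : ∀ n, P.map (N n) = Q) (hXN : IndepFun (fun ω n => X n ω) (fun ω n => N n ω) P)
    (hΦ : Measurable (Function.uncurry Φ)) :
    ∫⁻ ω, ∑' n, Φ (N n ω) (X n ω) ∂P = ∫⁻ ω, ∑' n, ∫⁻ v, Φ v (X n ω) ∂Q ∂P := by
  have : IsProbabilityMeasure Q := hQ 0 ▸ Measure.isProbabilityMeasure_map (hN 0).aemeasurable
  rw [lintegral_tsum (f := fun n ω => Φ (N n ω) (X n ω)) fun n =>
      (hΦ.comp ((hN n).prodMk (hX n))).aemeasurable,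
    lintegral_tsum (f := fun n ω => ∫⁻ v, Φ v (X n ω) ∂Q) fun n =>
      ((Measurable.lintegral_prod_left hΦ).comp (hX n)).aemeasurable]
  refine tsum_congr fun n => ?_
  have hind : IndepFun (X n) (N n) P :=
    hXN.comp (φ := fun x : ℕ → S => x n) (ψ := fun x : ℕ → T => x n) (by fun_prop) (by fun_prop)
  rw [lintegral_of_indepFun (hX n) (hN n) hind (F := fun C v => Φ v C) (hΦ.comp measurable_swap),
    hQ n]

lemma lintegral_sq_of_indep (hX : ∀ n, Measurable (X n)) (hN : ∀ n, Measurable (N n))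
    (hQ : ∀ n, P.map (N n) = Q) (hXN : IndepFun (fun ω n => X n ω) (fun ω n => N n ω) P)
    (hΦ : Measurable (Function.uncurry Φ)) (i : ℕ) :
    ∫⁻ ω, Φ (N i ω) (X i ω) * Φ (N i ω) (X i ω) ∂P = ∫⁻ ω, ∫⁻ v, Φ v (X i ω) ^ 2 ∂Q ∂P := by
  have hind : IndepFun (X i) (N i) P :=
    hXN.comp (φ := fun x : ℕ → S => x i) (ψ := fun x : ℕ → T => x i) (by fun_prop) (by fun_prop)
  simp only [← sq]
  rw [lintegral_of_indepFun (hX i) (hN i) hind (F := fun C v => Φ v C ^ 2)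
    ((hΦ.comp measurable_swap).pow_const 2), hQ i]

lemma lintegral_mul_of_indep [IsProbabilityMeasure Q] (hX : ∀ n, Measurable (X n))
    (hN : ∀ n, Measurable (N n))
    (hQ : ∀ n, P.map (N n) = Q) (hXN : IndepFun (fun ω n => X n ω) (fun ω n => N n ω) P)
    (hNN : iIndepFun N P) (hΦ : Measurable (Function.uncurry Φ)) {i j : ℕ} (hij : i ≠ j) :
    ∫⁻ ω, Φ (N i ω) (X i ω) * Φ (N j ω) (X j ω) ∂P =
      ∫⁻ ω, (∫⁻ v, Φ v (X i ω) ∂Q) * (∫⁻ v, Φ v (X j ω) ∂Q) ∂P := by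
  have hind : IndepFun (fun ω => (X i ω, X j ω)) (fun ω => (N i ω, N j ω)) P :=
    hXN.comp (φ := fun x : ℕ → S => (x i, x j)) (ψ := fun x : ℕ → T => (x i, x j))
      (by fun_prop) (by fun_prop)
  have hlaw : P.map (fun ω => (N i ω, N j ω)) = Q.prod Q := by
    rw [(indepFun_iff_map_prod_eq_prod_map_map (hN i).aemeasurable (hN j).aemeasurable).1
      (hNN.indepFun hij), hQ, hQ]
  have h1 : Measurable fun z : (S × S) × (T × T) => Φ z.2.1 z.1.1 :=
    hΦ.comp ((measurable_fst.comp measurable_snd).prodMk (measurable_fst.comp measurable_fst))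
  have h2 : Measurable fun z : (S × S) × (T × T) => Φ z.2.2 z.1.2 :=
    hΦ.comp ((measurable_snd.comp measurable_snd).prodMk (measurable_snd.comp measurable_fst))
  rw [lintegral_of_indepFun ((hX i).prodMk (hX j)) ((hN i).prodMk (hN j)) hind
    (F := fun c v => Φ v.1 c.1 * Φ v.2 c.2) (h1.mul h2), hlaw]
  refine lintegral_congr fun ω => ?_
  exact lintegral_prod_mul (f := fun v => Φ v (X i ω)) (g := fun v => Φ v (X j ω))
    (hΦ.comp (measurable_id.prodMk measurable_const)).aemeasurable
    (hΦ.comp (measurable_id.prodMk measurable_const)).aemeasurable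

lemma tsum_tsum_add_diag {a b : ℕ → ℕ → ℝ≥0∞} (h : ∀ i j, i ≠ j → a i j = b i j) :
    ∑' i, ∑' j, a i j + ∑' i, b i i = ∑' i, ∑' j, b i j + ∑' i, a i i := by
  rw [← ENNReal.tsum_add, ← ENNReal.tsum_add]
  refine tsum_congr fun i => ?_
  have hsplit : ∀ f : ℕ → ℝ≥0∞, ∑' j, f j = f i + ∑' j, if j = i then 0 else f j :=
    fun f => ENNReal.summable.tsum_eq_add_tsum_ite' i
  have hrest : ∀ j, (if j = i then 0 else a i j) = if j = i then 0 else b i j := by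
    intro j
    split_ifs with hj
    · rfl
    · exact h i j (Ne.symm hj)
  rw [hsplit (a i), hsplit (b i), tsum_congr hrest]
  ring

/-- If the summands of `∑ₙ Φ(Nₙ, Xₙ)` are independent and, up to `Xₙ`, identically distributed given
`X`, its second moment exceeds that of the conditional expectation by the sum of the conditional
variances. The identity is stated without subtraction. -/
theorem lintegral_sq_condIndep_tsum (hX : ∀ n, Measurable (X n)) (hN : ∀ n, Measurable (N n))
    (hQ : ∀ n, P.map (N n) = Q) (hXN : IndepFun (fun ω n => X n ω) (fun ω n => N n ω) P)
    (hNN : iIndepFun N P) (hΦ : Measurable (Function.uncurry Φ)) :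
    ∫⁻ ω, (∑' n, Φ (N n ω) (X n ω)) ^ 2 ∂P + ∫⁻ ω, ∑' n, (∫⁻ v, Φ v (X n ω) ∂Q) ^ 2 ∂P =
      ∫⁻ ω, (∑' n, ∫⁻ v, Φ v (X n ω) ∂Q) ^ 2 ∂P + ∫⁻ ω, ∑' n, ∫⁻ v, Φ v (X n ω) ^ 2 ∂Q ∂P := by
  have : IsProbabilityMeasure Q := hQ 0 ▸ Measure.isProbabilityMeasure_map (hN 0).aemeasurable
  have hsm : Measurable fun C => ∫⁻ v, Φ v C ^ 2 ∂Q := Measurable.lintegral_prod_left (hΦ.pow_const 2)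
  have hΦn : ∀ n, Measurable fun ω => Φ (N n ω) (X n ω) := fun n => hΦ.comp ((hN n).prodMk (hX n))
  have hmX : ∀ n, Measurable fun ω => ∫⁻ v, Φ v (X n ω) ∂Q := fun n =>
    (Measurable.lintegral_prod_left hΦ).comp (hX n)
  have h1 := lintegral_tsum (μ := P) (f := fun n ω => (∫⁻ v, Φ v (X n ω) ∂Q) ^ 2)
    fun n => ((hmX n).pow_const 2).aemeasurable
  have h2 := lintegral_tsum (μ := P) (f := fun n ω => ∫⁻ v, Φ v (X n ω) ^ 2 ∂Q)
    fun n => (hsm.comp (hX n)).aemeasurable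
  have h3 := tsum_tsum_add_diag fun i j (hij : i ≠ j) =>
    lintegral_mul_of_indep hX hN hQ hXN hNN hΦ hij
  rw [ennreal_tsum_sq_lintegral hΦn, ennreal_tsum_sq_lintegral hmX, h1, h2]
  simp only [← sq] at h3 ⊢
  rw [h3]
  simp only [sq, lintegral_sq_of_indep hX hN hQ hXN hΦ]

end secondMoment

/-! ### Moments of the trace of a component tessellation on the faces of a cell -/

section traceMoment

variable {Ω : Type*} [MeasurableSpace Ω] {P : Measure Ω} {d k : ℕ} {X₀ : ℕ → Ω → Body d}

/-- The `p`-th moment of `ν_{k-1}(X₀^(d-1) ∩ C^(k) ∩ W)`, for a fixed polytope `C`. -/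
noncomputable def traceMoment (p k : ℕ) (X₀ : ℕ → Ω → Body d) (P : Measure Ω) (C : Body d)
    (W : Set (E d)) : ℝ≥0∞ :=
  ∫⁻ ω, traceVolume k X₀ (faceUnion k C ∩ W) ω ^ p ∂P

lemma exists_measurable_traceMoment [SFinite P] (hT : IsRandomTessellation X₀ P) (hd : 1 ≤ d)
    (hk : k ≤ d) (p : ℕ) : ∃ s : Body d × Body d → ℝ≥0∞, Measurable s ∧ ∀ C W, IsPolytopal C →
      s (C, W) = traceMoment p k X₀ P C W := by
  obtain ⟨Φ, hΦ, h⟩ := exists_measurable_facetUnion_faceUnion hd (k - 1) hk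
  have hpp := measurable_pointProcess hT.measurable
  have hm : Measurable fun z : (Body d × Body d) × Ω =>
      Φ (pointProcess fun n => X₀ n z.2, z.1.1, z.1.2) ^ p :=
    (hΦ.comp ((hpp.comp measurable_snd).prodMk measurable_fst)).pow_const p
  refine ⟨fun z => ∫⁻ ω, Φ (pointProcess fun n => X₀ n ω, z.1, z.2) ^ p ∂P,
    hm.lintegral_prod_right', fun C W hC => ?_⟩
  refine lintegral_congr_ae ?_
  filter_upwards [hT.isTessellation] with ω hω
  simp only [h _ C W hω hC, traceVolume]

lemma traceMoment_one (hT : IsRandomTessellation X₀ P) (hX₀ : IsMotionInvariant X₀ P) (hk : k < d)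
    (hfin : traceIntensity k X₀ P < ∞) {C : Body d} (hC : IsPolytopal C) (W : Body d) :
    traceMoment 1 k X₀ P C W = traceIntensity k X₀ P * μHE[k] (faceUnion k C ∩ W) := by
  simp only [traceMoment, pow_one, traceVolume]
  exact lintegral_facetUnion_faceUnion hT hX₀ hk hfin hC W

lemma traceMoment_of_subset (p : ℕ) {C : Body d} {W : Set (E d)} (h : (C : Set (E d)) ⊆ W) :
    traceMoment p k X₀ P C W = traceMoment p k X₀ P C C := by
  simp only [traceMoment]
  rw [Set.inter_eq_left.2 ((faceUnion_subset k C).trans h),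
    Set.inter_eq_left.2 (faceUnion_subset k C)]

lemma faceUnion_translate {C : Body d} (hC : IsPolytopal C) (hk : k ≤ d) (x : E d) :
    faceUnion k (translate x C) = (fun y => x + y) '' faceUnion k C := by
  rw [(hC.translate x).faceUnion_eq_skeleton hk, skeleton_translate, hC.faceUnion_eq_skeleton hk]

lemma faceUnion_translate_inter {C : Body d} (hC : IsPolytopal C) (hk : k ≤ d)
    (x : E d) (W : Body d) : faceUnion k (translate x C) ∩ W =
      (fun y => x + y) '' (faceUnion k C ∩ translate (-x) W) := by
  rw [faceUnion_translate hC hk, Set.image_inter (add_right_injective x)]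
  congr 1
  have : translate x (translate (-x) W) = W := by
    rw [translate_translate, add_neg_cancel, translate_zero]
  conv_lhs => rw [← this]
  rfl

lemma traceMoment_translate (hT : IsRandomTessellation X₀ P) (hX₀ : IsMotionInvariant X₀ P)
    (hd : 1 ≤ d) (hk : k ≤ d) (p : ℕ) {C : Body d} (hC : IsPolytopal C) (W : Body d) (x : E d) :
    traceMoment p k X₀ P (translate x C) W = traceMoment p k X₀ P C (translate (-x) W) := by
  simp only [traceMoment, traceVolume, faceUnion_translate_inter hC hk]
  exact lintegral_facetUnion_motion hT hX₀ hd (f := fun t => t ^ p) (by fun_prop)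
    (isProperMotion_constVAdd x) ((hC.isCompact_faceUnion k).inter (translate (-x) W).isCompact)

end traceMoment

/-! ### Moments of the nesting functional -/

section nesting

variable {Ω : Type*} [MeasurableSpace Ω] {P : Measure Ω} [IsProbabilityMeasure P] {d k m : ℕ}
  {X X₀ : ℕ → Ω → Body d} {Y : ℕ → ℕ → Ω → Body d}

/-- Conditionally on the initial tessellation, `Z_k(W)` is a sum of independent variables with
moments `traceMoment`. The identity of second moments is written without subtraction, so that it
holds without any finiteness assumption. -/
theorem IsNesting.lintegral_Z (hnest : IsNesting X X₀ Y P) (hd : 1 ≤ d) (hk : k ≤ d) (W : Body d) :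
    AEMeasurable (Z k X Y W) P ∧
    ∫⁻ ω, Z k X Y W ω ∂P = ∫⁻ ω, ∑' n, traceMoment 1 k X₀ P (X n ω) W ∂P ∧
    ∫⁻ ω, Z k X Y W ω ^ 2 ∂P + ∫⁻ ω, ∑' n, traceMoment 1 k X₀ P (X n ω) W ^ 2 ∂P =
      ∫⁻ ω, (∑' n, traceMoment 1 k X₀ P (X n ω) W) ^ 2 ∂P +
        ∫⁻ ω, ∑' n, traceMoment 2 k X₀ P (X n ω) W ∂P := by
  obtain ⟨Φ, hΦ, h⟩ := exists_measurable_facetUnion_faceUnion hd (k - 1) hk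
  have hN : ∀ n, Measurable fun ω => pointProcess fun l => Y n l ω :=
    fun n => measurable_pointProcess (hnest.component n).measurable
  have hX := hnest.initial.measurable
  have hΨ : Measurable (Function.uncurry fun v C => Φ (v, C, W)) :=
    hΦ.comp (measurable_fst.prodMk (measurable_snd.prodMk measurable_const))
  have hpp := measurable_pointProcess hnest.generic.measurable
  have hmom : ∀ (p : ℕ) (C : Body d), IsPolytopal C →
      ∫⁻ v, Φ (v, C, W) ^ p ∂(P.map fun ω => pointProcess fun l => X₀ l ω) =
        traceMoment p k X₀ P C W := by
    intro p C hC
    have hp : Measurable fun v => Φ (v, C, W) ^ p :=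
      (hΨ.comp (measurable_id.prodMk measurable_const)).pow_const p
    rw [lintegral_map hp hpp]
    refine lintegral_congr_ae ?_
    filter_upwards [hnest.generic.isTessellation] with ω hω
    simp only [h _ C W hω hC, traceVolume]
  have hmom1 : ∀ C : Body d, IsPolytopal C →
      ∫⁻ v, Φ (v, C, W) ∂(P.map fun ω => pointProcess fun l => X₀ l ω) =
        traceMoment 1 k X₀ P C W := by
    intro C hC
    rw [← hmom 1 C hC]
    simp only [pow_one]
  have hpoly : ∀ᵐ ω ∂P, ∀ n, IsPolytopal (X n ω) :=
    hnest.initial.isTessellation.mono fun ω hω n => hω.isPolytopal n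
  have hZ : Z k X Y W =ᵐ[P] fun ω => ∑' n, Φ (pointProcess fun l => Y n l ω, X n ω, W) := by
    filter_upwards [hpoly, ae_all_iff.2 fun n => (hnest.component n).isTessellation] with ω h1 h2
    exact tsum_congr fun n => (h _ (X n ω) W (h2 n) (h1 n)).symm
  have hQ : ∀ n, P.map (fun ω => pointProcess fun l => Y n l ω) =
      P.map fun ω => pointProcess fun l => X₀ l ω := fun n => (hnest.copies n).map_eq
  have e1 := lintegral_condIndep_tsum hX hN hQ hnest.indep_initial hΨ
  have e2 := lintegral_sq_condIndep_tsum hX hN hQ hnest.indep_initial hnest.indep_components hΨ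
  have c1 : ∀ f : ℝ≥0∞ → ℝ≥0∞, ∫⁻ ω, f (Z k X Y W ω) ∂P =
      ∫⁻ ω, f (∑' n, Φ (pointProcess fun l => Y n l ω, X n ω, W)) ∂P := fun f =>
    lintegral_congr_ae (hZ.mono fun ω hω => by simp only [hω])
  refine ⟨⟨_, Measurable.tsum fun n => hΦ.comp ((hN n).prodMk ((hX n).prodMk measurable_const)), hZ⟩,
    ?_, ?_⟩
  · rw [c1 fun t => t, e1]
    refine lintegral_congr_ae (hpoly.mono fun ω hω => ?_)
    exact tsum_congr fun n => hmom1 _ (hω n)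
  · rw [c1 fun t => t ^ 2]
    have c2 : ∫⁻ ω, ∑' n, traceMoment 1 k X₀ P (X n ω) W ^ 2 ∂P = ∫⁻ ω, ∑' n,
        (∫⁻ v, Φ (v, X n ω, W) ∂(P.map fun ω => pointProcess fun l => X₀ l ω)) ^ 2 ∂P := by
      refine lintegral_congr_ae (hpoly.mono fun ω hω => ?_)
      exact tsum_congr fun n => by rw [hmom1 _ (hω n)]
    have c3 : ∫⁻ ω, (∑' n, traceMoment 1 k X₀ P (X n ω) W) ^ 2 ∂P = ∫⁻ ω, (∑' n,
        ∫⁻ v, Φ (v, X n ω, W) ∂(P.map fun ω => pointProcess fun l => X₀ l ω)) ^ 2 ∂P := by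
      refine lintegral_congr_ae (hpoly.mono fun ω hω => ?_)
      exact congrArg (· ^ 2) (tsum_congr fun n => (hmom1 _ (hω n)).symm)
    have c4 : ∫⁻ ω, ∑' n, traceMoment 2 k X₀ P (X n ω) W ∂P = ∫⁻ ω, ∑' n,
        ∫⁻ v, Φ (v, X n ω, W) ^ 2 ∂(P.map fun ω => pointProcess fun l => X₀ l ω) ∂P := by
      refine lintegral_congr_ae (hpoly.mono fun ω hω => ?_)
      exact tsum_congr fun n => (hmom 2 _ (hω n)).symm
    rw [c2, c3, c4]
    exact e2

/-- The first two moments of `Z_k(W)`. The sums over the cells are integrals with respect to the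
intensity measure of the cells. -/
theorem IsNesting.moments_Z (hnest : IsNesting X X₀ Y P) (hX₀ : IsMotionInvariant X₀ P)
    (hk : k < d) (hfin : traceIntensity k X₀ P < ∞) (hF : ConditionF k m X P) {W : Body d}
    (hW : 0 < volume (W : Set (E d))) :
    ∫⁻ ω, Z k X Y W ω ∂P = traceIntensity k X₀ P * m * ∫⁻ ω, facetVolume k X W ω ∂P ∧
    ∫⁻ ω, Z k X Y W ω ^ 2 ∂P +
        ∫⁻ C, traceMoment 1 k X₀ P C W ^ 2 ∂(cellIntensityMeasure X P) =
      (traceIntensity k X₀ P * m) ^ 2 * ∫⁻ ω, facetVolume k X W ω ^ 2 ∂P +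
        ∫⁻ C, traceMoment 2 k X₀ P C W ∂(cellIntensityMeasure X P) := by
  have hd : 1 ≤ d := by omega
  obtain ⟨-, h1, h2⟩ := hnest.lintegral_Z hd hk.le W
  have hX := hnest.initial.measurable
  have hpoly : ∀ᵐ ω ∂P, ∀ n, IsPolytopal (X n ω) :=
    hnest.initial.isTessellation.mono fun ω hω n => hω.isPolytopal n
  have hpolyΛ : ∀ᵐ C ∂(cellIntensityMeasure X P), IsPolytopal C :=
    ae_cellIntensityMeasure hX measurableSet_isPolytopal fun n => hpoly.mono fun ω hω => hω n
  have hlt : traceIntensity k X₀ P * m ≠ ∞ := ENNReal.mul_ne_top hfin.ne (ENNReal.natCast_ne_top m)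
  have hsum : ∀ᵐ ω ∂P, ∑' n, traceMoment 1 k X₀ P (X n ω) W =
      traceIntensity k X₀ P * m * facetVolume k X W ω := by
    filter_upwards [hpoly, hF.2 W hW] with ω hω hFω
    rw [mul_assoc, hFω, ← ENNReal.tsum_mul_left]
    exact tsum_congr fun n => traceMoment_one hnest.generic hX₀ hk hfin (hω n) W
  have hΛ : ∀ (p q : ℕ), ∫⁻ ω, ∑' n, traceMoment p k X₀ P (X n ω) W ^ q ∂P =
      ∫⁻ C, traceMoment p k X₀ P C W ^ q ∂(cellIntensityMeasure X P) := by
    intro p q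
    obtain ⟨s, hs, hsC⟩ := exists_measurable_traceMoment hnest.generic hd hk.le p
    have hm : Measurable fun C => s (C, W) ^ q :=
      (hs.comp (measurable_id.prodMk measurable_const)).pow_const q
    calc _ = ∫⁻ ω, ∑' n, s (X n ω, W) ^ q ∂P := by
          refine lintegral_congr_ae (hpoly.mono fun ω hω => ?_)
          exact tsum_congr fun n => by rw [hsC _ W (hω n)]
      _ = ∫⁻ C, s (C, W) ^ q ∂(cellIntensityMeasure X P) :=
          (lintegral_cellIntensityMeasure hX hm).symm
      _ = _ := lintegral_congr_ae (hpolyΛ.mono fun C hC => by simp only [hsC C W hC])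
  constructor
  · rw [h1, lintegral_congr_ae hsum, lintegral_const_mul' _ _ hlt]
  · have e := hΛ 2 1
    simp only [pow_one] at e
    rw [← hΛ 1 2, ← e, h2]
    congr 1
    rw [lintegral_congr_ae (hsum.mono fun ω hω => congrArg (· ^ 2) hω)]
    simp only [mul_pow]
    rw [lintegral_const_mul']
    rw [← mul_pow]
    exact ENNReal.pow_ne_top hlt

end nesting

/-! ### Second moments of the facet volume -/

section facetVolume

variable {Ω : Type*} [MeasurableSpace Ω] {P : Measure Ω} {d k m : ℕ} {X : ℕ → Ω → Body d}

/-- Condition F expresses the facet volume, up to the factor `m`, as a sum over the cells. This is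
what makes it measurable, and its law invariant under translations. -/
lemma ConditionF.aemeasurable_facetVolume (hF : ConditionF k m X P) (hX : IsRandomTessellation X P)
    (hk : k ≤ d) {W : Body d} (hW : 0 < volume (W : Set (E d))) :
    AEMeasurable (facetVolume k X W) P := by
  obtain ⟨Φ, hΦ, h⟩ := exists_measurable_faceUnion (d := d) k hk
  have hm : Measurable fun ω => ∑' n, Φ (X n ω, W) :=
    Measurable.tsum fun n => hΦ.comp ((hX.measurable n).prodMk measurable_const)
  refine ⟨fun ω => (m : ℝ≥0∞)⁻¹ * ∑' n, Φ (X n ω, W), hm.const_mul _, ?_⟩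
  filter_upwards [hX.isTessellation, hF.2 W hW] with ω hω hFω
  have h0 : (m : ℝ≥0∞) ≠ 0 := by exact_mod_cast (Nat.one_le_iff_ne_zero.1 hF.1)
  rw [tsum_congr fun n => h (X n ω) W (hω.isPolytopal n), ← hFω, ← mul_assoc,
    ENNReal.inv_mul_cancel h0 (ENNReal.natCast_ne_top m), one_mul]

lemma ConditionF.lintegral_facetVolume_translate (hF : ConditionF k m X P)
    (hX : IsRandomTessellation X P) (hstat : IsStationary X P) (hk : k ≤ d) {W : Body d}
    (hW : 0 < volume (W : Set (E d))) (x : E d) :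
    ∫⁻ ω, facetVolume k X (translate x W) ω ^ 2 ∂P = ∫⁻ ω, facetVolume k X W ω ^ 2 ∂P := by
  obtain ⟨Φ, hΦ, h⟩ := exists_measurable_faceUnion (d := d) k hk
  have hφ : Measurable fun C => Φ (C, W) := hΦ.comp (measurable_id.prodMk measurable_const)
  have h0 : (m : ℝ≥0∞) ≠ 0 := by exact_mod_cast (Nat.one_le_iff_ne_zero.1 hF.1)
  have h0' : (m : ℝ≥0∞) ≠ ∞ := ENNReal.natCast_ne_top m
  have hxW : 0 < volume (translate x W : Set (E d)) := by
    rw [coe_translate, Set.image_add_left]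
    rwa [measure_preimage_add]
  have e1 : ∫⁻ ω, (m * facetVolume k X W ω) ^ 2 ∂P =
      ∫⁻ ω, (∫⁻ C, Φ (C, W) ∂(pointProcess fun n => X n ω)) ^ 2 ∂P := by
    refine lintegral_congr_ae ?_
    filter_upwards [hX.isTessellation, hF.2 W hW] with ω hω hFω
    rw [lintegral_pointProcess _ hφ, hFω, tsum_congr fun n => h (X n ω) W (hω.isPolytopal n)]
  have e2 : ∫⁻ ω, (m * facetVolume k X (translate x W) ω) ^ 2 ∂P =
      ∫⁻ ω, (∫⁻ C, Φ (C, W) ∂(pointProcess fun n => translate (-x) (X n ω))) ^ 2 ∂P := by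
    refine lintegral_congr_ae ?_
    filter_upwards [hX.isTessellation, hF.2 _ hxW] with ω hω hFω
    rw [lintegral_pointProcess _ hφ, hFω]
    congr 1
    refine tsum_congr fun n => ?_
    have hp := hω.isPolytopal n
    rw [h _ W (hp.translate (-x)), faceUnion_translate_inter hp hk,
      (isometry_add_left (-x)).euclideanHausdorffMeasure_image, neg_neg]
  have e3 : ∫⁻ ω, (∫⁻ C, Φ (C, W) ∂(pointProcess fun n => translate (-x) (X n ω))) ^ 2 ∂P =
      ∫⁻ ω, (∫⁻ C, Φ (C, W) ∂(pointProcess fun n => X n ω)) ^ 2 ∂P :=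
    ((hstat (-x)).comp ((Measure.measurable_lintegral hφ).pow_const 2)).lintegral_eq
  have e := e2.trans (e3.trans e1.symm)
  simp only [mul_pow] at e
  rw [lintegral_const_mul' _ _ (ENNReal.pow_ne_top h0'),
    lintegral_const_mul' _ _ (ENNReal.pow_ne_top h0')] at e
  exact (ENNReal.mul_right_inj (pow_ne_zero 2 h0) (ENNReal.pow_ne_top h0')).1 e

lemma ennreal_add_sq_le (a b : ℝ≥0∞) : (a + b) ^ 2 ≤ 4 * (a ^ 2 + b ^ 2) := by
  have h1 : a + b ≤ 2 * max a b := by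
    rw [two_mul]
    exact add_le_add (le_max_left _ _) (le_max_right _ _)
  calc (a + b) ^ 2 ≤ (2 * max a b) ^ 2 := by gcongr
    _ = 4 * (max a b) ^ 2 := by rw [mul_pow]; norm_num
    _ ≤ 4 * (a ^ 2 + b ^ 2) := by
        gcongr
        rcases le_total a b with h | h
        · rw [max_eq_right h]
          exact le_add_self
        · rw [max_eq_left h]
          exact le_self_add

/-- `[0,1]^d` as a convex body. -/
def cubeBody (d : ℕ) : Body d where
  carrier := closedCube d
  convex' := by
    have : closedCube d = ⋂ i : Fin d, (fun x : E d => x i) ⁻¹' Set.Icc 0 1 := by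
      ext x
      simp [closedCube]
    rw [this]
    exact convex_iInter fun i => (convex_Icc 0 1).linear_preimage
      ((EuclideanSpace.proj i : E d →L[ℝ] ℝ) : E d →ₗ[ℝ] ℝ)
  isCompact' := by
    have : closedCube d = (EuclideanSpace.equiv (Fin d) ℝ) ⁻¹'
        (Set.univ.pi fun _ => Set.Icc (0 : ℝ) 1) := by
      ext x
      simp only [closedCube, Set.mem_preimage, Set.mem_univ_pi]
      rfl
    rw [this, ← (EuclideanSpace.equiv (Fin d) ℝ).image_symm_eq_preimage]
    exact (isCompact_univ_pi fun _ => isCompact_Icc).image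
      (EuclideanSpace.equiv (Fin d) ℝ).symm.continuous
  nonempty' := ⟨0, fun i => by simp⟩

lemma volume_cubeBody_pos (d : ℕ) : 0 < volume (cubeBody d : Set (E d)) := by
  have : cube d ⊆ closedCube d := fun x hx i => Set.Ico_subset_Icc_self (hx i)
  calc (0 : ℝ≥0∞) < 1 := one_pos
    _ = volume (cube d) := volume_cube.symm
    _ ≤ _ := measure_mono this

lemma translate_cubeBody_mem_nhds (x : E d) :
    (translate (x - WithLp.toLp 2 fun _ => 1 / 2) (cubeBody d) : Set (E d)) ∈ 𝓝 x := by
  have hU : IsOpen {y : E d | ∀ i, x i - 1 / 2 < y i ∧ y i < x i + 1 / 2} := by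
    simp only [Set.ofPred_forall]
    refine isOpen_iInter_of_finite fun i => ?_
    have hi : Continuous fun y : E d => y i := by fun_prop
    exact (isOpen_lt continuous_const hi).inter (isOpen_lt hi continuous_const)
  refine mem_of_superset (hU.mem_nhds fun i => ⟨by linarith, by linarith⟩) fun y hy => ?_
  rw [SetLike.mem_coe, mem_translate]
  intro i
  have := hy i
  simp only [PiLp.sub_apply, Set.mem_Icc]
  constructor <;> linarith

/-- The second moment of the facet volume is finite in every bounded window: cover the window by
finitely many translates of the unit cube. -/
lemma ConditionF.lintegral_facetVolume_sq_lt_top (hF : ConditionF k m X P)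
    (hX : IsRandomTessellation X P) (hstat : IsStationary X P) (hk : k ≤ d)
    (hX2 : ∫⁻ ω, facetVolume k X (closedCube d) ω ^ 2 ∂P < ∞) {W : Set (E d)} (hW : IsCompact W) :
    ∫⁻ ω, facetVolume k X W ω ^ 2 ∂P < ∞ := by
  have hmono : ∀ {A B : Set (E d)}, A ⊆ B → ∀ ω, facetVolume k X A ω ≤ facetVolume k X B ω :=
    fun h ω => measure_mono (Set.inter_subset_inter_right _ h)
  suffices h : ∃ G : Ω → ℝ≥0∞, AEMeasurable G P ∧ (∀ ω, facetVolume k X W ω ≤ G ω) ∧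
      ∫⁻ ω, G ω ^ 2 ∂P < ∞ by
    obtain ⟨G, -, hle, hG⟩ := h
    exact lt_of_le_of_lt (lintegral_mono fun ω => pow_le_pow_left₀ zero_le (hle ω) 2) hG
  refine hW.induction_on (p := fun B => ∃ G : Ω → ℝ≥0∞, AEMeasurable G P ∧
      (∀ ω, facetVolume k X B ω ≤ G ω) ∧ ∫⁻ ω, G ω ^ 2 ∂P < ∞) ?_ ?_ ?_ ?_
  · exact ⟨0, aemeasurable_const, fun ω => by simp [facetVolume], by simp⟩
  · rintro A B hAB ⟨G, hG, hle, hfin⟩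
    exact ⟨G, hG, fun ω => (hmono hAB ω).trans (hle ω), hfin⟩
  · rintro A B ⟨G, hG, hle, hfin⟩ ⟨G', hG', hle', hfin'⟩
    refine ⟨fun ω => G ω + G' ω, hG.add hG', fun ω => ?_, ?_⟩
    · rw [facetVolume, Set.inter_union_distrib_left]
      exact (measure_union_le _ _).trans (add_le_add (hle ω) (hle' ω))
    · calc ∫⁻ ω, (G ω + G' ω) ^ 2 ∂P ≤ ∫⁻ ω, 4 * (G ω ^ 2 + G' ω ^ 2) ∂P :=
            lintegral_mono fun ω => ennreal_add_sq_le _ _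
        _ = 4 * (∫⁻ ω, G ω ^ 2 ∂P + ∫⁻ ω, G' ω ^ 2 ∂P) := by
            rw [lintegral_const_mul' _ _ (by norm_num), lintegral_add_left' (hG.pow_const 2)]
        _ < ∞ := ENNReal.mul_lt_top (by norm_num) (ENNReal.add_lt_top.2 ⟨hfin, hfin'⟩)
  · intro x _
    refine ⟨_, mem_nhdsWithin_of_mem_nhds (translate_cubeBody_mem_nhds x), _, ?_,
      fun ω => le_rfl, ?_⟩
    · refine hF.aemeasurable_facetVolume hX hk ?_
      rw [coe_translate, Set.image_add_left, measure_preimage_add]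
      exact volume_cubeBody_pos d
    · rw [hF.lintegral_facetVolume_translate hX hstat hk (volume_cubeBody_pos d)]
      exact hX2

end facetVolume

/-! ### Averages over growing windows -/

section windows

variable {d : ℕ} {W₁ : Body d} {r : ℝ}

lemma volume_smul_pos (hr : 0 < r) (hW : Metric.closedBall (0 : E d) r ⊆ W₁) {ρ : ℝ} (hρ : 0 < ρ) :
    0 < volume ((ρ • W₁ : Body d) : Set (E d)) := by
  rw [ConvexBody.coe_smul, Measure.addHaar_smul]
  refine ENNReal.mul_pos ?_ ?_
  · exact (ENNReal.ofReal_pos.2 (by positivity)).ne'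
  · exact ((Metric.measure_closedBall_pos volume (0 : E d) hr).trans_le (measure_mono hW)).ne'

lemma translate_subset_smul (hW : Metric.closedBall (0 : E d) r ⊆ W₁) {ρ t R : ℝ} (hρ : 0 < ρ)
    (ht : 0 < t) (ht1 : t ≤ 1) (hR : R ≤ t * ρ * r) {C : Body d}
    (hC : (C : Set (E d)) ⊆ Metric.closedBall 0 R) {x : E d}
    (hx : x ∈ (1 - t) • ((ρ • W₁ : Body d) : Set (E d))) :
    (translate x C : Set (E d)) ⊆ (ρ • W₁ : Body d) := by
  rw [ConvexBody.coe_smul] at hx ⊢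
  rintro _ ⟨y, hy, rfl⟩
  obtain ⟨_, ⟨w, hw, rfl⟩, rfl⟩ := hx
  have hy' : ((t * ρ)⁻¹ • y) ∈ (W₁ : Set (E d)) := by
    apply hW
    rw [mem_closedBall_zero_iff, norm_smul, norm_inv, Real.norm_of_nonneg (by positivity),
      inv_mul_le_iff₀ (by positivity)]
    exact (mem_closedBall_zero_iff.1 (hC hy)).trans hR
  refine ⟨(1 - t) • w + t • ((t * ρ)⁻¹ • y), W₁.convex hw hy' (by linarith) ht.le (by ring), ?_⟩
  change ρ • ((1 - t) • w + t • ((t * ρ)⁻¹ • y)) = (1 - t) • ρ • w + y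
  rw [smul_add, smul_smul, smul_smul, smul_smul, smul_smul, mul_comm ρ (1 - t)]
  congr 1
  have : ρ * t * (t * ρ)⁻¹ = 1 := by field_simp
  rw [this, one_smul]

/-- Edge effects are negligible: if `h ρ x` attains its typical value `H` as soon as `C + x` lies in
the window `ρ • W₁`, and is `H` on average at most, then its averages tend to `H`. -/
lemma tendsto_average (hr : 0 < r) (hW : Metric.closedBall (0 : E d) r ⊆ W₁) {C : Body d}
    {h : ℝ → E d → ℝ≥0∞} {H : ℝ≥0∞}
    (hle : ∀ ρ : ℝ, 0 < ρ → ∫⁻ x, h ρ x ≤ volume ((ρ • W₁ : Body d) : Set (E d)) * H)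
    (heq : ∀ ρ : ℝ, 0 < ρ → ∀ x, (translate x C : Set (E d)) ⊆ (ρ • W₁ : Body d) → h ρ x = H) :
    Tendsto (fun ρ => (volume ((ρ • W₁ : Body d) : Set (E d)))⁻¹ * ∫⁻ x, h ρ x) atTop (𝓝 H) := by
  obtain ⟨R₀, hR₀⟩ := C.isCompact.isBounded.subset_closedBall 0
  set R := max R₀ 1
  have hR : (C : Set (E d)) ⊆ Metric.closedBall 0 R :=
    hR₀.trans (Metric.closedBall_subset_closedBall (le_max_left _ _))
  have hR1 : 0 < R := lt_of_lt_of_le one_pos (le_max_right _ _)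
  have hv0 : ∀ ρ : ℝ, 0 < ρ → volume ((ρ • W₁ : Body d) : Set (E d)) ≠ 0 :=
    fun _ hρ => (volume_smul_pos hr hW hρ).ne'
  have hv : ∀ ρ : ℝ, volume ((ρ • W₁ : Body d) : Set (E d)) ≠ ∞ :=
    fun ρ => (ρ • W₁ : Body d).isCompact.measure_lt_top.ne
  have ht : Tendsto (fun ρ : ℝ => R / (ρ * r)) atTop (𝓝 0) :=
    (tendsto_id.atTop_mul_const hr).const_div_atTop R
  -- `C + x` lies in `W := ρ • W₁` for all `x ∈ (1 - t) • W` if `t • W` contains the ball of radius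
  -- `R`, which it does for `t = R / (ρ r)`.
  have hlow : Tendsto (fun ρ : ℝ => ENNReal.ofReal ((1 - R / (ρ * r)) ^ d) * H) atTop (𝓝 H) := by
    have h1 : Tendsto (fun ρ : ℝ => ENNReal.ofReal ((1 - R / (ρ * r)) ^ d)) atTop (𝓝 1) := by
      have := ENNReal.tendsto_ofReal ((ht.const_sub 1).pow d)
      simpa using this
    simpa using ENNReal.Tendsto.mul_const h1 (Or.inl one_ne_zero)
  refine tendsto_of_tendsto_of_tendsto_of_le_of_le' hlow tendsto_const_nhds ?_ ?_
  · filter_upwards [eventually_gt_atTop (0 : ℝ), ht.eventually_le_const one_pos] with ρ hρ hρ1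
    set t := R / (ρ * r)
    have ht0 : 0 < t := by positivity
    rw [← ENNReal.div_eq_inv_mul,
      ENNReal.le_div_iff_mul_le (Or.inl (hv0 ρ hρ)) (Or.inl (hv ρ))]
    calc ENNReal.ofReal ((1 - t) ^ d) * H * volume ((ρ • W₁ : Body d) : Set (E d))
        = H * volume ((1 - t) • ((ρ • W₁ : Body d) : Set (E d))) := by
          rw [Measure.addHaar_smul, finrank_euclideanSpace_fin,
            abs_of_nonneg (pow_nonneg (by linarith) d)]
          ring
      _ = ∫⁻ x in (1 - t) • ((ρ • W₁ : Body d) : Set (E d)), H := by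
          rw [setLIntegral_const]
      _ = ∫⁻ x in (1 - t) • ((ρ • W₁ : Body d) : Set (E d)), h ρ x := by
          refine setLIntegral_congr_fun
            ((ρ • W₁ : Body d).isCompact.smul (1 - t)).measurableSet fun x hx => ?_
          refine (heq ρ hρ x (translate_subset_smul hW hρ ht0 hρ1 (le_of_eq ?_) hR hx)).symm
          simp only [t]
          field_simp
      _ ≤ ∫⁻ x, h ρ x := setLIntegral_le_lintegral _ _
  · filter_upwards [eventually_gt_atTop (0 : ℝ)] with ρ hρ
    calc _ ≤ (volume ((ρ • W₁ : Body d) : Set (E d)))⁻¹ *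
          (volume ((ρ • W₁ : Body d) : Set (E d)) * H) := by
          gcongr
          exact hle ρ hρ
      _ = H := by rw [← mul_assoc, ENNReal.inv_mul_cancel (hv0 ρ hρ) (hv ρ), one_mul]

/-- Bound one factor of the square by the total mass and integrate the other one by Tonelli. -/
lemma lintegral_sq_measure_translate_le (μ : Measure (E d)) [IsFiniteMeasure μ] (W : Body d) :
    ∫⁻ x, μ (translate (-x) W) ^ 2 ≤ volume (W : Set (E d)) * μ Set.univ ^ 2 := by
  have hWm : MeasurableSet (W : Set (E d)) := W.isCompact.measurableSet
  have hind : Measurable fun z : E d × E d => (W : Set (E d)).indicator (1 : E d → ℝ≥0∞)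
      (z.2 + z.1) := (measurable_one.indicator hWm).comp (measurable_snd.add measurable_fst)
  have hμ : ∀ x, μ (translate (-x) W) = ∫⁻ y, (W : Set (E d)).indicator 1 (y + x) ∂μ := by
    intro x
    rw [← lintegral_indicator_one (translate (-x) W).isCompact.measurableSet]
    refine lintegral_congr fun y => ?_
    have : y ∈ (translate (-x) W : Set (E d)) ↔ y + x ∈ (W : Set (E d)) := by
      rw [SetLike.mem_coe, mem_translate, sub_neg_eq_add, SetLike.mem_coe]
    by_cases hy : y + x ∈ (W : Set (E d))
    · rw [Set.indicator_of_mem hy, Set.indicator_of_mem (this.2 hy)]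
      rfl
    · rw [Set.indicator_of_notMem hy, Set.indicator_of_notMem (mt this.1 hy)]
  calc ∫⁻ x, μ (translate (-x) W) ^ 2 ≤ ∫⁻ x, μ Set.univ * μ (translate (-x) W) := by
        refine lintegral_mono fun x => ?_
        rw [sq]
        gcongr
        exact Set.subset_univ _
    _ = μ Set.univ * ∫⁻ x, (∫⁻ y, (W : Set (E d)).indicator 1 (y + x) ∂μ) := by
        rw [lintegral_const_mul' _ _ (measure_ne_top μ _)]
        simp only [hμ]
    _ = μ Set.univ * ∫⁻ y, (∫⁻ x : E d, (W : Set (E d)).indicator 1 (y + x)) ∂μ := by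
        rw [lintegral_lintegral_swap]
        exact hind.aemeasurable
    _ = volume (W : Set (E d)) * μ Set.univ ^ 2 := by
        have : ∀ y, ∫⁻ x : E d, (W : Set (E d)).indicator 1 (y + x) = volume (W : Set (E d)) := by
          intro y
          rw [lintegral_add_left_eq_self (fun x => (W : Set (E d)).indicator (1 : E d → ℝ≥0∞) x) y,
            lintegral_indicator_one hWm]
        simp only [this, lintegral_const]
        ring

end windows

section averages

variable {Ω : Type*} [MeasurableSpace Ω] {P : Measure Ω} [IsProbabilityMeasure P] {d k m : ℕ}
  {X X₀ : ℕ → Ω → Body d} {α : Body d → E d}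

lemma lintegral_traceMoment_two_translate_le (hT : IsRandomTessellation X₀ P)
    (hX₀ : IsMotionInvariant X₀ P) (hd : 1 ≤ d) (hk : k ≤ d) {C : Body d} (hC : IsPolytopal C)
    (hfin : traceMoment 2 k X₀ P C C < ∞) (W : Body d) :
    ∫⁻ x, traceMoment 2 k X₀ P (translate x C) W ≤
      volume (W : Set (E d)) * traceMoment 2 k X₀ P C C := by
  obtain ⟨Φ, hΦ, h⟩ := exists_measurable_facetUnion_faceUnion hd (k - 1) hk
  have hpp := measurable_pointProcess hT.measurable
  have hF : Measurable fun z : E d × Ω =>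
      Φ (pointProcess fun n => X₀ n z.2, C, translate (-z.1) W) ^ 2 :=
    (hΦ.comp ((hpp.comp measurable_snd).prodMk (measurable_const.prodMk
      (measurable_translate.comp (measurable_fst.neg.prodMk measurable_const))))).pow_const 2
  have hCC : ∀ ω, traceVolume k X₀ (faceUnion k C ∩ C) ω = traceVolume k X₀ (faceUnion k C) ω := by
    intro ω
    rw [Set.inter_eq_left.2 (faceUnion_subset k C)]
  have hfinite : ∀ᵐ ω ∂P, traceVolume k X₀ (faceUnion k C) ω < ∞ := by
    have hm : AEMeasurable (fun ω => traceVolume k X₀ (faceUnion k C) ω ^ 2) P :=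
      (hT.aemeasurable_facetUnion_inter hd (hC.isCompact_faceUnion k)).pow_const 2
    simp only [traceMoment, hCC] at hfin
    filter_upwards [ae_lt_top' hm hfin.ne] with ω hω
    exact (ENNReal.pow_lt_top_iff.1 hω).resolve_right two_ne_zero
  calc ∫⁻ x, traceMoment 2 k X₀ P (translate x C) W
      = ∫⁻ x : E d, ∫⁻ ω, Φ (pointProcess fun n => X₀ n ω, C, translate (-x) W) ^ 2 ∂P := by
        refine lintegral_congr fun x => ?_
        rw [traceMoment_translate hT hX₀ hd hk 2 hC]
        refine lintegral_congr_ae ?_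
        filter_upwards [hT.isTessellation] with ω hω
        simp only [h _ C (translate (-x) W) hω hC, traceVolume]
    _ = ∫⁻ ω, (∫⁻ x : E d, Φ (pointProcess fun n => X₀ n ω, C, translate (-x) W) ^ 2) ∂P :=
        lintegral_lintegral_swap hF.aemeasurable
    _ ≤ ∫⁻ ω, volume (W : Set (E d)) * traceVolume k X₀ (faceUnion k C) ω ^ 2 ∂P := by
        refine lintegral_mono_ae ?_
        filter_upwards [hT.isTessellation, hfinite] with ω hω hlt
        set μ : Measure (E d) :=
          (μHE[k - 1]).restrict (facetUnion (d - 1) (fun n => X₀ n ω) ∩ faceUnion k C)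
        have : IsFiniteMeasure μ := ⟨by rwa [Measure.restrict_apply_univ]⟩
        have e1 : ∀ x : E d, Φ (pointProcess fun n => X₀ n ω, C, translate (-x) W) =
            μ (translate (-x) W) := by
          intro x
          rw [h _ C _ hω hC, Measure.restrict_apply (translate (-x) W).isCompact.measurableSet,
            ← Set.inter_assoc, Set.inter_comm]
        simp only [e1]
        refine (lintegral_sq_measure_translate_le μ W).trans_eq ?_
        rw [Measure.restrict_apply_univ]
        rfl
    _ = volume (W : Set (E d)) * traceMoment 2 k X₀ P C C := by
        rw [lintegral_const_mul' _ _ W.isCompact.measure_lt_top.ne]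
        simp only [traceMoment, hCC]

omit [IsProbabilityMeasure P] in
lemma lintegral_traceMoment_one_sq_translate_le (hT : IsRandomTessellation X₀ P)
    (hX₀ : IsMotionInvariant X₀ P) (hk : k < d) (hl : traceIntensity k X₀ P < ∞) {C : Body d}
    (hC : IsPolytopal C) (hfin : traceMoment 1 k X₀ P C C < ∞) (W : Body d) :
    ∫⁻ x, traceMoment 1 k X₀ P (translate x C) W ^ 2 ≤
      volume (W : Set (E d)) * traceMoment 1 k X₀ P C C ^ 2 := by
  rw [traceMoment_one hT hX₀ hk hl hC, Set.inter_eq_left.2 (faceUnion_subset k C)] at *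
  set μ : Measure (E d) := traceIntensity k X₀ P • (μHE[k]).restrict (faceUnion k C)
  have hμ : ∀ A, MeasurableSet A → μ A = traceIntensity k X₀ P * μHE[k] (faceUnion k C ∩ A) := by
    intro A hA
    rw [Measure.smul_apply, Measure.restrict_apply hA, smul_eq_mul, Set.inter_comm]
  have hμu : μ Set.univ = traceIntensity k X₀ P * μHE[k] (faceUnion k C) := by
    rw [hμ _ MeasurableSet.univ, Set.inter_univ]
  have : IsFiniteMeasure μ := ⟨by rwa [hμu]⟩
  rw [← hμu]
  refine le_of_eq_of_le (lintegral_congr fun x => ?_) (lintegral_sq_measure_translate_le μ W)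
  rw [traceMoment_translate hT hX₀ (by omega) hk.le 1 hC, traceMoment_one hT hX₀ hk hl hC,
    hμ _ (translate (-x) W).isCompact.measurableSet]

/-- The sum over all cells of a moment of the trace in `W` is governed by the typical cell: divided by
the volume of the window, its mean tends to `γ` times the moment on the whole typical cell. The
assumption `hle` provides the dominating function. -/
lemma tendsto_lintegral_traceMoment (hX : IsRandomTessellation X P) (hstat : IsStationary X P)
    (hT : IsRandomTessellation X₀ P) (hX₀ : IsMotionInvariant X₀ P) (hd : 1 ≤ d) (hk : k ≤ d)
    (hα : IsAssociatedPoint α)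
    (hγ0 : cellIntensity α X P ≠ 0) (hγ : cellIntensity α X P ≠ ∞) {p q : ℕ} (hq : q ≠ 0)
    (hle : ∀ C W : Body d, IsPolytopal C → traceMoment p k X₀ P C C < ∞ →
      ∫⁻ x, traceMoment p k X₀ P (translate x C) W ^ q ≤
        volume (W : Set (E d)) * traceMoment p k X₀ P C C ^ q)
    (hfin : ∫⁻ C, traceMoment p k X₀ P C C ^ q ∂(palm α X P) < ∞)
    {W₁ : Body d} {r : ℝ} (hr : 0 < r) (hW : Metric.closedBall (0 : E d) r ⊆ W₁) :
    (∀ W : Body d, ∫⁻ C, traceMoment p k X₀ P C W ^ q ∂(cellIntensityMeasure X P) < ∞) ∧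
    Tendsto (fun ρ : ℝ => (volume ((ρ • W₁ : Body d) : Set (E d)))⁻¹ *
        ∫⁻ C, traceMoment p k X₀ P C (ρ • W₁ : Body d) ^ q ∂(cellIntensityMeasure X P)) atTop
      (𝓝 (cellIntensity α X P * ∫⁻ C, traceMoment p k X₀ P C C ^ q ∂(palm α X P))) := by
  obtain ⟨s, hs, hsC⟩ := exists_measurable_traceMoment hT hd hk p
  have hpalm := hX.ae_palm_isPolytopal hα
  have hpolyΛ : ∀ᵐ C ∂(cellIntensityMeasure X P), IsPolytopal C :=
    ae_cellIntensityMeasure hX.measurable measurableSet_isPolytopal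
      fun n => hX.isTessellation.mono fun ω hω => hω.isPolytopal n
  have hsq : Measurable fun z : Body d × Body d => s z ^ q := hs.pow_const q
  have hprod : ∀ W : Body d, Measurable fun z : E d × Body d => s (translate z.1 z.2, W) ^ q :=
    fun W => hsq.comp (measurable_translate.prodMk measurable_const)
  have hG : ∀ W : Body d, Measurable fun C => ∫⁻ x : E d, s (translate x C, W) ^ q := fun W =>
    Measurable.lintegral_prod_left (f := fun (x : E d) C => s (translate x C, W) ^ q) (hprod W)
  have hcampbell : ∀ W : Body d, ∫⁻ C, traceMoment p k X₀ P C W ^ q ∂(cellIntensityMeasure X P) =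
      cellIntensity α X P * ∫⁻ C, (∫⁻ x : E d, s (translate x C, W) ^ q) ∂(palm α X P) := by
    intro W
    have hm : Measurable fun C => s (C, W) ^ q := hsq.comp (measurable_id.prodMk measurable_const)
    rw [← lintegral_cellIntensityMeasure_eq_palm hX.measurable hstat hα hγ0 hγ hm]
    exact lintegral_congr_ae (hpolyΛ.mono fun C hC => by simp only [hsC C W hC])
  have hGs : ∀ W C : Body d, IsPolytopal C → ∫⁻ x : E d, s (translate x C, W) ^ q =
      ∫⁻ x, traceMoment p k X₀ P (translate x C) W ^ q := fun W C hC =>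
    lintegral_congr fun x => by rw [hsC _ W (hC.translate x)]
  have hae : ∀ᵐ C ∂(palm α X P), traceMoment p k X₀ P C C < ∞ := by
    have hm : AEMeasurable (fun C => traceMoment p k X₀ P C C ^ q) (palm α X P) :=
      ⟨fun C => s (C, C) ^ q, hsq.comp (measurable_id.prodMk measurable_id),
        hpalm.mono fun C hC => by simp only [hsC C C hC]⟩
    filter_upwards [ae_lt_top' hm hfin.ne] with C hC
    exact (ENNReal.pow_lt_top_iff.1 hC).resolve_right hq
  have hbound : ∀ W : Body d, ∀ᵐ C ∂(palm α X P), ∫⁻ x : E d, s (translate x C, W) ^ q ≤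
      volume (W : Set (E d)) * traceMoment p k X₀ P C C ^ q := by
    intro W
    filter_upwards [hpalm, hae] with C hC hlt
    rw [hGs W C hC]
    exact hle C W hC hlt
  constructor
  · intro W
    rw [hcampbell]
    refine ENNReal.mul_lt_top hγ.lt_top ?_
    refine (lintegral_mono_ae (hbound W)).trans_lt ?_
    rw [lintegral_const_mul' _ _ W.isCompact.measure_lt_top.ne]
    exact ENNReal.mul_lt_top W.isCompact.measure_lt_top hfin
  · have hvi : ∀ ρ : ℝ, 0 < ρ → (volume ((ρ • W₁ : Body d) : Set (E d)))⁻¹ ≠ ∞ := fun ρ hρ =>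
      ENNReal.inv_ne_top.2 (volume_smul_pos hr hW hρ).ne'
    have hlim : Tendsto (fun ρ : ℝ => ∫⁻ C, (volume ((ρ • W₁ : Body d) : Set (E d)))⁻¹ *
        (∫⁻ x : E d, s (translate x C, ρ • W₁) ^ q) ∂(palm α X P)) atTop
        (𝓝 (∫⁻ C, traceMoment p k X₀ P C C ^ q ∂(palm α X P))) := by
      refine tendsto_lintegral_filter_of_dominated_convergence
        (fun C => traceMoment p k X₀ P C C ^ q) ?_ ?_ hfin.ne ?_
      · exact Eventually.of_forall fun ρ => (hG (ρ • W₁)).const_mul _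
      · filter_upwards [eventually_gt_atTop (0 : ℝ)] with ρ hρ
        filter_upwards [hbound (ρ • W₁)] with C hC
        calc _ ≤ (volume ((ρ • W₁ : Body d) : Set (E d)))⁻¹ *
              (volume ((ρ • W₁ : Body d) : Set (E d)) * traceMoment p k X₀ P C C ^ q) := by
              gcongr
          _ = _ := by
              rw [← mul_assoc, ENNReal.inv_mul_cancel (volume_smul_pos hr hW hρ).ne'
                (ρ • W₁ : Body d).isCompact.measure_lt_top.ne, one_mul]
      · filter_upwards [hpalm, hae] with C hC hlt
        refine tendsto_average hr hW (C := C) (h := fun ρ x => s (translate x C, ρ • W₁) ^ q)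
          (fun ρ _ => ?_) fun ρ _ x hx => ?_
        · rw [hGs _ C hC]
          exact hle C _ hC hlt
        · rw [hsC _ _ (hC.translate x), traceMoment_of_subset p hx,
            traceMoment_translate hT hX₀ hd hk p hC, translate_translate, neg_add_cancel,
            translate_zero]
    refine (ENNReal.Tendsto.const_mul hlim (Or.inr hγ)).congr' ?_
    filter_upwards [eventually_gt_atTop (0 : ℝ)] with ρ hρ
    rw [lintegral_const_mul' _ _ (hvi ρ hρ), hcampbell]
    ring

end averages

/-! ### Variances -/

section variance

variable {Ω : Type*} [MeasurableSpace Ω] {P : Measure Ω} {d k m : ℕ} {X X₀ : ℕ → Ω → Body d}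
  {Y : ℕ → ℕ → Ω → Body d} {α : Body d → E d}

lemma ae_lt_top_of_lintegral_sq {f : Ω → ℝ≥0∞} (hf : AEMeasurable f P)
    (h2 : ∫⁻ ω, f ω ^ 2 ∂P < ∞) : ∀ᵐ ω ∂P, f ω < ∞ := by
  filter_upwards [ae_lt_top' (hf.pow_const 2) h2.ne] with ω hω
  exact (ENNReal.pow_lt_top_iff.1 hω).resolve_right two_ne_zero

lemma memLp_toReal {f : Ω → ℝ≥0∞} (hf : AEMeasurable f P) (h2 : ∫⁻ ω, f ω ^ 2 ∂P < ∞) :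
    MemLp (fun ω => (f ω).toReal) 2 P := by
  rw [memLp_two_iff_integrable_sq hf.ennreal_toReal.aestronglyMeasurable]
  have := integrable_toReal_of_lintegral_ne_top (hf.pow_const 2) h2.ne
  simpa only [ENNReal.toReal_pow] using this

lemma traceMoment_self (p k : ℕ) (C : Body d) :
    traceMoment p k X₀ P C C = ∫⁻ ω, traceVolume k X₀ (faceUnion k C) ω ^ p ∂P := by
  rw [traceMoment, Set.inter_eq_left.2 (faceUnion_subset k C)]

lemma aemeasurable_traceVolume (hT : IsRandomTessellation X₀ P) (hd : 1 ≤ d) {C : Body d}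
    (hC : IsPolytopal C) : AEMeasurable (traceVolume k X₀ (faceUnion k C)) P :=
  hT.aemeasurable_facetUnion_inter hd (hC.isCompact_faceUnion k)

variable [IsProbabilityMeasure P]

lemma variance_toReal {f : Ω → ℝ≥0∞} (hf : AEMeasurable f P) (h2 : ∫⁻ ω, f ω ^ 2 ∂P < ∞) :
    variance (fun ω => (f ω).toReal) P =
      (∫⁻ ω, f ω ^ 2 ∂P).toReal - (∫⁻ ω, f ω ∂P).toReal ^ 2 := by
  rw [variance_eq_sub (memLp_toReal hf h2), integral_toReal hf (ae_lt_top_of_lintegral_sq hf h2),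
    ← integral_toReal (hf.pow_const 2) (ae_lt_top' (hf.pow_const 2) h2.ne)]
  simp only [Pi.pow_apply, ENNReal.toReal_pow]

lemma lintegral_lt_top_of_sq {f : Ω → ℝ≥0∞} (h2 : ∫⁻ ω, f ω ^ 2 ∂P < ∞) : ∫⁻ ω, f ω ∂P < ∞ := by
  have h1 : ∀ t : ℝ≥0∞, t ≤ 1 + t ^ 2 := by
    intro t
    rcases le_total t 1 with h | h
    · exact h.trans le_self_add
    · exact (le_self_pow h two_ne_zero).trans le_add_self
  calc ∫⁻ ω, f ω ∂P ≤ ∫⁻ ω, 1 + f ω ^ 2 ∂P := lintegral_mono fun ω => h1 _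
    _ = 1 + ∫⁻ ω, f ω ^ 2 ∂P := by rw [lintegral_add_left measurable_const]; simp
    _ < ∞ := ENNReal.add_lt_top.2 ⟨ENNReal.one_lt_top, h2⟩

lemma lintegral_sq_le {f : Ω → ℝ≥0∞} (hf : AEMeasurable f P) (h2 : ∫⁻ ω, f ω ^ 2 ∂P < ∞) :
    (∫⁻ ω, f ω ∂P) ^ 2 ≤ ∫⁻ ω, f ω ^ 2 ∂P := by
  have h := variance_nonneg (fun ω => (f ω).toReal) P
  rw [variance_toReal hf h2, sub_nonneg, ← ENNReal.toReal_pow] at h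
  exact (ENNReal.toReal_le_toReal (ENNReal.pow_ne_top (lintegral_lt_top_of_sq h2).ne) h2.ne).1 h

lemma traceVariance_eq (hT : IsRandomTessellation X₀ P) (hd : 1 ≤ d) {C : Body d}
    (hC : IsPolytopal C) (hfin : traceMoment 2 k X₀ P C C < ∞) :
    traceVariance k X₀ P C =
      (traceMoment 2 k X₀ P C C).toReal - (traceMoment 1 k X₀ P C C ^ 2).toReal := by
  rw [traceMoment_self] at hfin ⊢
  rw [traceVariance, variance_toReal (aemeasurable_traceVolume hT hd hC) hfin, traceMoment_self,
    ENNReal.toReal_pow]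
  simp only [pow_one]

lemma traceMoment_one_sq_le (hT : IsRandomTessellation X₀ P) (hd : 1 ≤ d) {C : Body d}
    (hC : IsPolytopal C) (hfin : traceMoment 2 k X₀ P C C < ∞) :
    traceMoment 1 k X₀ P C C ^ 2 ≤ traceMoment 2 k X₀ P C C := by
  rw [traceMoment_self] at hfin
  rw [traceMoment_self, traceMoment_self]
  simp only [pow_one]
  exact lintegral_sq_le (aemeasurable_traceVolume hT hd hC) hfin

/-- The variance of the trace on the typical cell is integrable, and its mean is the difference of
the means of the second moment and of the squared first moment. -/
lemma integral_traceVariance (hX : IsRandomTessellation X P) (hT : IsRandomTessellation X₀ P)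
    (hd : 1 ≤ d) (hk : k ≤ d) (hα : IsAssociatedPoint α)
    (hfin : ∫⁻ C, traceMoment 2 k X₀ P C C ∂(palm α X P) < ∞) :
    ∫⁻ C, traceMoment 1 k X₀ P C C ^ 2 ∂(palm α X P) < ∞ ∧
    Integrable (traceVariance k X₀ P) (palm α X P) ∧
    ∫ C, traceVariance k X₀ P C ∂(palm α X P) =
      (∫⁻ C, traceMoment 2 k X₀ P C C ∂(palm α X P)).toReal -
        (∫⁻ C, traceMoment 1 k X₀ P C C ^ 2 ∂(palm α X P)).toReal := by
  have hpalm := hX.ae_palm_isPolytopal hα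
  have hm : ∀ p, AEMeasurable (fun C => traceMoment p k X₀ P C C) (palm α X P) := by
    intro p
    obtain ⟨s, hs, hsC⟩ := exists_measurable_traceMoment hT hd hk p
    exact ⟨fun C => s (C, C), hs.comp (measurable_id.prodMk measurable_id),
      hpalm.mono fun C hC => (hsC C C hC).symm⟩
  have hae := ae_lt_top' (hm 2) hfin.ne
  have hle : ∀ᵐ C ∂(palm α X P), traceMoment 1 k X₀ P C C ^ 2 ≤ traceMoment 2 k X₀ P C C := by
    filter_upwards [hpalm, hae] with C hC hlt
    exact traceMoment_one_sq_le hT hd hC hlt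
  have h1 : ∫⁻ C, traceMoment 1 k X₀ P C C ^ 2 ∂(palm α X P) < ∞ :=
    (lintegral_mono_ae hle).trans_lt hfin
  have heq : traceVariance k X₀ P =ᵐ[palm α X P] fun C =>
      (traceMoment 2 k X₀ P C C).toReal - (traceMoment 1 k X₀ P C C ^ 2).toReal := by
    filter_upwards [hpalm, hae] with C hC hlt
    exact traceVariance_eq hT hd hC hlt
  have i2 := integrable_toReal_of_lintegral_ne_top (hm 2) hfin.ne
  have i1 := integrable_toReal_of_lintegral_ne_top ((hm 1).pow_const 2) h1.ne
  refine ⟨h1, (i2.sub i1).congr heq.symm, ?_⟩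
  rw [integral_congr_ae heq, integral_sub i2 i1, integral_toReal (hm 2) hae,
    integral_toReal ((hm 1).pow_const 2) (ae_lt_top' ((hm 1).pow_const 2) h1.ne)]

/-- The variance of `Z_k(W)` splits into the variance of its conditional expectation and the mean
of its conditional variance. -/
lemma IsNesting.variance_Z (hnest : IsNesting X X₀ Y P) (hX₀ : IsMotionInvariant X₀ P)
    (hk : k < d) (hl : traceIntensity k X₀ P < ∞) (hF : ConditionF k m X P) {W : Body d}
    (hW : 0 < volume (W : Set (E d))) (hV : ∫⁻ ω, facetVolume k X W ω ^ 2 ∂P < ∞)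
    (hA : ∫⁻ C, traceMoment 2 k X₀ P C W ∂(cellIntensityMeasure X P) < ∞) :
    (∀ᵐ ω ∂P, Z k X Y W ω < ∞) ∧ MemLp (fun ω => (Z k X Y W ω).toReal) 2 P ∧
    variance (fun ω => (Z k X Y W ω).toReal) P =
      ((∫⁻ C, traceMoment 2 k X₀ P C W ∂(cellIntensityMeasure X P)).toReal -
        (∫⁻ C, traceMoment 1 k X₀ P C W ^ 2 ∂(cellIntensityMeasure X P)).toReal) +
      ((traceIntensity k X₀ P).toReal * m) ^ 2 *
        variance (fun ω => (facetVolume k X W ω).toReal) P := by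
  obtain ⟨hZm, -, -⟩ := hnest.lintegral_Z (k := k) (by omega) hk.le W
  obtain ⟨e1, e2⟩ := hnest.moments_Z hX₀ hk hl hF hW
  have hVm := hF.aemeasurable_facetVolume hnest.initial hk.le hW
  have hlt : traceIntensity k X₀ P * m < ∞ := ENNReal.mul_lt_top hl (ENNReal.natCast_lt_top m)
  -- The finite side of the identity of second moments bounds both terms of the other side.
  have hlV := ENNReal.mul_lt_top (ENNReal.pow_lt_top (n := 2) hlt) hV
  have hsum := ENNReal.add_lt_top.2 ⟨hlV, hA⟩
  rw [← e2] at hsum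
  obtain ⟨hZ2, hB⟩ := ENNReal.add_lt_top.1 hsum
  refine ⟨ae_lt_top_of_lintegral_sq hZm hZ2, memLp_toReal hZm hZ2, ?_⟩
  rw [variance_toReal hZm hZ2, variance_toReal hVm hV, e1]
  have e3 := congrArg ENNReal.toReal e2
  rw [ENNReal.toReal_add hZ2.ne hB.ne, ENNReal.toReal_add hlV.ne hA.ne] at e3
  simp only [ENNReal.toReal_mul, ENNReal.toReal_pow, ENNReal.toReal_natCast] at e3 ⊢
  linear_combination e3

end variance

end Tess

theorem lemma5p1 {Ω : Type*} [MeasurableSpace Ω] (P : Measure Ω) [IsProbabilityMeasure P]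
    (d k m : ℕ) (hk : 1 ≤ k) (hkd : k ≤ d - 1)
    -- the nesting
    (X X₀ : ℕ → Ω → Tess.Body d) (Y : ℕ → ℕ → Ω → Tess.Body d)
    (hnest : Tess.IsNesting X X₀ Y P)
    (hX : Tess.IsStationary X P) (hX₀ : Tess.IsMotionInvariant X₀ P)
    (α : Tess.Body d → Tess.E d) (hα : Tess.IsAssociatedPoint α)
    (hF : Tess.ConditionF k m X P)
    -- finiteness of intensities and second moments
    (hγ0 : 0 < Tess.cellIntensity α X P) (hγ : Tess.cellIntensity α X P < ∞)
    (hμ : Tess.facetIntensity k X P < ∞) (hl : Tess.traceIntensity k X₀ P < ∞)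
    (hX2 : ∫⁻ ω, Tess.facetVolume k X (Tess.closedCube d) ω ^ 2 ∂P < ∞)
    (hC2 : ∫⁻ C, ∫⁻ ω, Tess.traceVolume k X₀ (Tess.faceUnion k C) ω ^ 2 ∂P ∂(Tess.palm α X P) < ∞)
    -- the windows `ρ • W₁` and the asymptotic variance of the `k`-facet process
    (W₁ : Tess.Body d) (r : ℝ) (hr : 0 < r) (hW : Metric.closedBall (0 : Tess.E d) r ⊆ W₁)
    (τsq : ℝ)
    (hτ : Tendsto (fun ρ : ℝ =>
        variance (fun ω => (Tess.facetVolume k X (ρ • (W₁ : Set (Tess.E d))) ω).toReal) P /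
          (volume (ρ • (W₁ : Set (Tess.E d)))).toReal) atTop (𝓝 τsq)) :
    (∀ ρ : ℝ, 0 < ρ →
      (∀ᵐ ω ∂P, Tess.Z k X Y (ρ • (W₁ : Set (Tess.E d))) ω < ∞) ∧
      MemLp (fun ω => (Tess.Z k X Y (ρ • (W₁ : Set (Tess.E d))) ω).toReal) 2 P) ∧
    Integrable (Tess.traceVariance k X₀ P) (Tess.palm α X P) ∧
    Tendsto (fun ρ : ℝ =>
        variance (fun ω => (Tess.Z k X Y (ρ • (W₁ : Set (Tess.E d))) ω).toReal) P /
          (volume (ρ • (W₁ : Set (Tess.E d)))).toReal) atTop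
      (𝓝 ((Tess.cellIntensity α X P).toReal *
            ∫ C, Tess.traceVariance k X₀ P C ∂(Tess.palm α X P) +
          ((Tess.traceIntensity k X₀ P).toReal * m) ^ 2 * τsq)) := by
  have hd : 1 ≤ d := by omega
  have hkd' : k < d := by omega
  have hfin : ∫⁻ C, Tess.traceMoment 2 k X₀ P C C ∂(Tess.palm α X P) < ∞ := by
    simpa only [Tess.traceMoment_self] using hC2
  obtain ⟨hfin1, hint, hintegral⟩ :=
    Tess.integral_traceVariance hnest.initial hnest.generic hd hkd'.le hα hfin
  obtain ⟨hA, hAlim⟩ := Tess.tendsto_lintegral_traceMoment hnest.initial hX hnest.generic hX₀ hd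
    hkd'.le hα hγ0.ne' hγ.ne (p := 2) (q := 1) one_ne_zero
    (fun C W hC hlt => by
      simpa only [pow_one] using
        Tess.lintegral_traceMoment_two_translate_le hnest.generic hX₀ hd hkd'.le hC hlt W)
    (by simpa only [pow_one] using hfin) hr hW
  obtain ⟨-, hBlim⟩ := Tess.tendsto_lintegral_traceMoment hnest.initial hX hnest.generic hX₀ hd
    hkd'.le hα hγ0.ne' hγ.ne (p := 1) (q := 2) two_ne_zero
    (fun C W hC hlt =>
      Tess.lintegral_traceMoment_one_sq_translate_le hnest.generic hX₀ hkd' hl hC hlt W)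
    hfin1 hr hW
  simp only [pow_one] at hA hAlim
  have hvar := fun (ρ : ℝ) (hρ : 0 < ρ) => hnest.variance_Z hX₀ hkd' hl hF
    (Tess.volume_smul_pos hr hW hρ)
    (hF.lintegral_facetVolume_sq_lt_top hnest.initial hX hkd'.le hX2 (ρ • W₁).isCompact)
    (hA (ρ • W₁))
  refine ⟨fun ρ hρ => ?_, hint, ?_⟩
  · have h := hvar ρ hρ
    rw [ConvexBody.coe_smul] at h
    exact ⟨h.1, h.2.1⟩
  · -- The conditional variances contribute the difference of these two limits, the conditional
    -- expectation contributes `(λ₀ m)² τ²`.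
    have hAr := (ENNReal.tendsto_toReal (ENNReal.mul_lt_top hγ hfin).ne).comp hAlim
    have hBr := (ENNReal.tendsto_toReal (ENNReal.mul_lt_top hγ hfin1).ne).comp hBlim
    have hlim := (hAr.sub hBr).add (hτ.const_mul (((Tess.traceIntensity k X₀ P).toReal * m) ^ 2))
    rw [hintegral, mul_sub]
    simp only [ENNReal.toReal_mul] at hlim
    refine hlim.congr' ?_
    filter_upwards [eventually_gt_atTop (0 : ℝ)] with ρ hρ
    have h := (hvar ρ hρ).2.2
    simp only [ConvexBody.coe_smul] at h
    simp only [Function.comp_apply, ENNReal.toReal_mul, ENNReal.toReal_inv, ConvexBody.coe_smul]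
    rw [h]
    ring
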